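/- An \emph{amalgam of groups} is a set $\mathcal{A}$ with a partial multiplication and a family of subsets $(H_j)_{j\in J}$ covering $\mathcal{A}$ such that $ab$ is defined if and only if $a,b\in H_j$ for some $j$, each $H_j$ is a group under this multiplication, and $H_i\cap H_j$ is a subgroup of both $H_i$ and $H_j$ for all $i,j$. A \emph{completion} of $\mathcal{A}$ is a map $\pi$ from $\mathcal{A}$ to a group $G$ whose restriction to every $H_j$ is a homomorphism and whose image generates $G$. An \emph{isomorphism} of amalgams with the same index set is a bijection that respects the partial multiplications and maps each member onto the member with the same index. Let $\Delta$ be one of the irreducible Dynkin diagrams $A_3$, $B_3$, $C_3$ of rank three, with nodes $1,2,3$ in order along the diagram, where the node $3$ is the short root for $B_3$ and the long root for $C_3$. Let $K$ be the corresponding simply connected compact almost simple Lie group, that is, $K=\mathrm{SU}_4(\mathbb{C})$, $\mathrm{Spin}_7(\mathbb{R})$, $\mathrm{U}_3(\mathbb{H})$, respectively. Fix the standard maximal torus of $K$ and the standard system of simple roots $\alpha_1,\alpha_2,\alpha_3$, let $G_i\cong\mathrm{SU}_2(\mathbb{C})$ be the rank one subgroup of $K$ belonging to $\alpha_i$, and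 let $G_{ij}=\langle G_i,G_j\rangle$ (so $G_{ii}=G_i$). The \emph{standard Phan amalgam} of type $\Delta$ is the amalgam $(G_{ij})_{1\le i\le j\le 3}$ of these subgroups of $K$, with underlying set $\bigcup_{i,j}G_{ij}$. A \emph{Phan amalgam} of type $\Delta$ is an amalgam $\mathcal{A}=(L_{ij})_{1\le i\le j\le 3}$ such that, with $L_{ji}=L_{ij}$ and $L_i=L_{ii}$, for all $i,j$ there is an epimorphism $G_{ij}\to L_{ij}$ with central kernel that maps $G_i$ onto $L_i$ and $G_j$ onto $L_j$. It is \emph{unambiguous} if $L_{ij}\cong G_{ij}$ as groups for all $i,j$, and \emph{strongly noncollapsing} if it has a completion $\pi$ such that for each $i$ the kernel of $\pi|_{L_i}$ is contained in the center of $L_i$. \textbf{Proposition.} Let $\Delta\in\{A_3,B_3,C_3\}$. Every strongly noncollapsing unambiguous Phan amalgam of type $\Delta$ is isomorphic to the standard Phan amalgam of type $\Delta$. -/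

import Mathlib

universe u v w

/-- An amalgam of groups: a set with a partial multiplication and a family of subsets, the members,
covering it, such that a product is defined exactly when both factors lie in a common member, the
multiplication makes each member a group, and the intersection of any two members is a subgroup of
each of them. -/
structure GroupAmalgam (J : Type v) where
  /-- the underlying set -/
  carrier : Type u
  /-- the partial multiplication -/
  mul : carrier → carrier → Part carrier
  /-- the members of the amalgam -/
  member : J → Set carrier
  exists_mem_member : ∀ a, ∃ j, a ∈ member j
  mul_dom_iff : ∀ a b, (mul a b).Dom ↔ ∃ j, a ∈ member j ∧ b ∈ member j
  [grp : ∀ j, Group (member j)]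
  coe_mul_mem : ∀ j (a b : member j), ((a * b : member j) : carrier) ∈ mul a b
  inter_subgroup : ∀ i j, ∃ K : Subgroup (member i), ∀ x : member i,
    x ∈ K ↔ (x : carrier) ∈ member j

attribute [instance] GroupAmalgam.grp

namespace GroupAmalgam

/-- An isomorphism of amalgams over the same index set: a bijection of the underlying sets that
carries each member onto the member with the same index and respects the partial multiplication. -/
structure Iso {J : Type v} (A : GroupAmalgam.{u} J) (B : GroupAmalgam.{w} J) where
  /-- the underlying bijection -/
  toEquiv : A.carrier ≃ B.carrier
  image_member : ∀ j, toEquiv '' A.member j = B.member j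
  map_mul : ∀ a b, (A.mul a b).map toEquiv = B.mul (toEquiv a) (toEquiv b)

/-- The map `π` from the amalgam to the group `H` exhibits `H` as a completion: it restricts to a
homomorphism on every member, and its image generates `H`. -/
structure IsCompletion {J : Type v} (A : GroupAmalgam.{u} J) {H : Type w} [Group H]
    (π : A.carrier → H) : Prop where
  map_mul : ∀ j (a b : A.member j), π ((a * b : A.member j) : A.carrier) = π a * π b
  closure_range : Subgroup.closure (Set.range π) = ⊤

/-- The subgroup `H j`, regarded as a subset of the union of the family `H`, is a group. -/
abbrev memberGroup {J : Type v} {G : Type u} [Group G] (H : J → Subgroup G) (j : J) :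
    Group {a : {g : G // ∃ j, g ∈ H j} | a.1 ∈ H j} where
  mul a b := ⟨⟨a.1.1 * b.1.1, j, (H j).mul_mem a.2 b.2⟩, (H j).mul_mem a.2 b.2⟩
  one := ⟨⟨1, j, (H j).one_mem⟩, (H j).one_mem⟩
  inv a := ⟨⟨a.1.1⁻¹, j, (H j).inv_mem a.2⟩, (H j).inv_mem a.2⟩
  mul_assoc _ _ _ := Subtype.ext (Subtype.ext (mul_assoc _ _ _))
  one_mul _ := Subtype.ext (Subtype.ext (one_mul _))
  mul_one _ := Subtype.ext (Subtype.ext (mul_one _))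
  inv_mul_cancel _ := Subtype.ext (Subtype.ext (inv_mul_cancel _))

/-- The amalgam formed by a family of subgroups of a group `G`: its underlying set is the union of
these subgroups, and two elements may be multiplied when they lie in a common one. -/
def ofSubgroups {J : Type v} {G : Type u} [Group G] (H : J → Subgroup G) : GroupAmalgam.{u} J where
  carrier := {g : G // ∃ j, g ∈ H j}
  mul a b := ⟨∃ j, a.1 ∈ H j ∧ b.1 ∈ H j,
    fun h => ⟨a.1 * b.1, h.imp fun j hj => (H j).mul_mem hj.1 hj.2⟩⟩
  member j := {a | a.1 ∈ H j}
  exists_mem_member a := a.2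
  mul_dom_iff _ _ := Iff.rfl
  grp j := memberGroup H j
  coe_mul_mem j a b := ⟨⟨j, a.2, b.2⟩, rfl⟩
  inter_subgroup i j :=
    letI := memberGroup H i
    ⟨{ carrier := {x | x.1.1 ∈ H j}
       mul_mem' := fun ha hb => (H j).mul_mem ha hb
       one_mem' := (H j).one_mem
       inv_mem' := fun ha => (H j).inv_mem ha }, fun _ => Iff.rfl⟩

end GroupAmalgam

/-! Amalgams of rank one and rank two groups over a set `I` of simple roots. They are indexed by
the unordered pairs `s(i, j)`; the pair `s(i, i)` is the index of the rank one member `L i`, and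
`s(i, j)` with `i ≠ j` that of the rank two member `L i j`. -/

/-- The group `G i j` generated by `R i` and `R j`; in particular `G i i = R i`. -/
def pairSubgroup {I : Type v} {G : Type u} [Group G] (R : I → Subgroup G) :
    Sym2 I → Subgroup G :=
  Sym2.lift ⟨fun i j => R i ⊔ R j, fun _ _ => sup_comm _ _⟩

/-- The amalgam of the rank one groups `R i` and the rank two groups generated by pairs of them. -/
def standardAmalgam {I : Type v} {G : Type u} [Group G] (R : I → Subgroup G) :
    GroupAmalgam.{u} (Sym2 I) :=
  GroupAmalgam.ofSubgroups (pairSubgroup R)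

/-- `A` is a Phan amalgam for the system `R` of simple root subgroups: each member `L i j` is a
central quotient of `G i j`, by an epimorphism that carries `R i` onto `L i` and `R j` onto
`L j`. -/
def IsPhanAmalgam {I : Type v} {G : Type u} [Group G] (R : I → Subgroup G)
    (A : GroupAmalgam.{w} (Sym2 I)) : Prop :=
  ∀ i j, ∃ f : pairSubgroup R s(i, j) →* A.member s(i, j),
    Function.Surjective f ∧ f.ker ≤ Subgroup.center (pairSubgroup R s(i, j)) ∧
    (fun x => (f x : A.carrier)) '' {x | (x : G) ∈ R i} = A.member s(i, i) ∧
    (fun x => (f x : A.carrier)) '' {x | (x : G) ∈ R j} = A.member s(j, j)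

/-- A Phan amalgam is unambiguous if each of its members `L i j` is isomorphic to `G i j`. -/
def IsUnambiguous {I : Type v} {G : Type u} [Group G] (R : I → Subgroup G)
    (A : GroupAmalgam.{w} (Sym2 I)) : Prop :=
  ∀ i j, Nonempty (A.member s(i, j) ≃* pairSubgroup R s(i, j))

/-- There is a completion whose restriction to each rank one member `L i` has central kernel.
A completion is generated by the image of the amalgam, so no generality is lost by taking it in the
universe of the amalgam. -/
def IsStronglyNoncollapsing {I : Type v} (A : GroupAmalgam.{u} (Sym2 I)) : Prop :=
  ∃ (H : Type u) (_ : Group H) (π : A.carrier → H), A.IsCompletion π ∧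
    ∀ i, ∀ x : A.member s(i, i), π x = 1 → x ∈ Subgroup.center (A.member s(i, i))

/-! The simple root subgroups of the simply connected compact almost simple Lie groups of rank
three. -/

/-- The simple root subgroups of `SU (n + 1)` for the diagonal torus: the `i`-th one is the copy of
`SU 2` acting on the coordinates `i` and `i + 1` and fixing the other basis vectors. -/
def suRootSubgroup (n : ℕ) (i : Fin n) :
    Subgroup (Matrix.specialUnitaryGroup (Fin (n + 1)) ℂ) where
  carrier := {g | ∀ k, k ≠ i.castSucc → k ≠ i.succ →
    (g : Matrix (Fin (n + 1)) (Fin (n + 1)) ℂ).mulVec (Pi.single k 1) = Pi.single k 1}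
  mul_mem' {a b} ha hb k h1 h2 := by
    rw [Submonoid.coe_mul, ← Matrix.mulVec_mulVec, hb k h1 h2, ha k h1 h2]
  one_mem' k _ _ := by rw [Submonoid.coe_one, Matrix.one_mulVec]
  inv_mem' {a} ha k h1 h2 := by
    have h := congrArg (((a⁻¹ : Matrix.specialUnitaryGroup (Fin (n + 1)) ℂ) :
      Matrix (Fin (n + 1)) (Fin (n + 1)) ℂ).mulVec) (ha k h1 h2)
    rw [Matrix.mulVec_mulVec, ← Submonoid.coe_mul, inv_mul_cancel, Submonoid.coe_one,
      Matrix.one_mulVec] at h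
    exact h.symm

/-- The quaternionic unitary group `U_n(ℍ)`, the compact form of type `C_n`. -/
abbrev QuaternionicUnitaryGroup (n : ℕ) : Type :=
  unitary (Matrix (Fin n) (Fin n) (Quaternion ℝ))

/-- The inclusion of `SU n` in `U_n(ℍ)` induced by the inclusion of `ℂ` in `ℍ`. -/
noncomputable def suToQuaternionic (n : ℕ) :
    Matrix.specialUnitaryGroup (Fin n) ℂ →* QuaternionicUnitaryGroup n where
  toFun g := ⟨(g : Matrix (Fin n) (Fin n) ℂ).map Quaternion.ofComplex, by
    have hs : star ((g : Matrix (Fin n) (Fin n) ℂ).map Quaternion.ofComplex) =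
        (star (g : Matrix (Fin n) (Fin n) ℂ)).map Quaternion.ofComplex := by
      ext i j <;> simp [Matrix.star_eq_conjTranspose]
    have hg := Matrix.specialUnitaryGroup_le_unitaryGroup g.2
    rw [Unitary.mem_iff, hs]
    constructor
    · rw [← Matrix.map_mul, (Unitary.mem_iff.1 hg).1]
      exact Matrix.map_one _ (map_zero _) (map_one _)
    · rw [← Matrix.map_mul, (Unitary.mem_iff.1 hg).2]
      exact Matrix.map_one _ (map_zero _) (map_one _)⟩
  map_one' := Subtype.ext (Matrix.map_one _ (map_zero _) (map_one _))
  map_mul' a b := Subtype.ext Matrix.map_mul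

/-- The simple root subgroups of `U_3(ℍ)` for the torus of complex diagonal matrices: the short
simple roots give the two simple root subgroups of `SU 3`, the long one gives the copy of `U_1(ℍ)`
acting on the last coordinate. -/
noncomputable def quaternionicRootSubgroup : Fin 3 → Subgroup (QuaternionicUnitaryGroup 3)
  | 0 => (suRootSubgroup 2 0).map (suToQuaternionic 3)
  | 1 => (suRootSubgroup 2 1).map (suToQuaternionic 3)
  | 2 =>
    { carrier := {g | ∀ k, k ≠ 2 →
        (g : Matrix (Fin 3) (Fin 3) (Quaternion ℝ)).mulVec (Pi.single k 1) = Pi.single k 1}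
      mul_mem' := fun {a b} ha hb k hk => by
        rw [Submonoid.coe_mul, ← Matrix.mulVec_mulVec, hb k hk, ha k hk]
      one_mem' := fun k _ => by rw [Submonoid.coe_one, Matrix.one_mulVec]
      inv_mem' := fun {a} ha k hk => by
        have h := congrArg (((a⁻¹ : QuaternionicUnitaryGroup 3) :
          Matrix (Fin 3) (Fin 3) (Quaternion ℝ)).mulVec) (ha k hk)
        rw [Matrix.mulVec_mulVec, ← Submonoid.coe_mul, inv_mul_cancel, Submonoid.coe_one,
          Matrix.one_mulVec] at h
        exact h.symm }

/-- The standard positive definite quadratic form on `ℝ^7`. -/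
def sumSquares7 : QuadraticForm ℝ (Fin 7 → ℝ) :=
  QuadraticMap.weightedSumSquares ℝ (fun _ : Fin 7 => (1 : ℝ))

/-- The compact spin group `Spin(7)`. -/
abbrev Spin7 : Type := spinGroup sumSquares7

/-- The element `exp (t e_a e_b) = cos t + sin t e_a e_b` of the Clifford algebra, where `e` is the
standard basis of `ℝ^7` and `a ≠ b`. -/
noncomputable def spinRotor (a b : Fin 7) (t : ℝ) : CliffordAlgebra sumSquares7 :=
  algebraMap ℝ (CliffordAlgebra sumSquares7) (Real.cos t) +
    Real.sin t • (CliffordAlgebra.ι sumSquares7 (Pi.single a 1) *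
      CliffordAlgebra.ι sumSquares7 (Pi.single b 1))

/-- The simple root subgroups of `Spin(7)` for the torus generated by the bivectors `e_0 e_1`,
`e_2 e_3`, `e_4 e_5`, with simple roots `ε_0 - ε_1`, `ε_1 - ε_2` (long) and `ε_2` (short).
Each one is generated by the one-parameter groups of two elements that span the intersection of the
Lie algebra with the sum of the root spaces of the root and of its negative: for the long roots these
are `e_a e_(a+2) + e_(a+1) e_(a+3)` and `e_a e_(a+3) - e_(a+1) e_(a+2)` with `a = 0, 2`, and for
the short root they are `e_4 e_6` and `e_5 e_6`. -/
noncomputable def spinRootSubgroup : Fin 3 → Subgroup Spin7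
  | 0 => Subgroup.closure {x | ∃ t : ℝ,
      (x : CliffordAlgebra sumSquares7) = spinRotor 0 2 t * spinRotor 1 3 t ∨
      (x : CliffordAlgebra sumSquares7) = spinRotor 0 3 t * spinRotor 1 2 (-t)}
  | 1 => Subgroup.closure {x | ∃ t : ℝ,
      (x : CliffordAlgebra sumSquares7) = spinRotor 2 4 t * spinRotor 3 5 t ∨
      (x : CliffordAlgebra sumSquares7) = spinRotor 2 5 t * spinRotor 3 4 (-t)}
  | 2 => Subgroup.closure {x | ∃ t : ℝ,
      (x : CliffordAlgebra sumSquares7) = spinRotor 4 6 t ∨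
      (x : CliffordAlgebra sumSquares7) = spinRotor 5 6 t}

/-- The irreducible Dynkin diagrams of rank three. The nodes are `0`, `1`, `2` in this order along
the diagram; in type `B₃` the node `2` is the short root, in type `C₃` it is the long one. -/
inductive DiagramRankThree where
  | A₃ : DiagramRankThree
  | B₃ : DiagramRankThree
  | C₃ : DiagramRankThree

/-- The simply connected compact almost simple Lie group with the given diagram: `SU(4)`, `Spin(7)`
or `U_3(ℍ)`. -/
def DiagramRankThree.CompactGroup : DiagramRankThree → Type
  | .A₃ => Matrix.specialUnitaryGroup (Fin 4) ℂ
  | .B₃ => Spin7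
  | .C₃ => QuaternionicUnitaryGroup 3

noncomputable instance DiagramRankThree.instGroupCompactGroup :
    (Δ : DiagramRankThree) → Group Δ.CompactGroup
  | .A₃ => inferInstanceAs (Group (Matrix.specialUnitaryGroup (Fin 4) ℂ))
  | .B₃ => inferInstanceAs (Group Spin7)
  | .C₃ => inferInstanceAs (Group (QuaternionicUnitaryGroup 3))

/-- The simple root subgroups of the compact group with the given diagram. -/
noncomputable def DiagramRankThree.rootSubgroup :
    (Δ : DiagramRankThree) → Fin 3 → Subgroup Δ.CompactGroup
  | .A₃ => suRootSubgroup 3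
  | .B₃ => spinRootSubgroup
  | .C₃ => quaternionicRootSubgroup

/-! Every rank one group here is a copy of the group of unit quaternions, that is, SU(2). A rank two
epimorphism with central kernel onto a group abstractly isomorphic to its source is injective,
because the source is perfect with finite center (`injective_of_ker_le_center`). So the members with
indices (0,1), (1,2), (0,2) are SU(3), a group M generated by two copies of SU(2), and SU(2) ×
SU(2). Only the way they are glued along the rank one members is in question.

The gluing along nodes 0 and 2 is harmless: it is absorbed by automorphisms of the two factors of
SU(2) × SU(2). What remains is an automorphism α of SU(2) comparing the two parametrizations of the
middle rank one member, one from SU(3) and one from M. It is absorbed as well once it extends to an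
automorphism of SU(3) preserving the first root subgroup.

Two facts give this extension. First, α i = i or α i = -i (`Parametrization.map_i_eq`): an element
of the node 0 torus acts on the middle member as conjugation by e = e^(iπ/4), an element of the node
2 torus acts as conjugation by α(e), and the two elements commute because they lie in the two
factors of the (0,2) member. To compose the two actions one works in a completion; strong
noncollapsing says that nothing beyond the center is lost there, so e and α(e) commute up to sign.
Second, an abstract endomorphism of SU(2) fixing -1 preserves real parts (`UnitQuaternion.re_map`),
although no continuity is assumed: having nonnegative real part is expressible by commutators, and
repeated squaring then determines the angle. Hence α is conjugation by a torus element, possibly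
combined with conjugation by j. On SU(3) these are induced by a diagonal matrix and by complex
conjugation (`SU3.exists_extension`).

The axioms of an amalgam do not say that two rank two members meet only in the expected rank one
member. This is proved in `Realization.eq_of_f_upper_eq_g` and its corollaries, from the few
properties of the pair of root subgroups of M collected in `IsRankTwoModel`. Then all
identifications are forced, and amalgams with the same gluing data are isomorphic
(`Realization.nonempty_iso`).

The compact groups enter through `RootEmbedding`: block matrices for SU(4) and U_3(ℍ), and explicit
matrix units in the Clifford algebra for Spin(7). -/

open Quaternion in
/-- The group of unit quaternions. -/
abbrev UnitQuaternion : Type := unitary (Quaternion ℝ)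

/-! ### Unit quaternions: coordinates and conjugacy. -/

namespace UnitQuaternion

/-- The real part. -/
def re (x : UnitQuaternion) : ℝ := x.1.re
/-- The `i`-coordinate. -/
def imI (x : UnitQuaternion) : ℝ := x.1.imI
/-- The `j`-coordinate. -/
def imJ (x : UnitQuaternion) : ℝ := x.1.imJ
/-- The `k`-coordinate. -/
def imK (x : UnitQuaternion) : ℝ := x.1.imK

theorem ext_iff' {x y : UnitQuaternion} : x = y ↔ x.re = y.re ∧ x.imI = y.imI ∧
    x.imJ = y.imJ ∧ x.imK = y.imK := by
  rw [Subtype.ext_iff, Quaternion.ext_iff]; rfl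

theorem sum_sq (x : UnitQuaternion) :
    x.re ^ 2 + x.imI ^ 2 + x.imJ ^ 2 + x.imK ^ 2 = 1 := by
  have h := (Unitary.mem_iff.1 x.2).2
  rw [Quaternion.self_mul_star, Quaternion.normSq_def'] at h
  exact Quaternion.coe_inj.1 h

/-- The quaternion with the given coordinates. -/
def quat (a b c d : ℝ) : Quaternion ℝ := ⟨a, b, c, d⟩

@[simp] theorem re_quat (a b c d : ℝ) : (quat a b c d).re = a := rfl
@[simp] theorem imI_quat (a b c d : ℝ) : (quat a b c d).imI = b := rfl
@[simp] theorem imJ_quat (a b c d : ℝ) : (quat a b c d).imJ = c := rfl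
@[simp] theorem imK_quat (a b c d : ℝ) : (quat a b c d).imK = d := rfl

theorem mem_unitary_iff {q : Quaternion ℝ} :
    q ∈ unitary (Quaternion ℝ) ↔ q.re ^ 2 + q.imI ^ 2 + q.imJ ^ 2 + q.imK ^ 2 = 1 := by
  rw [Unitary.mem_iff, Quaternion.self_mul_star, Quaternion.star_mul_self, and_self,
    Quaternion.normSq_def', ← Quaternion.coe_one, Quaternion.coe_inj]

/-- The unit quaternion with the given coordinates. -/
def mk (a b c d : ℝ) (h : a ^ 2 + b ^ 2 + c ^ 2 + d ^ 2 = 1) : UnitQuaternion :=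
  ⟨quat a b c d, mem_unitary_iff.2 h⟩

theorem exists_eq_mk (x : UnitQuaternion) : ∃ a b c d h, x = mk a b c d h :=
  ⟨_, _, _, _, x.sum_sq, rfl⟩

theorem coe_mk (a b c d : ℝ) (h) : (mk a b c d h).1 = quat a b c d := rfl

section
variable (a b c d : ℝ) (h : a ^ 2 + b ^ 2 + c ^ 2 + d ^ 2 = 1)
@[simp] theorem re_mk : (mk a b c d h).re = a := rfl
@[simp] theorem imI_mk : (mk a b c d h).imI = b := rfl
@[simp] theorem imJ_mk : (mk a b c d h).imJ = c := rfl
@[simp] theorem imK_mk : (mk a b c d h).imK = d := rfl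
end

section
variable (x y : UnitQuaternion)
@[simp] theorem re_mul : (x * y).re =
    x.re * y.re - x.imI * y.imI - x.imJ * y.imJ - x.imK * y.imK :=
  Quaternion.re_mul _ _
@[simp] theorem imI_mul : (x * y).imI =
    x.re * y.imI + x.imI * y.re + x.imJ * y.imK - x.imK * y.imJ :=
  Quaternion.imI_mul _ _
@[simp] theorem imJ_mul : (x * y).imJ =
    x.re * y.imJ - x.imI * y.imK + x.imJ * y.re + x.imK * y.imI :=
  Quaternion.imJ_mul _ _
@[simp] theorem imK_mul : (x * y).imK =
    x.re * y.imK + x.imI * y.imJ - x.imJ * y.imI + x.imK * y.re :=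
  Quaternion.imK_mul _ _
@[simp] theorem re_inv : (x⁻¹).re = x.re := by
  rw [← Unitary.star_eq_inv]; exact Quaternion.re_star x.1
@[simp] theorem imI_inv : (x⁻¹).imI = -x.imI := by
  rw [← Unitary.star_eq_inv]; exact Quaternion.imI_star x.1
@[simp] theorem imJ_inv : (x⁻¹).imJ = -x.imJ := by
  rw [← Unitary.star_eq_inv]; exact Quaternion.imJ_star x.1
@[simp] theorem imK_inv : (x⁻¹).imK = -x.imK := by
  rw [← Unitary.star_eq_inv]; exact Quaternion.imK_star x.1
@[simp] theorem re_one : (1 : UnitQuaternion).re = 1 := rfl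
@[simp] theorem imI_one : (1 : UnitQuaternion).imI = 0 := rfl
@[simp] theorem imJ_one : (1 : UnitQuaternion).imJ = 0 := rfl
@[simp] theorem imK_one : (1 : UnitQuaternion).imK = 0 := rfl
@[simp] theorem re_neg : (-x).re = -x.re := rfl
@[simp] theorem imI_neg : (-x).imI = -x.imI := rfl
@[simp] theorem imJ_neg : (-x).imJ = -x.imJ := rfl
@[simp] theorem imK_neg : (-x).imK = -x.imK := rfl
end

/-- The unit quaternion `i`. -/
def i : UnitQuaternion := mk 0 1 0 0 (by norm_num)
/-- The unit quaternion `j`. -/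
def j : UnitQuaternion := mk 0 0 1 0 (by norm_num)
/-- The unit quaternion `k`. -/
def k : UnitQuaternion := mk 0 0 0 1 (by norm_num)

/-- The circle subgroup of unit quaternions lying in `ℂ`. -/
def torus : Subgroup UnitQuaternion where
  carrier := {x | x.imJ = 0 ∧ x.imK = 0}
  mul_mem' {a b} ha hb := by
    obtain ⟨h1, h2⟩ := ha
    obtain ⟨h3, h4⟩ := hb
    simp [h1, h2, h3, h4]
  one_mem' := by simp
  inv_mem' {a} ha := by
    obtain ⟨h1, h2⟩ := ha
    simp [h1, h2]

theorem mem_torus {x : UnitQuaternion} : x ∈ torus ↔ x.imJ = 0 ∧ x.imK = 0 := Iff.rfl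

theorem re_le_one (x : UnitQuaternion) : x.re ≤ 1 := by
  nlinarith [x.sum_sq, sq_nonneg x.imI, sq_nonneg x.imJ, sq_nonneg x.imK]

theorem neg_one_le_re (x : UnitQuaternion) : -1 ≤ x.re := by
  nlinarith [x.sum_sq, sq_nonneg x.imI, sq_nonneg x.imJ, sq_nonneg x.imK]

theorem eq_one_iff {x : UnitQuaternion} : x = 1 ↔ x.re = 1 := by
  refine ⟨fun h => by rw [h]; rfl, fun h => ?_⟩
  have hs := x.sum_sq
  rw [h] at hs
  have h1 : x.imI = 0 := by
    nlinarith [sq_nonneg x.imI, sq_nonneg x.imJ, sq_nonneg x.imK]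
  have h2 : x.imJ = 0 := by
    nlinarith [sq_nonneg x.imI, sq_nonneg x.imJ, sq_nonneg x.imK]
  have h3 : x.imK = 0 := by
    nlinarith [sq_nonneg x.imI, sq_nonneg x.imJ, sq_nonneg x.imK]
  simp [ext_iff', h, h1, h2, h3]

theorem re_mul_self (x : UnitQuaternion) : (x * x).re = 2 * x.re ^ 2 - 1 := by
  simp only [re_mul]
  linarith [x.sum_sq]

theorem sq_eq_one {x : UnitQuaternion} (h : x * x = 1) : x = 1 ∨ x = -1 := by
  have h1 : (x * x).re = 1 := by rw [h]; rfl
  rw [re_mul_self] at h1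
  have h2 : (x.re - 1) * (x.re + 1) = 0 := by linarith
  rcases mul_eq_zero.1 h2 with h3 | h3
  · exact Or.inl (eq_one_iff.2 (by linarith))
  · refine Or.inr (neg_eq_iff_eq_neg.1 (eq_one_iff.2 ?_))
    simp only [re_neg]
    linarith

theorem sq_eq_neg_one {x : UnitQuaternion} : x * x = -1 ↔ x.re = 0 := by
  rw [← neg_eq_iff_eq_neg, eq_one_iff, re_neg, re_mul_self]
  constructor
  · intro h
    exact pow_eq_zero_iff two_ne_zero |>.1 (by linarith)
  · intro h
    rw [h]
    norm_num

theorem one_ne_neg_one : (1 : UnitQuaternion) ≠ -1 := by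
  intro h
  have := (ext_iff'.1 h).1
  norm_num at this

theorem exists_normalize (g : Quaternion ℝ) (hg : g ≠ 0) (x y : UnitQuaternion)
    (h : g * x.1 = y.1 * g) : ∃ u : UnitQuaternion, u * x = y * u := by
  have hn : Quaternion.normSq g ≠ 0 := Quaternion.normSq_eq_zero.not.2 hg
  have hp : 0 < Quaternion.normSq g := lt_of_le_of_ne Quaternion.normSq_nonneg hn.symm
  set c : ℝ := (Real.sqrt (Quaternion.normSq g))⁻¹ with hc
  have hc2 : c ^ 2 * Quaternion.normSq g = 1 := by
    rw [hc, inv_pow, Real.sq_sqrt hp.le, inv_mul_cancel₀ hn]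
  refine ⟨⟨c • g, ?_⟩, ?_⟩
  · rw [Unitary.mem_iff, Quaternion.self_mul_star, Quaternion.star_mul_self,
      Quaternion.normSq_smul, hc2]
    simp
  · apply Subtype.ext
    change (c • g) * x.1 = y.1 * (c • g)
    rw [smul_mul_assoc, mul_smul_comm, h]

/-- The equation g x = y g is linear in g over the quaternions, so it suffices to exhibit one
nonzero solution and normalize it. -/
theorem exists_conj_of_re_eq (x y : UnitQuaternion) (h : x.re = y.re) :
    ∃ u : UnitQuaternion, u * x = y * u := by
  by_contra! hne
  have key : ∀ g : Quaternion ℝ, g * x.1 = y.1 * g → g = 0 := by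
    intro g hg
    by_contra hg0
    obtain ⟨u, hu⟩ := exists_normalize g hg0 x y hg
    exact hne u hu
  have hx := x.sum_sq
  have hy := y.sum_sq
  have hxy : x ≠ y := fun e => hne 1 (by rw [e, one_mul, mul_one])
  rw [Ne, ext_iff'] at hxy
  clear hne
  obtain ⟨a, b, c, d, _, rfl⟩ := x.exists_eq_mk
  obtain ⟨a', b', c', d', _, rfl⟩ := y.exists_eq_mk
  simp only [re_mk, imI_mk, imJ_mk, imK_mk] at h hx hy hxy
  subst h
  have hv : b ^ 2 + c ^ 2 + d ^ 2 = b' ^ 2 + c' ^ 2 + d' ^ 2 := by linarith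
  -- With v, v' the imaginary parts, this is g = |v|² - v'v, which satisfies g v = v' g since |v| =
  -- |v'|. Its real part is |v + v'|² / 2, so it vanishes only for v' = -v.
  have k1 := key (quat (b ^ 2 + c ^ 2 + d ^ 2 + (b * b' + c * c' + d * d')) (-(c' * d - d' * c))
    (-(d' * b - b' * d)) (-(b' * c - c' * b))) (by
      rw [Quaternion.ext_iff]
      simp only [Quaternion.re_mul, Quaternion.imI_mul, Quaternion.imJ_mul, Quaternion.imK_mul,
        re_quat, imI_quat, imJ_quat, imK_quat, coe_mk]
      refine ⟨?_, ?_, ?_, ?_⟩ <;> grind)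
  have hre := congrArg QuaternionAlgebra.re k1
  simp only [re_quat, Quaternion.re_zero] at hre
  have hb : b' = -b := by nlinarith [sq_nonneg (b + b'), sq_nonneg (c + c'), sq_nonneg (d + d')]
  have hc : c' = -c := by nlinarith [sq_nonneg (b + b'), sq_nonneg (c + c'), sq_nonneg (d + d')]
  have hd : d' = -d := by nlinarith [sq_nonneg (b + b'), sq_nonneg (c + c'), sq_nonneg (d + d')]
  subst hb hc hd
  -- When v' = -v, any imaginary quaternion orthogonal to v anticommutes with v. This one and the
  -- next vanish together only for v = 0, that is, x = y.
  have k2 := key (quat 0 0 (-d) c) (by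
    rw [Quaternion.ext_iff]
    simp only [Quaternion.re_mul, Quaternion.imI_mul, Quaternion.imJ_mul, Quaternion.imK_mul,
      re_quat, imI_quat, imJ_quat, imK_quat, coe_mk]
    refine ⟨?_, ?_, ?_, ?_⟩ <;> ring)
  have k3 := key (quat 0 (-c) b 0) (by
    rw [Quaternion.ext_iff]
    simp only [Quaternion.re_mul, Quaternion.imI_mul, Quaternion.imJ_mul, Quaternion.imK_mul,
      re_quat, imI_quat, imJ_quat, imK_quat, coe_mk]
    refine ⟨?_, ?_, ?_, ?_⟩ <;> ring)
  have h1 : -d = 0 := congrArg QuaternionAlgebra.imJ k2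
  have h2 : c = 0 := congrArg QuaternionAlgebra.imK k2
  have h3 : b = 0 := congrArg QuaternionAlgebra.imJ k3
  exact hxy ⟨rfl, by simp [h3], by simp [h2], by linarith⟩

end UnitQuaternion

/-! ### Commutators, and endomorphisms of SU(2) without continuity. -/

namespace UnitQuaternion

theorem exists_orthogonal (x : UnitQuaternion) : ∃ n : UnitQuaternion, n.re = 0 ∧
    n.imI * x.imI + n.imJ * x.imJ + n.imK * x.imK = 0 := by
  by_cases h : x.imI ^ 2 + x.imJ ^ 2 = 0
  · have h1 : x.imI = 0 := by nlinarith [sq_nonneg x.imI, sq_nonneg x.imJ]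
    have h2 : x.imJ = 0 := by nlinarith [sq_nonneg x.imI, sq_nonneg x.imJ]
    exact ⟨i, rfl, by simp [i, h1]⟩
  · have hp : 0 < x.imI ^ 2 + x.imJ ^ 2 := lt_of_le_of_ne (by positivity) (Ne.symm h)
    set r := Real.sqrt (x.imI ^ 2 + x.imJ ^ 2) with hr
    have hr2 : r ^ 2 = x.imI ^ 2 + x.imJ ^ 2 := Real.sq_sqrt hp.le
    have hr0 : r ≠ 0 := (Real.sqrt_pos.2 hp).ne'
    refine ⟨mk 0 (-x.imJ / r) (x.imI / r) 0 ?_, rfl, ?_⟩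
    · field_simp
      linarith
    · simp only [imI_mk, imJ_mk, imK_mk]
      ring

/-- Writing x as a commutator with first entry y means that y⁻¹x is conjugate to y⁻¹, and conjugacy
is decided by the real part. -/
theorem eq_commutator_of_re_eq {x y : UnitQuaternion} (h : (y⁻¹ * x).re = y.re) :
    ∃ u, x = y * u * y⁻¹ * u⁻¹ := by
  obtain ⟨u, hu⟩ := exists_conj_of_re_eq y⁻¹ (y⁻¹ * x) (by rw [h, re_inv])
  refine ⟨u, ?_⟩
  rw [mul_assoc y, hu]
  group

/-- An imaginary unit n orthogonal to the imaginary part of x serves as first entry: both n and n⁻¹x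
then have real part 0. This yields perfectness of all groups generated by root subgroups. -/
theorem exists_eq_commutator (x : UnitQuaternion) : ∃ y u, x = y * u * y⁻¹ * u⁻¹ := by
  obtain ⟨n, h0, h1⟩ := exists_orthogonal x
  refine ⟨n, eq_commutator_of_re_eq ?_⟩
  simp only [re_mul, re_inv, imI_inv, imJ_inv, imK_inv, h0]
  linarith

theorem re_conj (u y : UnitQuaternion) : (u * y * u⁻¹).re = y.re := by
  have h := u.sum_sq
  simp only [re_mul, imI_mul, imJ_mul, imK_mul, re_inv, imI_inv, imJ_inv, imK_inv]
  linear_combination y.re * h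

/-- The commutator is y times a conjugate z of y⁻¹; real parts agree, and the Cauchy–Schwarz bound
for the imaginary parts gives a² - (1 - a²) with a the real part of y. -/
theorem re_commutator (y u : UnitQuaternion) : 2 * y.re ^ 2 - 1 ≤ (y * u * y⁻¹ * u⁻¹).re := by
  have hz : (u * y⁻¹ * u⁻¹).re = y.re := by rw [re_conj, re_inv]
  rw [show y * u * y⁻¹ * u⁻¹ = y * (u * y⁻¹ * u⁻¹) by group]
  generalize u * y⁻¹ * u⁻¹ = z at hz
  have h1 := y.sum_sq
  have h2 := z.sum_sq
  rw [hz] at h2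
  rw [re_mul, hz]
  nlinarith [sq_nonneg (y.imI - z.imI), sq_nonneg (y.imJ - z.imJ), sq_nonneg (y.imK - z.imK)]

/-- Turns an inequality into a group-theoretic condition involving only -1. The condition y⁴ = -1
says that the real part of y is ±√2/2, exactly where the bound 2a² - 1 becomes 0. -/
theorem re_nonneg_iff (x : UnitQuaternion) :
    0 ≤ x.re ↔ ∃ y u, y * y * (y * y) = -1 ∧ x = y * u * y⁻¹ * u⁻¹ := by
  constructor
  · intro hx
    obtain ⟨n, h0, h1⟩ := exists_orthogonal x
    have hs := x.sum_sq
    have hn := n.sum_sq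
    have hc : 0 < 1 + x.re := by linarith
    set s : ℝ := Real.sqrt 2 / (2 * (1 + x.re)) with hsdef
    have hs1 : s * (1 + x.re) = Real.sqrt 2 / 2 := by rw [hsdef]; field_simp
    have h2 : Real.sqrt 2 ^ 2 = 2 := Real.sq_sqrt (by norm_num)
    set t : ℝ := Real.sqrt (x.re / (1 + x.re)) with htdef
    have ht : t ^ 2 = x.re / (1 + x.re) := Real.sq_sqrt (by positivity)
    have hsq : s ^ 2 * (2 * (1 + x.re)) = 1 / (1 + x.re) := by
      rw [hsdef, div_pow, h2]; field_simp
    -- The requirement is that y be orthogonal to 1 - x. Both 1 + x and n are, so y = s(1 + x) + t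
    -- n, with s making the real part √2/2 and t making the norm 1. The value of t² is nonnegative
    -- because x has nonnegative real part.
    let y : UnitQuaternion := mk (s * (1 + x.re)) (s * x.imI + t * n.imI) (s * x.imJ + t * n.imJ)
      (s * x.imK + t * n.imK) (by
        have e : s ^ 2 * (2 * (1 + x.re)) + t ^ 2 = 1 := by
          rw [hsq, ht]; field_simp
        have e1 : n.imI ^ 2 + n.imJ ^ 2 + n.imK ^ 2 = 1 := by
          rw [h0] at hn; linarith
        linear_combination e + s ^ 2 * hs + t ^ 2 * e1 + 2 * s * t * h1)
    have hy : (y⁻¹ * x).re = y.re := by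
      simp only [y, re_mul, re_inv, imI_inv, imJ_inv, imK_inv, re_mk, imI_mk, imJ_mk, imK_mk]
      linear_combination s * hs + t * h1
    obtain ⟨u, hu⟩ := eq_commutator_of_re_eq hy
    refine ⟨y, u, ?_, hu⟩
    rw [sq_eq_neg_one, re_mul_self]
    simp only [y, re_mk, hs1]
    linear_combination h2 / 2
  · rintro ⟨y, u, hy, rfl⟩
    rw [sq_eq_neg_one, re_mul_self] at hy
    linarith [re_commutator y u]

section
variable {α : UnitQuaternion →* UnitQuaternion} (hα : α (-1) = -1)
include hα

theorem map_neg' (x : UnitQuaternion) : α (-x) = -α x := by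
  rw [← neg_one_mul, map_mul, hα, neg_one_mul]

theorem re_map_nonneg {x : UnitQuaternion} (hx : 0 ≤ x.re) : 0 ≤ (α x).re := by
  obtain ⟨y, u, hy, rfl⟩ := (re_nonneg_iff x).1 hx
  refine (re_nonneg_iff _).2 ⟨α y, α u, ?_, by simp only [map_mul, map_inv]⟩
  rw [← map_mul, ← map_mul, hy, hα]

/-- On the right half sphere squaring doubles the angle, and α preserves this half. A bound on the
angle error at x², applied to all x, is therefore halved at x. -/
theorem abs_arccos_sub_le (n : ℕ) : ∀ x : UnitQuaternion,
    |Real.arccos x.re - Real.arccos (α x).re| ≤ Real.pi / 2 ^ n := by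
  induction n with
  | zero =>
    intro x
    rw [abs_le]
    constructor <;> linarith [Real.arccos_nonneg x.re, Real.arccos_nonneg (α x).re,
      Real.arccos_le_pi x.re, Real.arccos_le_pi (α x).re]
  | succ n ih =>
    have double : ∀ x : UnitQuaternion, 0 ≤ x.re →
        Real.arccos (x * x).re = 2 * Real.arccos x.re := by
      intro x hx
      rw [re_mul_self]
      conv_lhs => rw [← Real.cos_arccos x.neg_one_le_re x.re_le_one, ← Real.cos_two_mul]
      exact Real.arccos_cos (by linarith [Real.arccos_nonneg x.re])
        (by linarith [Real.arccos_le_pi_div_two.2 hx])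
    have key : ∀ x : UnitQuaternion, 0 ≤ x.re →
        |Real.arccos x.re - Real.arccos (α x).re| ≤ Real.pi / 2 ^ (n + 1) := by
      intro x hx
      have h := ih (x * x)
      rw [map_mul, double x hx, double _ (re_map_nonneg hα hx), ← mul_sub, abs_mul, abs_two] at h
      rw [pow_succ, ← div_div]
      linarith
    intro x
    -- In the left half replace x by -x, which turns the angle θ into π - θ and commutes with α.
    rcases le_total 0 x.re with hx | hx
    · exact key x hx
    · have h := key (-x) (by rw [re_neg]; linarith)
      rw [map_neg' hα, re_neg, re_neg, Real.arccos_neg, Real.arccos_neg, abs_sub_comm] at h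
      convert h using 2
      ring

/-- An endomorphism of the group of unit quaternions that fixes `-1` preserves real parts. -/
theorem re_map (x : UnitQuaternion) : (α x).re = x.re := by
  have h : Real.arccos x.re - Real.arccos (α x).re = 0 := by
    by_contra hne
    have hpos := abs_pos.2 hne
    obtain ⟨n, hn⟩ := pow_unbounded_of_one_lt
      (Real.pi / |Real.arccos x.re - Real.arccos (α x).re|) (one_lt_two (α := ℝ))
    rw [div_lt_iff₀ hpos] at hn
    have := abs_arccos_sub_le hα n x
    rw [le_div_iff₀ (by positivity)] at this
    linarith
  exact (Real.arccos_injOn ⟨x.neg_one_le_re, x.re_le_one⟩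
    ⟨(α x).neg_one_le_re, (α x).re_le_one⟩ (sub_eq_zero.1 h)).symm

/-- The coordinates of x are, up to sign, the real parts of x, xi, xj and xk, all of which are
preserved. -/
theorem map_eq_self (hi : α i = i) (hj : α j = j) (x : UnitQuaternion) : α x = x := by
  have hk : α k = k := by
    rw [show k = i * j by rw [ext_iff']; simp [i, j, k], map_mul, hi, hj]
  have h0 := re_map hα x
  have h1 := re_map hα (x * i)
  have h2 := re_map hα (x * j)
  have h3 := re_map hα (x * k)
  rw [map_mul, hi] at h1
  rw [map_mul, hj] at h2
  rw [map_mul, hk] at h3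
  simp only [re_mul, i, j, k, re_mk, imI_mk, imJ_mk, imK_mk] at h1 h2 h3
  rw [ext_iff']
  exact ⟨h0, by linarith, by linarith, by linarith⟩

end

theorem torus_comm {a b : UnitQuaternion} (ha : a ∈ torus) (hb : b ∈ torus) : a * b = b * a := by
  obtain ⟨h1, h2⟩ := mem_torus.1 ha
  obtain ⟨h3, h4⟩ := mem_torus.1 hb
  rw [ext_iff']
  simp only [re_mul, imI_mul, imJ_mul, imK_mul, h1, h2, h3, h4]
  refine ⟨?_, ?_, ?_, ?_⟩ <;> ring

theorem exists_mul_self_eq {u : UnitQuaternion} (hu : u ∈ torus) : ∃ s ∈ torus, s * s = u := by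
  obtain ⟨hJ, hK⟩ := mem_torus.1 hu
  have hs := u.sum_sq
  rw [hJ, hK] at hs
  rcases u.neg_one_le_re.eq_or_lt with h | h
  · refine ⟨i, by simp [mem_torus, i], ?_⟩
    have : u = -1 := neg_eq_iff_eq_neg.1 (eq_one_iff.2 (by rw [re_neg, ← h, neg_neg]))
    rw [this, sq_eq_neg_one]
    rfl
  · have hp : 0 < 2 + 2 * u.re := by linarith
    set r := Real.sqrt (2 + 2 * u.re) with hr
    have hr2 : r ^ 2 = 2 + 2 * u.re := Real.sq_sqrt hp.le
    have hr0 : r ≠ 0 := (Real.sqrt_pos.2 hp).ne'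
    -- The square root is (1 + u) / |1 + u|, with |1 + u|² = 2 + 2 re u.
    refine ⟨mk ((1 + u.re) / r) (u.imI / r) 0 0 ?_, ⟨rfl, rfl⟩, ?_⟩
    · field_simp
      linarith
    · rw [ext_iff']
      simp only [re_mul, imI_mul, imJ_mul, imK_mul, re_mk, imI_mk, imJ_mk, imK_mk, hJ, hK]
      refine ⟨?_, ?_, by ring, by ring⟩
      · field_simp
        rw [hr2]
        linarith
      · field_simp
        rw [hr2]
        ring

theorem j_mul_of_mem_torus {s : UnitQuaternion} (hs : s ∈ torus) : j * s⁻¹ = s * j := by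
  obtain ⟨hJ, hK⟩ := mem_torus.1 hs
  rw [ext_iff']
  simp [j, hJ, hK]

/-- An endomorphism fixing `i` is conjugation by an element of the torus. -/
theorem eq_conj_of_map_i {α : UnitQuaternion →* UnitQuaternion} (hi : α i = i) :
    ∃ s ∈ torus, ∀ q, α q = s * q * s⁻¹ := by
  have hii : i * i = -1 := sq_eq_neg_one.2 rfl
  have hα : α (-1) = -1 := by rw [← hii, map_mul, hi]
  have h0 := re_map hα j
  have h1 := re_map hα (i * j)
  rw [map_mul, hi] at h1
  simp only [re_mul, i, j, re_mk, imI_mk, imJ_mk, imK_mk] at h0 h1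
  have h1' : (α j).imI = 0 := by simp only [i, j] at *; linarith
  have hs := (α j).sum_sq
  have h0' : (α j).re = 0 := h0
  rw [h0', h1'] at hs
  -- Preservation of real parts makes α j orthogonal to 1 and i, so α j = u j with u on the circle.
  -- Since s j s⁻¹ = s² j, a square root of u is wanted.
  obtain ⟨s, hsT, hss⟩ := exists_mul_self_eq (u := mk (α j).imJ (α j).imK 0 0 (by linarith))
    (by simp [mem_torus])
  have hj : α j = s * j * s⁻¹ := by
    rw [mul_assoc, j_mul_of_mem_torus hsT, ← mul_assoc, hss, ext_iff']
    simp only [re_mul, imI_mul, imJ_mul, imK_mul, re_mk, imI_mk, imJ_mk, imK_mk, h0', h1']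
    simp [j]
  have hsi : s * i * s⁻¹ = i := by
    rw [torus_comm hsT (by simp [mem_torus, i]), mul_inv_cancel_right]
  refine ⟨s, hsT, fun q => ?_⟩
  have := map_eq_self (α := (MulAut.conj s⁻¹).toMonoidHom.comp α) (by simp [hα])
    (by simp [hi]; nth_rw 1 [← hsi]; group) (by simp [hj]; group) q
  simp only [MonoidHom.comp_apply, MulEquiv.coe_toMonoidHom, MulAut.conj_apply, inv_inv] at this
  calc α q = s * (s⁻¹ * α q * s) * s⁻¹ := by group
    _ = s * q * s⁻¹ := by rw [this]

/-- The unit quaternion `e ^ (i π / 4)`. -/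
noncomputable def sqrtI : UnitQuaternion := mk (Real.sqrt 2 / 2) (Real.sqrt 2 / 2) 0 0 (by
  have h2 : Real.sqrt 2 ^ 2 = 2 := Real.sq_sqrt (by norm_num)
  linear_combination h2 / 2)

theorem sqrtI_mem_torus : sqrtI ∈ torus := ⟨rfl, rfl⟩

theorem sqrtI_mul_self : sqrtI * sqrtI = i := by
  have h2 : Real.sqrt 2 ^ 2 = 2 := Real.sq_sqrt (by norm_num)
  rw [ext_iff']
  simp [sqrtI, i]
  linear_combination h2 / 2

theorem eq_one_or_neg_one {c : UnitQuaternion} (hi : c * i = i * c) (hj : c * j = j * c) :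
    c = 1 ∨ c = -1 := by
  apply sq_eq_one
  rw [ext_iff'] at hi hj ⊢
  have hs := c.sum_sq
  simp only [re_mul, imI_mul, imJ_mul, imK_mul, i, j, re_mk, imI_mk, imJ_mk, imK_mk] at hi hj
  have h1 : c.imI = 0 := by linarith [hj.2.2.2]
  have h2 : c.imJ = 0 := by linarith [hi.2.2.2]
  have h3 : c.imK = 0 := by linarith [hi.2.2.1]
  rw [h1, h2, h3] at hs
  simp only [re_mul, imI_mul, imJ_mul, imK_mul, h1, h2, h3, re_one, imI_one, imJ_one, imK_one]
  refine ⟨by linarith, by ring, by ring, by ring⟩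

/-- An endomorphism which is compatible with conjugation by `e ^ (i π / 4)` up to the center
maps `i` to `i` or to `-i`. -/
theorem map_i_eq_of_commute {α : UnitQuaternion →* UnitQuaternion} (hα : α (-1) = -1)
    (h : sqrtI * α sqrtI = α sqrtI * sqrtI ∨ sqrtI * α sqrtI = -(α sqrtI * sqrtI)) :
    α i = i ∨ α i = -i := by
  have hre := re_map hα sqrtI
  have hs0 : Real.sqrt 2 ≠ 0 := by positivity
  rw [← sqrtI_mul_self, map_mul]
  generalize α sqrtI = z at *
  have hz := z.sum_sq
  have h2 : Real.sqrt 2 ^ 2 = 2 := Real.sq_sqrt (by norm_num)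
  have hre' : z.re = Real.sqrt 2 / 2 := hre
  -- In the commuting case the image of e^(iπ/4) lies on the torus and has real part √2/2, so it is
  -- e^(±iπ/4). Anticommuting would make e^(iπ/4) conjugate to its negative, which real parts
  -- forbid.
  rcases h with h | h
  · rw [ext_iff'] at h
    simp only [re_mul, imI_mul, imJ_mul, imK_mul, sqrtI, re_mk, imI_mk, imJ_mk, imK_mk] at h
    have hJ : z.imJ = 0 := by
      have : Real.sqrt 2 * z.imJ = 0 := by linarith [h.2.2.2]
      exact (mul_eq_zero.1 this).resolve_left hs0
    have hK : z.imK = 0 := by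
      have : Real.sqrt 2 * z.imK = 0 := by linarith [h.2.2.1]
      exact (mul_eq_zero.1 this).resolve_left hs0
    rw [hJ, hK, hre'] at hz
    have : (z.imI - Real.sqrt 2 / 2) * (z.imI + Real.sqrt 2 / 2) = 0 := by
      linear_combination hz - h2 / 2
    rcases mul_eq_zero.1 this with h3 | h3
    · left
      rw [show z = sqrtI by rw [ext_iff']; exact ⟨hre, by simp [sqrtI]; linarith, hJ, hK⟩]
    · right
      have h4 : z.imI = - (Real.sqrt 2 / 2) := by linarith
      rw [ext_iff']
      simp [hJ, hK, h4, hre', sqrtI]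
  · exfalso
    rw [ext_iff'] at h
    simp only [re_mul, imI_mul, re_neg, imI_neg, sqrtI, re_mk, imI_mk, imJ_mk, imK_mk] at h
    have : z.imI = z.re := by
      have : Real.sqrt 2 * (z.imI - z.re) = 0 := by linarith [h.1]
      linarith [(mul_eq_zero.1 this).resolve_left hs0]
    have h3 := h.2.1
    rw [this, hre'] at h3
    have : Real.sqrt 2 ^ 2 = 0 := by linarith
    rw [h2] at this
    norm_num at this

/-- The circles through `j` and `k` generate the group of unit quaternions. -/
theorem closure_circles (G : Subgroup UnitQuaternion)
    (hj : ∀ t : ℝ, mk (Real.cos t) 0 (Real.sin t) 0 (by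
      linear_combination Real.cos_sq_add_sin_sq t) ∈ G)
    (hk : ∀ t : ℝ, mk (Real.cos t) 0 0 (Real.sin t) (by
      linear_combination Real.cos_sq_add_sin_sq t) ∈ G) : G = ⊤ := by
  have hi : ∀ t : ℝ, mk (Real.cos t) (Real.sin t) 0 0 (by
      linear_combination Real.cos_sq_add_sin_sq t) ∈ G := by
    intro t
    -- Conjugation by e^(jπ/4) is a quarter turn carrying k to i.
    have h := G.mul_mem (G.mul_mem (hj (Real.pi / 4)) (hk t)) (hj (-(Real.pi / 4)))
    convert h using 1
    have h2 : Real.sqrt 2 ^ 2 = 2 := Real.sq_sqrt (by norm_num)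
    rw [ext_iff']
    simp only [re_mul, imI_mul, imJ_mul, imK_mul, re_mk, imI_mk, imJ_mk, imK_mk, Real.cos_neg,
      Real.sin_neg, Real.cos_pi_div_four, Real.sin_pi_div_four]
    refine ⟨?_, ?_, ?_, ?_⟩
    · linear_combination -Real.cos t * h2 / 2
    · linear_combination -Real.sin t * h2 / 2
    · ring
    · ring
  have hcirc : ∀ q : UnitQuaternion, q ∈ torus → q ∈ G := by
    intro q hq
    obtain ⟨h1, h2⟩ := mem_torus.1 hq
    have hs := q.sum_sq
    rw [h1, h2] at hs
    have hc : (⟨q.re, q.imI⟩ : ℂ) ≠ 0 := by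
      intro h
      have e1 := congrArg Complex.re h
      have e2 := congrArg Complex.im h
      simp only [Complex.zero_re, Complex.zero_im] at e1 e2
      rw [e1, e2] at hs
      norm_num at hs
    have hn : ‖(⟨q.re, q.imI⟩ : ℂ)‖ = 1 := by
      rw [← sq_eq_sq₀ (norm_nonneg _) zero_le_one, ← Complex.normSq_eq_norm_sq,
        Complex.normSq_mk]
      linarith
    convert hi (Complex.arg ⟨q.re, q.imI⟩) using 1
    rw [ext_iff']
    simp [Complex.cos_arg hc, Complex.sin_arg, hn, h1, h2]
  refine eq_top_iff.2 fun q _ => ?_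
  have hs := q.sum_sq
  set a := Real.sqrt (q.re ^ 2 + q.imI ^ 2) with ha
  set b := Real.sqrt (q.imJ ^ 2 + q.imK ^ 2) with hb
  have ha2 : a ^ 2 = q.re ^ 2 + q.imI ^ 2 := Real.sq_sqrt (by positivity)
  have hb2 : b ^ 2 = q.imJ ^ 2 + q.imK ^ 2 := Real.sq_sqrt (by positivity)
  have polar : ∀ x y r : ℝ, r ^ 2 = x ^ 2 + y ^ 2 →
      ∃ u v : ℝ, u ^ 2 + v ^ 2 = 1 ∧ r * u = x ∧ r * v = y := by
    intro x y r h
    rcases eq_or_ne r 0 with h0 | h0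
    · refine ⟨1, 0, by norm_num, ?_, ?_⟩
      · rw [h0] at h ⊢; nlinarith [sq_nonneg x, sq_nonneg y]
      · rw [h0] at h ⊢; nlinarith [sq_nonneg x, sq_nonneg y]
    · exact ⟨x / r, y / r, by field_simp; linarith, by field_simp, by field_simp⟩
  obtain ⟨u, v, huv, hu, hv⟩ := polar _ _ _ ha2
  obtain ⟨u', v', huv', hu', hv'⟩ := polar _ _ _ hb2
  -- Write q = a z + b z' j with z, z' on the circle, a = cos w, b = sin w. For s² = z z' one has q
  -- = s e^(jw) s⁻¹ z, because j s⁻¹ = s j and j z = z⁻¹ j.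
  obtain ⟨s, hs, hss⟩ := exists_mul_self_eq (u := mk u v 0 0 (by linarith) *
    mk u' v' 0 0 (by linarith)) (torus.mul_mem ⟨rfl, rfl⟩ ⟨rfl, rfl⟩)
  obtain ⟨w, hw⟩ : ∃ w : ℝ, Real.cos w = a ∧ Real.sin w = b := by
    have ha1 : a ≤ 1 := by nlinarith [Real.sqrt_nonneg (q.re ^ 2 + q.imI ^ 2)]
    refine ⟨Real.arccos a, Real.cos_arccos (by linarith [Real.sqrt_nonneg (q.re ^ 2 + q.imI ^ 2)])
      ha1, ?_⟩
    rw [Real.sin_arccos, hb]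
    congr 1
    linarith
  have hm : s⁻¹ * mk u v 0 0 (by linarith) ∈ torus := torus.mul_mem (torus.inv_mem hs) ⟨rfl, rfl⟩
  have h := G.mul_mem (G.mul_mem (hcirc _ hs) (hj w)) (hcirc _ hm)
  obtain ⟨h1, h2⟩ := mem_torus.1 hs
  have hsum := s.sum_sq
  rw [ext_iff'] at hss
  simp only [re_mul, imI_mul, imJ_mul, imK_mul, h1, h2, re_mk, imI_mk, imJ_mk, imK_mk] at hss hsum
  convert h using 1
  rw [ext_iff']
  simp only [re_mul, imI_mul, imJ_mul, imK_mul, h1, h2, re_mk, imI_mk, imJ_mk, imK_mk, re_inv,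
    imI_inv, imJ_inv, imK_inv, hw.1, hw.2, ← hu, ← hv, ← hu', ← hv']
  obtain ⟨e1, e2, -, -⟩ := hss
  refine ⟨?_, ?_, ?_, ?_⟩
  · linear_combination -(a * u) * hsum
  · linear_combination -(a * v) * hsum
  · linear_combination -b * u' * huv - b * u * e1 - b * v * e2
  · linear_combination -b * v' * huv + b * v * e1 - b * u * e2

end UnitQuaternion

/-! ### Complex coordinates and the two root subgroups of SU(3). -/

open Matrix ComplexConjugate

namespace UnitQuaternion

/-- The first complex coordinate of a quaternion `z + w j`. -/
def fstC (q : UnitQuaternion) : ℂ := ⟨q.re, q.imI⟩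
/-- The second complex coordinate of a quaternion `z + w j`. -/
def sndC (q : UnitQuaternion) : ℂ := ⟨q.imJ, q.imK⟩

theorem ext_complex {x y : UnitQuaternion} (h1 : x.fstC = y.fstC) (h2 : x.sndC = y.sndC) :
    x = y :=
  ext_iff'.2 ⟨congrArg Complex.re h1, congrArg Complex.im h1, congrArg Complex.re h2,
    congrArg Complex.im h2⟩

section
variable (x y : UnitQuaternion)
@[simp] theorem fstC_mul : (x * y).fstC = x.fstC * y.fstC - x.sndC * conj y.sndC := by
  apply Complex.ext <;> simp [fstC, sndC] <;> ring
@[simp] theorem sndC_mul : (x * y).sndC = x.fstC * y.sndC + x.sndC * conj y.fstC := by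
  apply Complex.ext <;> simp [fstC, sndC] <;> ring
@[simp] theorem fstC_one : (1 : UnitQuaternion).fstC = 1 := by
  apply Complex.ext <;> simp [fstC]
@[simp] theorem sndC_one : (1 : UnitQuaternion).sndC = 0 := by
  apply Complex.ext <;> simp [sndC]
@[simp] theorem fstC_inv : (x⁻¹).fstC = conj x.fstC := by
  apply Complex.ext <;> simp [fstC]
@[simp] theorem sndC_inv : (x⁻¹).sndC = -x.sndC := by
  apply Complex.ext <;> simp [sndC]
@[simp] theorem fstC_neg : (-x).fstC = -x.fstC := by
  apply Complex.ext <;> simp [fstC]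
@[simp] theorem sndC_neg : (-x).sndC = -x.sndC := by
  apply Complex.ext <;> simp [sndC]
@[simp] theorem fstC_i : i.fstC = Complex.I := by
  apply Complex.ext <;> simp [fstC, i]
@[simp] theorem sndC_i : i.sndC = 0 := by
  apply Complex.ext <;> simp [sndC, i]
@[simp] theorem fstC_j : j.fstC = 0 := by
  apply Complex.ext <;> simp [fstC, j]
@[simp] theorem sndC_j : j.sndC = 1 := by
  apply Complex.ext <;> simp [sndC, j]
end

theorem mem_torus_iff_sndC {x : UnitQuaternion} : x ∈ torus ↔ x.sndC = 0 := by
  rw [mem_torus, Complex.ext_iff]; rfl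

theorem fstC_sndC_sum (x : UnitQuaternion) :
    x.fstC * conj x.fstC + x.sndC * conj x.sndC = 1 := by
  have h := x.sum_sq
  apply Complex.ext <;> simp [fstC, sndC]
  · linarith
  · ring

theorem fstC_mul_conj {x : UnitQuaternion} (hx : x ∈ torus) : x.fstC * conj x.fstC = 1 := by
  simpa [mem_torus_iff_sndC.1 hx] using x.fstC_sndC_sum

theorem exists_of_complex {z w : ℂ} (h : z * conj z + w * conj w = 1) :
    ∃ x : UnitQuaternion, x.fstC = z ∧ x.sndC = w := by
  refine ⟨mk z.re z.im w.re w.im ?_, rfl, rfl⟩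
  have := congrArg Complex.re h
  simp at this
  linarith

theorem exists_torus {z : ℂ} (h : z * conj z = 1) :
    ∃ x ∈ torus, x.fstC = z := by
  obtain ⟨x, h1, h2⟩ := exists_of_complex (z := z) (w := 0) (by simpa using h)
  exact ⟨x, mem_torus_iff_sndC.2 h2, h1⟩

theorem torus_ext {x y : UnitQuaternion} (hx : x ∈ torus) (hy : y ∈ torus)
    (h : x.fstC = y.fstC) : x = y :=
  ext_complex h (by rw [mem_torus_iff_sndC.1 hx, mem_torus_iff_sndC.1 hy])

end UnitQuaternion

open UnitQuaternion

/-- The group `SU(3)`. -/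
abbrev SU3 : Type := Matrix.specialUnitaryGroup (Fin 3) ℂ

namespace SU3

theorem ext_entries {x y : SU3} (h : ∀ a b, x.1 a b = y.1 a b) : x = y :=
  Subtype.ext (Matrix.ext h)

@[simp] theorem mul_entry (x y : SU3) (a b : Fin 3) : (x * y).1 a b =
    x.1 a 0 * y.1 0 b + x.1 a 1 * y.1 1 b + x.1 a 2 * y.1 2 b := by
  change (x.1 * y.1) a b = _
  rw [Matrix.mul_apply, Fin.sum_univ_three]

theorem entry_eq {x y : SU3} (h : x = y) (a b : Fin 3) : x.1 a b = y.1 a b := by rw [h]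

theorem mem_iff (A : Matrix (Fin 3) (Fin 3) ℂ) :
    A ∈ Matrix.specialUnitaryGroup (Fin 3) ℂ ↔ Aᴴ * A = 1 ∧ A.det = 1 := by
  rw [Matrix.mem_specialUnitaryGroup_iff, Matrix.mem_unitaryGroup_iff', Matrix.star_eq_conjTranspose]

theorem star_mul_entry (x : SU3) (a b : Fin 3) : conj (x.1 0 a) * x.1 0 b +
    conj (x.1 1 a) * x.1 1 b + conj (x.1 2 a) * x.1 2 b = (1 : Matrix (Fin 3) (Fin 3) ℂ) a b := by
  rw [← ((mem_iff x.1).1 x.2).1, Matrix.mul_apply, Fin.sum_univ_three]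
  rfl

/-- The matrix of a unit quaternion in the coordinates `0`, `1`. -/
def upperMatrix (q : UnitQuaternion) : Matrix (Fin 3) (Fin 3) ℂ :=
  !![q.fstC, q.sndC, 0; -conj q.sndC, conj q.fstC, 0; 0, 0, 1]

/-- The matrix of a unit quaternion in the coordinates `1`, `2`. -/
def lowerMatrix (q : UnitQuaternion) : Matrix (Fin 3) (Fin 3) ℂ :=
  !![1, 0, 0; 0, q.fstC, q.sndC; 0, -conj q.sndC, conj q.fstC]

/-- The embedding of the unit quaternions in `SU(3)` as the first simple root subgroup. -/
def upper : UnitQuaternion →* SU3 where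
  toFun q := ⟨upperMatrix q, (mem_iff _).2 (by
    have h := q.fstC_sndC_sum
    constructor
    · ext a b
      fin_cases a <;> fin_cases b <;>
        simp [upperMatrix, Matrix.mul_apply, Fin.sum_univ_three] <;>
        first | ring1 | linear_combination h
    · simp [upperMatrix, Matrix.det_fin_three]
      linear_combination h)⟩
  map_one' := by
    apply ext_entries
    intro a b
    fin_cases a <;> fin_cases b <;> simp [upperMatrix]
  map_mul' x y := by
    apply ext_entries
    intro a b
    rw [mul_entry]
    fin_cases a <;> fin_cases b <;> simp [upperMatrix] <;> ring

/-- The embedding of the unit quaternions in `SU(3)` as the second simple root subgroup. -/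
def lower : UnitQuaternion →* SU3 where
  toFun q := ⟨lowerMatrix q, (mem_iff _).2 (by
    have h := q.fstC_sndC_sum
    constructor
    · ext a b
      fin_cases a <;> fin_cases b <;>
        simp [lowerMatrix, Matrix.mul_apply, Fin.sum_univ_three] <;>
        first | ring1 | linear_combination h
    · simp [lowerMatrix, Matrix.det_fin_three]
      linear_combination h)⟩
  map_one' := by
    apply ext_entries
    intro a b
    fin_cases a <;> fin_cases b <;> simp [lowerMatrix]
  map_mul' x y := by
    apply ext_entries
    intro a b
    rw [mul_entry]
    fin_cases a <;> fin_cases b <;> simp [lowerMatrix] <;> ring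

theorem upper_val (q : UnitQuaternion) : (upper q).1 = upperMatrix q := rfl
theorem lower_val (q : UnitQuaternion) : (lower q).1 = lowerMatrix q := rfl

/-- Entrywise complex conjugation. -/
def conjHom : SU3 →* SU3 where
  toFun x := ⟨x.1.map conj, (mem_iff _).2 (by
    constructor
    · ext a b
      have h := congrArg conj (star_mul_entry x a b)
      rw [Matrix.mul_apply, Fin.sum_univ_three]
      simp only [map_add, map_mul, Complex.conj_conj] at h
      simp only [conjTranspose_apply, map_apply, Complex.star_def, Complex.conj_conj]
      rw [h, Matrix.one_apply]
      split_ifs <;> simp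
    · have h := congrArg conj ((mem_iff x.1).1 x.2).2
      rw [Matrix.det_fin_three] at h ⊢
      simpa using h)⟩
  map_one' := by
    apply ext_entries
    intro a b
    simp [Matrix.one_apply]
  map_mul' _ _ := Subtype.ext Matrix.map_mul

@[simp] theorem conjHom_entry (x : SU3) (a b : Fin 3) : (conjHom x).1 a b = conj (x.1 a b) := rfl

theorem conjHom_conjHom (x : SU3) : conjHom (conjHom x) = x :=
  ext_entries fun a b => by simp

/-- Entrywise complex conjugation as an automorphism. -/
def conjEquiv : SU3 ≃* SU3 :=
  { conjHom with invFun := conjHom, left_inv := conjHom_conjHom, right_inv := conjHom_conjHom }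

/-- Conjugation by j sends z + wj to the quaternion with both complex coordinates conjugated. -/
theorem conjEquiv_upper (q : UnitQuaternion) : conjEquiv (upper q) = upper (j * q * j⁻¹) := by
  apply ext_entries
  intro a b
  change conj ((upper q).1 a b) = _
  rw [upper_val, upper_val]
  fin_cases a <;> fin_cases b <;> simp [upperMatrix]

theorem conjEquiv_lower (q : UnitQuaternion) : conjEquiv (lower q) = lower (j * q * j⁻¹) := by
  apply ext_entries
  intro a b
  change conj ((lower q).1 a b) = _
  rw [lower_val, lower_val]
  fin_cases a <;> fin_cases b <;> simp [lowerMatrix]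

theorem upper_injective : Function.Injective upper := fun x y h =>
  ext_complex (by simpa [upper_val, upperMatrix] using entry_eq h 0 0)
    (by simpa [upper_val, upperMatrix] using entry_eq h 0 1)

theorem lower_injective : Function.Injective lower := fun x y h =>
  ext_complex (by simpa [lower_val, lowerMatrix] using entry_eq h 1 1)
    (by simpa [lower_val, lowerMatrix] using entry_eq h 1 2)

theorem lower_eq_one_of_eq_upper {q q' : UnitQuaternion} (h : upper q = lower q') : q' = 1 := by
  have h1 := entry_eq h 2 2
  have h2 := entry_eq h 1 2
  simp [upper_val, lower_val, upperMatrix, lowerMatrix] at h1 h2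
  exact ext_complex (by simpa using congrArg conj h1.symm) (by simpa using h2.symm)

/-- The element of the second root subgroup is diag(1, -1, -1); commuting with it kills the
off-diagonal entry of b. -/
theorem mem_torus_of_upper_commute {b : UnitQuaternion}
    (h : upper b * lower (-1) = lower (-1) * upper b) : b ∈ torus := by
  have h1 := entry_eq h 0 1
  simp [upper_val, lower_val, upperMatrix, lowerMatrix] at h1
  rw [mem_torus_iff_sndC]
  linear_combination -h1 / 2

theorem upper_lower_torus_comm {b t : UnitQuaternion} (hb : b ∈ torus) (ht : t ∈ torus) :
    upper b * lower t = lower t * upper b := by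
  rw [mem_torus_iff_sndC] at hb ht
  apply ext_entries
  intro x y
  rw [mul_entry, mul_entry]
  fin_cases x <;> fin_cases y <;>
    simp [-map_mul, -map_inv, upper_val, lower_val, upperMatrix, lowerMatrix, hb, ht, mul_comm]

/-- The diagonal matrix has first two entries b and b⁻¹t⁻¹; commuting with the upper copy of j
forces them to be equal. -/
theorem relation_of_commute_upper {b t : UnitQuaternion} (hb : b ∈ torus) (ht : t ∈ torus)
    (h : upper b * lower t⁻¹ * upper j = upper j * (upper b * lower t⁻¹)) : b * b * t = 1 := by
  have h1 := entry_eq h 0 1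
  have e1 := fstC_mul_conj hb
  have e2 := fstC_mul_conj ht
  refine torus_ext (torus.mul_mem (torus.mul_mem hb hb) ht) torus.one_mem ?_
  rw [mem_torus_iff_sndC] at hb ht
  simp [-map_mul, -map_inv, upper_val, lower_val, upperMatrix, lowerMatrix, hb, ht] at h1 ⊢
  linear_combination b.fstC * t.fstC * h1 + t.fstC * conj t.fstC * e1 + e2

theorem upper_mul_lower_j {b : UnitQuaternion} (hb : b ∈ torus) :
    upper b * lower j = lower (b⁻¹ * j) * upper b := by
  have e1 := fstC_mul_conj hb
  rw [mem_torus_iff_sndC] at hb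
  apply ext_entries
  intro x y
  rw [mul_entry, mul_entry]
  fin_cases x <;> fin_cases y <;>
    simp [-map_mul, -map_inv, upper_val, lower_val, upperMatrix, lowerMatrix, hb]
  linear_combination -e1

/-- Conjugation by diag(1, s⁻², s²) multiplies the (0,1) entry by s², as conjugation by s multiplies
the j-part of a quaternion. So a torus element of one root subgroup acts on the other as an inner
automorphism of the latter. -/
theorem lower_mul_upper {s : UnitQuaternion} (hs : s ∈ torus) (q : UnitQuaternion) :
    lower (s⁻¹ * s⁻¹) * upper q = upper (s * q * s⁻¹) * lower (s⁻¹ * s⁻¹) := by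
  have e1 := fstC_mul_conj hs
  rw [mem_torus_iff_sndC] at hs
  apply ext_entries
  intro x y
  rw [mul_entry, mul_entry]
  fin_cases x <;> fin_cases y <;>
    simp [-map_mul, -map_inv, upper_val, lower_val, upperMatrix, lowerMatrix, hs]
  all_goals try simp only [map_mul, Complex.conj_conj]
  all_goals grind

theorem upper_mul_lower {s : UnitQuaternion} (hs : s ∈ torus) (q : UnitQuaternion) :
    upper (s⁻¹ * s⁻¹) * lower q = lower (s * q * s⁻¹) * upper (s⁻¹ * s⁻¹) := by
  have e1 := fstC_mul_conj hs
  rw [mem_torus_iff_sndC] at hs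
  apply ext_entries
  intro x y
  rw [mul_entry, mul_entry]
  fin_cases x <;> fin_cases y <;>
    simp [-map_mul, -map_inv, upper_val, lower_val, upperMatrix, lowerMatrix, hs]
  all_goals try simp only [map_mul, Complex.conj_conj]
  all_goals grind

end SU3

open Matrix ComplexConjugate UnitQuaternion

/-- A special unitary 2 × 2 matrix is determined by its first row. -/
theorem UnitQuaternion.exists_of_block {a b c d : ℂ} (h1 : conj a * a + conj c * c = 1)
    (h2 : conj a * b + conj c * d = 0) (h3 : conj b * b + conj d * d = 1)
    (h4 : a * d - b * c = 1) : ∃ q : UnitQuaternion, q.fstC = a ∧ q.sndC = b ∧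
      c = -conj b ∧ d = conj a := by
  have hd : d = conj a := by linear_combination -d * h1 + conj a * h4 + c * h2
  have h2' := congrArg conj h2
  simp only [map_add, map_mul, Complex.conj_conj, map_zero] at h2'
  have hc : c = -conj b := by
    linear_combination -c * h3 - conj b * h4 + d * h2'
  obtain ⟨q, e1, e2⟩ := exists_of_complex (z := a) (w := b) (by
    rw [hc] at h1
    simp only [map_neg, Complex.conj_conj] at h1
    linear_combination h1)
  exact ⟨q, e1, e2, hc, hd⟩

section
variable {m : ℕ} {g : Matrix.specialUnitaryGroup (Fin m) ℂ} {k : Fin m}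

theorem col_of_mulVec_single (h : g.1 *ᵥ Pi.single k 1 = Pi.single k 1) (l : Fin m) :
    g.1 l k = (1 : Matrix (Fin m) (Fin m) ℂ) l k := by
  have := congrFun h l
  rw [Matrix.mulVec_single_one] at this
  simpa [Matrix.one_apply, Pi.single_apply] using this

/-- The adjoint of a unitary matrix is its inverse, so it fixes the same basis vector. -/
theorem row_of_mulVec_single (h : g.1 *ᵥ Pi.single k 1 = Pi.single k 1) (l : Fin m) :
    g.1 k l = (1 : Matrix (Fin m) (Fin m) ℂ) k l := by
  have hu : g.1ᴴ * g.1 = 1 :=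
    Matrix.mem_unitaryGroup_iff'.1 (Matrix.mem_specialUnitaryGroup_iff.1 g.2).1
  have h2 : g.1ᴴ *ᵥ Pi.single k 1 = Pi.single k 1 := by
    nth_rw 1 [← h]
    rw [Matrix.mulVec_mulVec, hu, Matrix.one_mulVec]
  have := congrArg conj (congrFun h2 l)
  rw [Matrix.mulVec_single_one] at this
  simp only [Matrix.col_apply, Matrix.conjTranspose_apply, Complex.star_def, Complex.conj_conj]
    at this
  rw [this, Pi.single_apply, Matrix.one_apply]
  rcases eq_or_ne l k with h3 | h3
  · simp [h3]
  · simp [h3, h3.symm]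

theorem mulVec_single_of_col (h : ∀ l, g.1 l k = (1 : Matrix (Fin m) (Fin m) ℂ) l k) :
    g.1 *ᵥ Pi.single k 1 = Pi.single k 1 := by
  funext l
  rw [Matrix.mulVec_single_one, Matrix.col_apply, h l]
  simp [Matrix.one_apply, Pi.single_apply]

end

namespace SU3

theorem range_upper : upper.range = suRootSubgroup 2 0 := by
  ext g
  constructor
  · rintro ⟨q, rfl⟩ k h1 h2
    have hk : k = 2 := by fin_cases k <;> simp_all
    subst hk
    refine mulVec_single_of_col fun l => ?_
    fin_cases l <;> simp [upper_val, upperMatrix, Matrix.one_apply]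
  · intro h
    have h2 := h 2 (by decide) (by decide)
    have hc := fun l => col_of_mulVec_single h2 l
    have hr := fun l => row_of_mulVec_single h2 l
    have hdet := ((mem_iff g.1).1 g.2).2
    have s1 := star_mul_entry g 0 0
    have s2 := star_mul_entry g 0 1
    have s3 := star_mul_entry g 1 1
    rw [Matrix.det_fin_three] at hdet
    have c0 := hc 0
    have c1 := hc 1
    have c2 := hc 2
    have r0 := hr 0
    have r1 := hr 1
    simp at c0 c1 c2 r0 r1
    simp [c0, c1, c2, r0, r1] at s1 s2 s3 hdet
    obtain ⟨q, e1, e2, e3, e4⟩ := exists_of_block s1 s2 s3 hdet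
    refine ⟨q, ext_entries fun a b => ?_⟩
    fin_cases a <;> fin_cases b <;>
      simp [upper_val, upperMatrix, e1, e2, e3, e4, c0, c1, c2, r0, r1]

theorem range_lower : lower.range = suRootSubgroup 2 1 := by
  ext g
  constructor
  · rintro ⟨q, rfl⟩ k h1 h2
    have hk : k = 0 := by fin_cases k <;> simp_all
    subst hk
    refine mulVec_single_of_col fun l => ?_
    fin_cases l <;> simp [lower_val, lowerMatrix, Matrix.one_apply]
  · intro h
    have h2 := h 0 (by decide) (by decide)
    have hc := fun l => col_of_mulVec_single h2 l
    have hr := fun l => row_of_mulVec_single h2 l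
    have hdet := ((mem_iff g.1).1 g.2).2
    have s1 := star_mul_entry g 1 1
    have s2 := star_mul_entry g 1 2
    have s3 := star_mul_entry g 2 2
    rw [Matrix.det_fin_three] at hdet
    have c0 := hc 0
    have c1 := hc 1
    have c2 := hc 2
    have r1 := hr 1
    have r2 := hr 2
    simp at c0 c1 c2 r1 r2
    simp [c0, c1, c2, r1, r2] at s1 s2 s3 hdet
    obtain ⟨q, e1, e2, e3, e4⟩ := exists_of_block s1 s2 s3 hdet
    refine ⟨q, ext_entries fun a b => ?_⟩
    fin_cases a <;> fin_cases b <;>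
      simp [lower_val, lowerMatrix, e1, e2, e3, e4, c0, c1, c2, r1, r2]

theorem mem_range_lower_of_col {g : SU3} (h : ∀ l, g.1 l 0 = (1 : Matrix (Fin 3) (Fin 3) ℂ) l 0) :
    g ∈ lower.range := by
  rw [range_lower]
  intro k h1 h2
  have hk : k = 0 := by fin_cases k <;> simp_all
  subst hk
  exact mulVec_single_of_col h

/-- Euler angles: every element of `SU(3)` is a product of three elements of simple root
subgroups. -/
theorem exists_eq_lower_upper_lower (x : SU3) :
    ∃ a b c, x = lower a * upper b * lower c := by
  have hx := star_mul_entry x 0 0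
  simp only [Matrix.one_apply_eq] at hx
  have e : ∀ z : ℂ, conj z * z = ((‖z‖ ^ 2 : ℝ) : ℂ) := fun z => by
    rw [mul_comm, Complex.mul_conj, Complex.normSq_eq_norm_sq]
  set r : ℝ := Real.sqrt (‖x.1 1 0‖ ^ 2 + ‖x.1 2 0‖ ^ 2) with hr
  have hr2 : r ^ 2 = ‖x.1 1 0‖ ^ 2 + ‖x.1 2 0‖ ^ 2 := Real.sq_sqrt (by positivity)
  have hrC : (r : ℂ) ^ 2 = conj (x.1 1 0) * x.1 1 0 + conj (x.1 2 0) * x.1 2 0 := by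
    rw [e, e, ← Complex.ofReal_pow, hr2]
    push_cast
    rfl
  obtain ⟨a, ha1, ha2⟩ : ∃ a : UnitQuaternion, a.fstC * r = x.1 1 0 ∧
      -conj a.sndC * r = x.1 2 0 := by
    rcases eq_or_ne r 0 with h0 | h0
    · have h1 : ‖x.1 1 0‖ = 0 := by
        rw [h0] at hr2; nlinarith [sq_nonneg ‖x.1 1 0‖, sq_nonneg ‖x.1 2 0‖]
      have h2 : ‖x.1 2 0‖ = 0 := by
        rw [h0] at hr2; nlinarith [sq_nonneg ‖x.1 1 0‖, sq_nonneg ‖x.1 2 0‖]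
      rw [norm_eq_zero] at h1 h2
      exact ⟨1, by simp [h0, h1], by simp [h0, h2]⟩
    · have h0' : (r : ℂ) ≠ 0 := Complex.ofReal_ne_zero.2 h0
      obtain ⟨a, h1, h2⟩ := exists_of_complex (z := x.1 1 0 / r) (w := -conj (x.1 2 0) / r) (by
        simp only [map_div₀, map_neg, Complex.conj_conj, Complex.conj_ofReal]
        field_simp
        linear_combination -hrC)
      refine ⟨a, by rw [h1]; field_simp, ?_⟩
      rw [h2]
      simp only [map_div₀, map_neg, Complex.conj_conj, Complex.conj_ofReal]
      field_simp
  -- The upper factor sends the first basis vector to (x₀₀, r, 0), and the lower factor `a` rotates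
  -- (r, 0) to the rest of the first column of x. What is left over fixes the first basis vector,
  -- hence is a lower element.
  obtain ⟨b, hb1, hb2⟩ := exists_of_complex (z := x.1 0 0) (w := -(r : ℂ)) (by
    simp only [map_neg, Complex.conj_ofReal]
    linear_combination hx + hrC)
  have hcol : ∀ l, (lower a * upper b).1 l 0 = x.1 l 0 := by
    intro l
    rw [mul_entry]
    fin_cases l <;> simp [lower_val, upper_val, lowerMatrix, upperMatrix, hb1, hb2, ← ha1, ← ha2]
  have hmem : (lower a * upper b)⁻¹ * x ∈ lower.range := by
    refine mem_range_lower_of_col fun l => ?_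
    refine Eq.trans ?_ (entry_eq (inv_mul_cancel (lower a * upper b)) l 0)
    rw [mul_entry, mul_entry, hcol, hcol, hcol]
  obtain ⟨c, hc⟩ := hmem
  exact ⟨a, b, c, by rw [hc]; group⟩

end SU3

/-! ### Pairs of root subgroups in rank two; SU(3) as a model. -/

noncomputable section

open Matrix ComplexConjugate UnitQuaternion

/-- A pair of embeddings `r`, `s` of the unit quaternions in a group with the properties of the two
simple root subgroups of a compact group of rank two that are needed to control the amalgam of a
diagram of rank three. -/
structure IsRankTwoModel {M : Type*} [Group M] (r s : UnitQuaternion →* M) : Prop where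
  injective_left : Function.Injective r
  injective_right : Function.Injective s
  eq_one_of_eq : ∀ q q', s q' = r q → q' = 1
  -- This ties the torus of the second root subgroup to that of the first and is what detects i up
  -- to sign.
  exists_acts : ∃ v, ∀ q, s v * r q = r (sqrtI * q * sqrtI⁻¹) * s v
  finite_centralizer : {y : M | (∀ q, y * r q = r q * y) ∧ ∀ q, y * s q = s q * y}.Finite
  -- Applied to an element shared with the first root subgroup of SU(3), either alternative forces
  -- that element into the torus.
  centralizer : ∀ y : M, (∀ q, y * s q = s q * y) → y * y = 1 ∨ y * r (-1) = r (-1) * y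
  -- Here b is the parameter of an element of the first root subgroup of SU(3) that might also be y
  -- in M; the hypotheses record how such an element acts on the middle group. The last two
  -- alternatives cannot be excluded inside M; they are excluded by the product SU(2) × SU(2).
  relation : ∀ (y : M) (b : UnitQuaternion), b ∈ torus → (∀ q, y * s q = s q * y) →
    (∀ t ∈ torus, y * r t = r t * y) → y * r j = r (b⁻¹ * j) * y →
    ∃ t ∈ torus, ∃ c ∈ torus, y = r t * s c ∧ (b * b * t = 1 →
      b = 1 ∨ (b = -1 ∧ t = 1 ∧ c = -1) ∨ (b * b = -1 ∧ t * t = 1 ∧ c * c = -1))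

/-- The subgroup generated by the images of two homomorphisms. -/
abbrev genSubgroup {M : Type*} [Group M] (r s : UnitQuaternion →* M) : Subgroup M :=
  r.range ⊔ s.range

/-- The first homomorphism with values in the generated subgroup. -/
abbrev genLeft {M : Type*} [Group M] (r s : UnitQuaternion →* M) :
    UnitQuaternion →* genSubgroup r s :=
  r.codRestrict _ fun q => le_sup_left (a := r.range) ⟨q, rfl⟩

/-- The second homomorphism with values in the generated subgroup. -/
abbrev genRight {M : Type*} [Group M] (r s : UnitQuaternion →* M) :
    UnitQuaternion →* genSubgroup r s :=
  s.codRestrict _ fun q => le_sup_right (a := r.range) ⟨q, rfl⟩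

theorem range_genLeft_sup_range_genRight {M : Type*} [Group M] (r s : UnitQuaternion →* M) :
    (genLeft r s).range ⊔ (genRight r s).range = ⊤ := by
  apply Subgroup.map_injective (genSubgroup r s).subtype_injective
  rw [Subgroup.map_sup, MonoidHom.map_range, MonoidHom.map_range, ← MonoidHom.range_eq_map,
    Subgroup.range_subtype]
  rfl

/-- All conditions descend to the subgroup generated by the two images, so in types B₃ and C₃ it
need not be shown that the root subgroups generate U_2(ℍ). -/
theorem IsRankTwoModel.gen {M : Type*} [Group M] {r s : UnitQuaternion →* M}
    (h : IsRankTwoModel r s) : IsRankTwoModel (genLeft r s) (genRight r s) where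
  injective_left _ _ e := h.injective_left (congrArg Subtype.val e)
  injective_right _ _ e := h.injective_right (congrArg Subtype.val e)
  eq_one_of_eq q q' e := h.eq_one_of_eq q q' (congrArg Subtype.val e)
  exists_acts := h.exists_acts.imp fun _ hv q => Subtype.ext (hv q)
  finite_centralizer := by
    refine Set.Finite.of_finite_image (f := Subtype.val) (h.finite_centralizer.subset ?_)
      Subtype.val_injective.injOn
    rintro _ ⟨y, ⟨h1, h2⟩, rfl⟩
    exact ⟨fun q => congrArg Subtype.val (h1 q), fun q => congrArg Subtype.val (h2 q)⟩
  centralizer y hy := (h.centralizer y.1 fun q => congrArg Subtype.val (hy q)).imp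
    (fun e => Subtype.ext e) (fun e => Subtype.ext e)
  relation y b hb h1 h2 h3 := by
    obtain ⟨t, ht, c, hc, e, h4⟩ := h.relation y.1 b hb (fun q => congrArg Subtype.val (h1 q))
      (fun t ht => congrArg Subtype.val (h2 t ht)) (congrArg Subtype.val h3)
    exact ⟨t, ht, c, hc, Subtype.ext e, h4⟩

namespace SU3

/-- Commuting with diag(1, -1, -1) gives the block form; commuting with i makes the block diagonal
and commuting with j makes it scalar. -/
theorem centralizer_lower {y : SU3} (hy : ∀ q, y * lower q = lower q * y) :
    y.1 0 1 = 0 ∧ y.1 0 2 = 0 ∧ y.1 1 0 = 0 ∧ y.1 2 0 = 0 ∧ y.1 1 2 = 0 ∧ y.1 2 1 = 0 ∧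
      y.1 2 2 = y.1 1 1 := by
  have hm := hy (-1)
  have hi := hy i
  have hj := hy j
  have a1 := entry_eq hm 0 1
  have a2 := entry_eq hm 0 2
  have a3 := entry_eq hm 1 0
  have a4 := entry_eq hm 2 0
  have a5 := entry_eq hi 1 2
  have a6 := entry_eq hi 2 1
  have a7 := entry_eq hj 1 2
  simp [lower_val, lowerMatrix] at a1 a2 a3 a4 a5 a6 a7
  have hI : Complex.I * Complex.I = -1 := Complex.I_mul_I
  refine ⟨?_, ?_, ?_, ?_, ?_, ?_, ?_⟩
  · linear_combination -a1 / 2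
  · linear_combination -a2 / 2
  · linear_combination a3 / 2
  · linear_combination a4 / 2
  · linear_combination Complex.I / 2 * a5 + y.1 1 2 * hI
  · linear_combination -Complex.I / 2 * a6 + y.1 2 1 * hI
  · exact a7.symm

theorem diag_relations {y : SU3} (hy : ∀ q, y * lower q = lower q * y) :
    y.1 0 0 * (y.1 1 1 * y.1 1 1) = 1 ∧ y.1 0 0 * conj (y.1 0 0) = 1 ∧
      y.1 1 1 * conj (y.1 1 1) = 1 := by
  obtain ⟨h1, h2, h3, h4, h5, h6, h7⟩ := centralizer_lower hy
  have hdet := ((mem_iff y.1).1 y.2).2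
  have s1 := star_mul_entry y 0 0
  have s2 := star_mul_entry y 1 1
  rw [Matrix.det_fin_three] at hdet
  simp [h1, h2, h3, h4, h5, h6, h7] at hdet s1 s2
  exact ⟨by linear_combination hdet, by linear_combination s1, by linear_combination s2⟩

theorem ext_of_commute_lower {x y : SU3} (hx : ∀ q, x * lower q = lower q * x)
    (hy : ∀ q, y * lower q = lower q * y) (h0 : x.1 0 0 = y.1 0 0) (h1 : x.1 1 1 = y.1 1 1) :
    x = y := by
  obtain ⟨a1, a2, a3, a4, a5, a6, a7⟩ := centralizer_lower hx
  obtain ⟨b1, b2, b3, b4, b5, b6, b7⟩ := centralizer_lower hy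
  apply ext_entries
  intro a b
  fin_cases a <;> fin_cases b <;> simp [*]

/-- Only scalar matrices remain, and the determinant makes the scalar a cube root of unity. -/
theorem finite_centralizer :
    {y : SU3 | (∀ q, y * upper q = upper q * y) ∧ ∀ q, y * lower q = lower q * y}.Finite := by
  have key : ∀ y : SU3, ((∀ q, y * upper q = upper q * y) ∧ ∀ q, y * lower q = lower q * y) →
      y.1 1 1 = y.1 0 0 := by
    rintro y ⟨h1, h2⟩
    obtain ⟨b1, b2, b3, b4, b5, b6, b7⟩ := centralizer_lower h2
    have := entry_eq (h1 j) 0 1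
    simpa [upper_val, upperMatrix, b1] using this.symm
  have hfin : {w : ℂ | w ^ 3 = 1}.Finite := by
    refine (Polynomial.nthRootsFinset 3 (1 : ℂ)).finite_toSet.subset fun w hw => ?_
    rw [Finset.mem_coe, Polynomial.mem_nthRootsFinset (by norm_num)]
    exact hw
  refine Set.Finite.of_finite_image (f := fun y : SU3 => y.1 0 0) (hfin.subset ?_) ?_
  · rintro _ ⟨y, hy, rfl⟩
    have := (diag_relations hy.2).1
    rw [key y hy] at this
    change y.1 0 0 ^ 3 = 1
    linear_combination this
  · intro x hx y hy h
    exact ext_of_commute_lower hx.2 hy.2 h (by rw [key x hx, key y hy]; exact h)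

theorem isRankTwoModel : IsRankTwoModel upper lower where
  injective_left := upper_injective
  injective_right := lower_injective
  eq_one_of_eq q q' h := lower_eq_one_of_eq_upper h.symm
  exists_acts := ⟨sqrtI⁻¹ * sqrtI⁻¹, lower_mul_upper sqrtI_mem_torus⟩
  finite_centralizer := finite_centralizer
  centralizer y hy := by
    obtain ⟨b1, b2, b3, b4, b5, b6, b7⟩ := centralizer_lower hy
    right
    apply ext_entries
    intro a b
    rw [mul_entry, mul_entry]
    fin_cases a <;> fin_cases b <;> simp [upper_val, upperMatrix, *]
  -- Here y = diag(z, w, w) with z w² = 1, and the action on j gives w = b z. Put t = z and c = w⁻¹.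
  -- If b²t = 1, then w² = z and z² = 1: for z = 1 this leaves b = w = ±1, for z = -1 it leaves b² =
  -- w² = -1.
  relation y b hb h1 h2 h3 := by
    obtain ⟨b1, b2, b3, b4, b5, b6, b7⟩ := centralizer_lower h1
    obtain ⟨e1, e2, e3⟩ := diag_relations h1
    obtain ⟨t, ht, htz⟩ := exists_torus e2
    obtain ⟨c, hc, hcz⟩ := exists_torus (z := conj (y.1 1 1)) (by
      rw [Complex.conj_conj]; linear_combination e3)
    have hb1 := fstC_mul_conj hb
    have ht0 := mem_torus_iff_sndC.1 ht
    have hc0 := mem_torus_iff_sndC.1 hc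
    have hb0 := mem_torus_iff_sndC.1 hb
    have h4 := entry_eq h3 0 1
    simp [-map_mul, -map_inv, upper_val, upperMatrix, b1, b2, b6, hb0] at h4
    refine ⟨t, ht, c, hc, ?_, fun hbt => ?_⟩
    · have e4 : conj (y.1 0 0) = y.1 1 1 * y.1 1 1 := by
        linear_combination conj (y.1 0 0) * e1 * (-1) + y.1 1 1 * y.1 1 1 * e2
      apply ext_entries
      intro a b
      rw [mul_entry]
      fin_cases a <;> fin_cases b <;>
        simp [upper_val, lower_val, upperMatrix, lowerMatrix, ht0, hc0, htz, hcz, b1, b2, b3, b4, b5, b6, b7]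
      linear_combination -conj (y.1 1 1) * e4 - y.1 1 1 * e3
    · have hbt' := congrArg fstC hbt
      simp [hb0, htz] at hbt'
      have h5 : b.fstC * y.1 0 0 = y.1 1 1 := by
        linear_combination b.fstC * h4 + y.1 1 1 * hb1
      have h6 : y.1 1 1 * y.1 1 1 = y.1 0 0 := by
        rw [← h5]; linear_combination y.1 0 0 * hbt'
      have h7 : (y.1 0 0 - 1) * (y.1 0 0 + 1) = 0 := by
        rw [h6] at e1; linear_combination e1
      have m1 : (-1 : UnitQuaternion) ∈ torus := by simp [mem_torus_iff_sndC]
      rcases mul_eq_zero.1 h7 with h8 | h8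
      · have h8' : y.1 0 0 = 1 := by linear_combination h8
        rw [h8'] at htz h5 h6
        have ht1 : t = 1 := torus_ext ht torus.one_mem (by rw [htz, fstC_one])
        have h9 : (y.1 1 1 - 1) * (y.1 1 1 + 1) = 0 := by linear_combination h6
        rcases mul_eq_zero.1 h9 with h9 | h9
        · refine Or.inl (torus_ext hb torus.one_mem ?_)
          rw [fstC_one]
          linear_combination h5 + h9
        · have h9' : y.1 1 1 = -1 := by linear_combination h9
          refine Or.inr (Or.inl ⟨torus_ext hb m1 ?_, ht1, torus_ext hc m1 ?_⟩)
          · rw [fstC_neg, fstC_one]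
            linear_combination h5 + h9
          · rw [hcz, h9']
            simp
      · have h8' : y.1 0 0 = -1 := by linear_combination h8
        rw [h8'] at htz h5 h6
        have ht1 : t = -1 := torus_ext ht m1 (by rw [htz, fstC_neg, fstC_one])
        have h6' := congrArg conj h6
        simp only [map_mul, map_neg, map_one] at h6'
        refine Or.inr (Or.inr ⟨torus_ext (torus.mul_mem hb hb) m1 ?_, by rw [ht1]; simp,
          torus_ext (torus.mul_mem hc hc) m1 ?_⟩)
        · simp only [fstC_mul, hb0, fstC_neg, fstC_one]
          linear_combination h6 + (y.1 1 1 - b.fstC) * h5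
        · simp only [fstC_mul, hc0, hcz, fstC_neg, fstC_one]
          linear_combination h6'

end SU3

end

/-! ### The long and short root subgroups of U_2(ℍ). -/

open Matrix ComplexConjugate UnitQuaternion

noncomputable section

/-- The group `U_2(ℍ)`. -/
abbrev U2H : Type := QuaternionicUnitaryGroup 2

namespace U2H

theorem ext_entries {x y : U2H} (h : ∀ a b, x.1 a b = y.1 a b) : x = y :=
  Subtype.ext (Matrix.ext h)

@[simp] theorem mul_entry (x y : U2H) (a b : Fin 2) : (x * y).1 a b =
    x.1 a 0 * y.1 0 b + x.1 a 1 * y.1 1 b := by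
  change (x.1 * y.1) a b = _
  rw [Matrix.mul_apply, Fin.sum_univ_two]

theorem entry_eq {x y : U2H} (h : x = y) (a b : Fin 2) : x.1 a b = y.1 a b := by rw [h]

theorem entry_mul_star (x : U2H) (a b : Fin 2) : x.1 a 0 * star (x.1 b 0) +
    x.1 a 1 * star (x.1 b 1) = (1 : Matrix (Fin 2) (Fin 2) (Quaternion ℝ)) a b := by
  rw [← (Unitary.mem_iff.1 x.2).2, Matrix.mul_apply, Fin.sum_univ_two]
  rfl

/-- The matrix of a unit quaternion in the second coordinate. -/
def longMatrix (q : UnitQuaternion) : Matrix (Fin 2) (Fin 2) (Quaternion ℝ) := !![1, 0; 0, q.1]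

/-- The complex matrix of a unit quaternion. -/
def shortMatrix (q : UnitQuaternion) : Matrix (Fin 2) (Fin 2) (Quaternion ℝ) :=
  !![quat q.re q.imI 0 0, quat q.imJ q.imK 0 0; quat (-q.imJ) q.imK 0 0, quat q.re (-q.imI) 0 0]

@[simp] theorem re_quat_zero : (0 : Quaternion ℝ).re = 0 := rfl
@[simp] theorem imI_quat_zero : (0 : Quaternion ℝ).imI = 0 := rfl
@[simp] theorem imJ_quat_zero : (0 : Quaternion ℝ).imJ = 0 := rfl
@[simp] theorem imK_quat_zero : (0 : Quaternion ℝ).imK = 0 := rfl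
@[simp] theorem re_quat_one : (1 : Quaternion ℝ).re = 1 := rfl
@[simp] theorem imI_quat_one : (1 : Quaternion ℝ).imI = 0 := rfl
@[simp] theorem imJ_quat_one : (1 : Quaternion ℝ).imJ = 0 := rfl
@[simp] theorem imK_quat_one : (1 : Quaternion ℝ).imK = 0 := rfl

theorem quat_ext {p q : Quaternion ℝ} (h1 : p.re = q.re) (h2 : p.imI = q.imI)
    (h3 : p.imJ = q.imJ) (h4 : p.imK = q.imK) : p = q :=
  Quaternion.ext_iff.2 ⟨h1, h2, h3, h4⟩

theorem longMatrix_eq (q : UnitQuaternion) : longMatrix q =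
    !![quat 1 0 0 0, quat 0 0 0 0; quat 0 0 0 0, quat q.re q.imI q.imJ q.imK] := rfl

theorem longMatrix_mul (x y : UnitQuaternion) :
    longMatrix (x * y) = longMatrix x * longMatrix y := by
  ext1 a b
  fin_cases a <;> fin_cases b <;> simp [longMatrix, Matrix.mul_apply, Fin.sum_univ_two]

theorem longMatrix_one : longMatrix 1 = 1 := by
  ext1 a b
  fin_cases a <;> fin_cases b <;> simp [longMatrix]

theorem star_longMatrix (x : UnitQuaternion) : star (longMatrix x) = longMatrix x⁻¹ := by
  rw [← Unitary.star_eq_inv]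
  ext1 a b
  fin_cases a <;> fin_cases b <;> simp [longMatrix]

theorem shortMatrix_mul (x y : UnitQuaternion) :
    shortMatrix (x * y) = shortMatrix x * shortMatrix y := by
  ext1 a b
  rw [Matrix.mul_apply, Fin.sum_univ_two]
  fin_cases a <;> fin_cases b <;> simp only [shortMatrix] <;> apply quat_ext <;> simp <;> ring

theorem shortMatrix_one : shortMatrix 1 = 1 := by
  ext1 a b
  fin_cases a <;> fin_cases b <;> apply quat_ext <;> simp [shortMatrix]

theorem star_shortMatrix (x : UnitQuaternion) : star (shortMatrix x) = shortMatrix x⁻¹ := by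
  ext1 a b
  fin_cases a <;> fin_cases b <;> apply quat_ext <;>
    simp [shortMatrix]

/-- The embedding of the unit quaternions in `U_2(ℍ)` as a long root subgroup. -/
def long : UnitQuaternion →* U2H where
  toFun q := ⟨longMatrix q, by
    rw [Unitary.mem_iff, star_longMatrix, ← longMatrix_mul, ← longMatrix_mul, inv_mul_cancel,
      mul_inv_cancel, longMatrix_one, and_self]⟩
  map_one' := Subtype.ext longMatrix_one
  map_mul' x y := Subtype.ext (longMatrix_mul x y)

/-- The embedding of the unit quaternions in `U_2(ℍ)` as a short root subgroup. -/
def short : UnitQuaternion →* U2H where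
  toFun q := ⟨shortMatrix q, by
    rw [Unitary.mem_iff, star_shortMatrix, ← shortMatrix_mul, ← shortMatrix_mul, inv_mul_cancel,
      mul_inv_cancel, shortMatrix_one, and_self]⟩
  map_one' := Subtype.ext shortMatrix_one
  map_mul' x y := Subtype.ext (shortMatrix_mul x y)

theorem long_val (q : UnitQuaternion) : (long q).1 = longMatrix q := rfl
theorem short_val (q : UnitQuaternion) : (short q).1 = shortMatrix q := rfl

theorem long_injective : Function.Injective long := fun _ _ h =>
  Subtype.ext (entry_eq h 1 1)

theorem short_injective : Function.Injective short := fun x y h => by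
  have h1 : quat _ _ _ _ = quat _ _ _ _ := entry_eq h 0 0
  have h2 : quat _ _ _ _ = quat _ _ _ _ := entry_eq h 0 1
  rw [Quaternion.ext_iff] at h1 h2
  exact ext_iff'.2 ⟨h1.1, h1.2.1, h2.1, h2.2.1⟩

theorem short_eq_one_of_eq_long {q q' : UnitQuaternion} (h : short q = long q') : q = 1 := by
  have h1 := congrArg QuaternionAlgebra.re (entry_eq h 0 0)
  exact eq_one_iff.2 h1

theorem long_eq_one_of_eq_short {q q' : UnitQuaternion} (h : long q = short q') : q = 1 := by
  rw [short_eq_one_of_eq_long h.symm, map_one, ← map_one long] at h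
  exact long_injective h

theorem centralizer_long {y : U2H} (hy : ∀ q, y * long q = long q * y) :
    y.1 0 1 = 0 ∧ y.1 1 0 = 0 ∧ (y.1 1 1 = 1 ∨ y.1 1 1 = -1) := by
  have a1 := entry_eq (hy (-1)) 0 1
  have a2 := entry_eq (hy (-1)) 1 0
  have a3 := entry_eq (hy i) 1 1
  have a4 := entry_eq (hy j) 1 1
  have s := entry_mul_star y 1 1
  simp [long_val, longMatrix] at a1 a2 a3 a4
  have hm : ((-1 : UnitQuaternion) : Quaternion ℝ) = -1 := rfl
  have h0 : ∀ p : Quaternion ℝ, p = -p → p = 0 := fun p hp => by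
    rw [Quaternion.ext_iff] at hp
    simp only [Quaternion.re_neg, Quaternion.imI_neg, Quaternion.imJ_neg, Quaternion.imK_neg] at hp
    obtain ⟨e1, e2, e3, e4⟩ := hp
    apply quat_ext <;> simp <;> linarith
  rw [hm] at a1 a2
  have b1 : y.1 0 1 = 0 := h0 _ (by rw [mul_neg, mul_one] at a1; exact a1.symm)
  have b2 : y.1 1 0 = 0 := h0 _ (by rw [neg_mul, one_mul] at a2; exact a2)
  rw [b2] at s
  simp only [zero_mul, zero_add, Matrix.one_apply_eq] at s
  refine ⟨b1, b2, ?_⟩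
  have hu : y.1 1 1 ∈ unitary (Quaternion ℝ) := by
    rw [Unitary.mem_iff, Quaternion.star_mul_self, ← Quaternion.self_mul_star, s, and_self]
  have := eq_one_or_neg_one (c := ⟨y.1 1 1, hu⟩) (Subtype.ext a3) (Subtype.ext a4)
  exact this.imp (congrArg Subtype.val) (congrArg Subtype.val)

/-- Commuting with i and j leaves the form (x, w; -w, x) with x complex and w in ℂj. Orthogonality
of the two rows then forces one of x, w to vanish. -/
theorem centralizer_short {y : U2H} (hy : ∀ q, y * short q = short q * y) :
    y.1 1 1 = y.1 0 0 ∧ y.1 1 0 = - y.1 0 1 ∧ (y.1 0 0).imJ = 0 ∧ (y.1 0 0).imK = 0 ∧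
      (y.1 0 1).re = 0 ∧ (y.1 0 1).imI = 0 ∧ (y.1 0 0 = 0 ∨ y.1 0 1 = 0) := by
  have a1 := entry_eq (hy i) 0 0
  have a2 := entry_eq (hy i) 0 1
  have a3 := entry_eq (hy j) 0 0
  have a4 := entry_eq (hy j) 0 1
  have s := entry_mul_star y 0 1
  simp only [mul_entry, short_val, shortMatrix, i, j, Matrix.of_apply, Matrix.cons_val', Matrix.cons_val_zero,
    Matrix.cons_val_one, Matrix.cons_val_fin_one, re_mk, imI_mk, imJ_mk, imK_mk] at a1 a2 a3 a4
  rw [Quaternion.ext_iff] at a1 a2 a3 a4 s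
  simp [-mul_eq_zero] at a1 a2 a3 a4 s
  obtain ⟨p1, p2, p3, p4⟩ := a4
  obtain ⟨q1, q2, q3, q4⟩ := a3
  have c1 : (y.1 0 0).imK = 0 := by linarith
  have c2 : (y.1 0 0).imJ = 0 := by linarith
  have c3 : (y.1 0 1).re = 0 := by linarith
  have c4 : (y.1 0 1).imI = 0 := by linarith
  refine ⟨quat_ext p1.symm p2.symm p3.symm p4.symm, quat_ext (by simp [q1]) (by simp [q2])
    (by simp [q3]) (by simp [q4]), c2, c1, c3, c4, ?_⟩
  rw [← mul_eq_zero]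
  simp only [← p1, ← p2, ← p3, ← p4, ← q1, ← q2, ← q3, ← q4, c1, c2, c3, c4] at s
  apply quat_ext <;> simp [-mul_eq_zero, c1, c2, c3, c4] <;> linarith [s.2.2.1, s.2.2.2]

theorem finite_centralizer :
    {y : U2H | (∀ q, y * short q = short q * y) ∧ ∀ q, y * long q = long q * y}.Finite := by
  -- The argument only reaches the first and the last element, which are ±1.
  refine (Set.toFinite {(1 : U2H), long (-1) * short 1, short (-1)}).subset ?_
  rintro y ⟨h1, h2⟩
  obtain ⟨a1, a2, a3⟩ := centralizer_long h2
  obtain ⟨b1, b2, -⟩ := centralizer_short h1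
  rw [b1] at a3
  rcases a3 with h | h
  · left
    apply ext_entries
    intro a b
    fin_cases a <;> fin_cases b <;> simp [*]
  · right
    right
    apply ext_entries
    intro a b
    fin_cases a <;> fin_cases b <;> apply quat_ext <;> simp [short_val, shortMatrix, *]

/-- The torus of `U_2(ℍ)` acts on the short root subgroup. -/
theorem long_mul_short {s : UnitQuaternion} (hs : s ∈ torus) (q : UnitQuaternion) :
    long (s⁻¹ * s⁻¹) * short q = short (s * q * s⁻¹) * long (s⁻¹ * s⁻¹) := by
  have e1 := s.sum_sq
  obtain ⟨hs1, hs2⟩ := mem_torus.1 hs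
  rw [hs1, hs2] at e1
  apply ext_entries
  intro x y
  rw [mul_entry, mul_entry]
  fin_cases x <;> fin_cases y <;> apply quat_ext <;>
    simp [-map_mul, -map_inv, short_val, long_val, shortMatrix, longMatrix_eq, hs1, hs2] <;>
    grind

/-- The torus of `U_2(ℍ)` acts on the long root subgroup. -/
theorem short_mul_long {s : UnitQuaternion} (hs : s ∈ torus) (q : UnitQuaternion) :
    short s⁻¹ * long q = long (s * q * s⁻¹) * short s⁻¹ := by
  have e1 := s.sum_sq
  obtain ⟨hs1, hs2⟩ := mem_torus.1 hs
  rw [hs1, hs2] at e1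
  apply ext_entries
  intro x y
  rw [mul_entry, mul_entry]
  fin_cases x <;> fin_cases y <;> apply quat_ext <;>
    simp [-map_mul, -map_inv, short_val, long_val, shortMatrix, longMatrix_eq, hs1, hs2] <;>
    grind

/-- Type C₃. The short copy of -1 is the central matrix -1. In the relation y = diag(t, ±1), and the
action on j gives t = ±b⁻¹, so b²t = ±b. -/
theorem isRankTwoModel_short_long : IsRankTwoModel short long where
  injective_left := short_injective
  injective_right := long_injective
  eq_one_of_eq _ _ := long_eq_one_of_eq_short
  exists_acts := ⟨_, long_mul_short sqrtI_mem_torus⟩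
  finite_centralizer := finite_centralizer
  centralizer y hy := by
    right
    apply ext_entries
    intro a b
    rw [mul_entry, mul_entry]
    fin_cases a <;> fin_cases b <;> apply quat_ext <;> simp [short_val, shortMatrix]
  relation y b hb h1 h2 h3 := by
    obtain ⟨a1, a2, a3⟩ := centralizer_long h1
    have hi := entry_eq (h2 i ⟨rfl, rfl⟩) 0 0
    have s := entry_mul_star y 0 0
    have h4 := entry_eq h3 0 1
    obtain ⟨b1, b2⟩ := mem_torus.1 hb
    have m1 : (-1 : UnitQuaternion) ∈ torus := by simp [mem_torus]
    rw [a1] at s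
    rw [Quaternion.ext_iff] at hi h4 s
    simp [-map_mul, -map_inv, short_val, shortMatrix, a1, a2, i, j, b1, b2] at hi s h4
    have c1 : (y.1 0 0).imJ = 0 := by linarith
    have c2 : (y.1 0 0).imK = 0 := by linarith
    have s' : (y.1 0 0).re ^ 2 + (y.1 0 0).imI ^ 2 + 0 ^ 2 + 0 ^ 2 = 1 := by
      rw [c1, c2] at s; linarith [s.1]
    set t : UnitQuaternion := UnitQuaternion.mk _ _ 0 0 s' with htdef
    have ht : t ∈ torus := ⟨rfl, rfl⟩
    rcases a3 with a3 | a3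
    · refine ⟨t, ht, t, ht, ?_, ?_⟩
      · apply ext_entries
        intro x y
        rw [mul_entry]
        fin_cases x <;> fin_cases y <;> apply quat_ext <;>
          simp [short_val, long_val, shortMatrix, longMatrix_eq, a1, a2, a3, c1, c2, t] <;>
          linarith
      · intro hbt
        have : t = b⁻¹ := by
          rw [ext_iff']
          simp [a3] at h4
          simp [t, b1, b2, h4]
        left
        simpa [this] using hbt
    · refine ⟨t, ht, -t, by simp [mem_torus, t], ?_, ?_⟩
      · apply ext_entries
        intro x y
        rw [mul_entry]
        fin_cases x <;> fin_cases y <;> apply quat_ext <;>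
          simp [-map_neg, short_val, long_val, shortMatrix, longMatrix_eq, a1, a2, a3, c1, c2, t] <;>
          linarith
      · intro hbt
        have ht1 : t = -b⁻¹ := by
          rw [ext_iff']
          simp [a3] at h4
          simp [t, b1, b2, ← h4]
        rw [ht1, mul_neg, mul_inv_cancel_right] at hbt
        have hb1 : b = -1 := neg_eq_iff_eq_neg.1 hbt
        exact Or.inr (Or.inl ⟨hb1, by rw [ht1, hb1]; simp, by rw [ht1, hb1]; simp⟩)

/-- Type B₃. The centralizer of the short root subgroup has diagonal elements and antidiagonal ones,
the latter of square 1. In the relation y is the complex scalar matrix u; it acts on j through u²,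
so u² = b⁻¹ and b²t = b. -/
theorem isRankTwoModel_long_short : IsRankTwoModel long short where
  injective_left := long_injective
  injective_right := short_injective
  eq_one_of_eq _ _ := short_eq_one_of_eq_long
  exists_acts := ⟨_, short_mul_long sqrtI_mem_torus⟩
  finite_centralizer := finite_centralizer.subset fun _ h => ⟨h.2, h.1⟩
  centralizer y hy := by
    obtain ⟨b1, b2, b3, b4, b5, b6, b7⟩ := centralizer_short hy
    rcases b7 with b7 | b7
    · left
      have s := entry_mul_star y 0 0
      rw [Quaternion.ext_iff] at s
      simp [b5, b6, b7] at s
      apply ext_entries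
      intro a b
      rw [mul_entry]
      fin_cases a <;> fin_cases b <;> apply quat_ext <;> simp [b1, b2, b5, b6, b7] <;> linarith
    · right
      apply ext_entries
      intro a b
      rw [mul_entry, mul_entry]
      fin_cases a <;> fin_cases b <;> apply quat_ext <;> simp [long_val, longMatrix_eq, b2, b7]
  relation y b hb h1 h2 h3 := by
    obtain ⟨a1, a2, a3, a4, a5, a6, a7⟩ := centralizer_short h1
    obtain ⟨b1, b2⟩ := mem_torus.1 hb
    have h01 : y.1 0 1 = 0 := by
      have hi := entry_eq (h2 i ⟨rfl, rfl⟩) 0 1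
      rw [Quaternion.ext_iff] at hi
      simp [-map_mul, -map_inv, long_val, longMatrix_eq, i, a5, a6] at hi
      apply quat_ext <;> simp [a5, a6] <;> linarith
    have s := entry_mul_star y 0 0
    have h4 := entry_eq h3 1 1
    rw [Quaternion.ext_iff] at h4 s
    simp [-map_mul, -map_inv, long_val, longMatrix_eq, h01, a1, a2, a3, a4, j, b1, b2] at s h4
    have s' : (y.1 0 0).re ^ 2 + (y.1 0 0).imI ^ 2 + 0 ^ 2 + 0 ^ 2 = 1 := by linarith
    set u : UnitQuaternion := UnitQuaternion.mk _ _ 0 0 s' with hudef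
    have hu : u ∈ torus := ⟨rfl, rfl⟩
    refine ⟨u * u, torus.mul_mem hu hu, u, hu, ?_, ?_⟩
    · apply ext_entries
      intro x y
      rw [mul_entry]
      fin_cases x <;> fin_cases y <;> apply quat_ext <;>
        simp [-map_mul, short_val, long_val, shortMatrix, longMatrix_eq, h01, a1, a2, a3, a4, u]
      · linear_combination -(y.1 0 0).re * s'
      · linear_combination -(y.1 0 0).imI * s'
    · intro hbt
      have : u * u = b⁻¹ := by
        rw [ext_iff']
        simp [b1, b2, u]
        constructor
        · linear_combination (y.1 0 0).re * h4.1 - (y.1 0 0).imI * h4.2 + b.re * s'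
        · linear_combination (y.1 0 0).imI * h4.1 + (y.1 0 0).re * h4.2 - b.imI * s'
      left
      simpa [this] using hbt

end U2H

/-! ### Amalgams with given gluing data: intersections of members and isomorphism. -/

open UnitQuaternion

noncomputable section

namespace GroupAmalgam

section
variable {J : Type v} {A : GroupAmalgam.{u} J} {p q : J}

theorem mul_eq_some (a b : A.member p) : A.mul a b = Part.some ((a * b : A.member p) : A.carrier) :=
  Part.eq_some_iff.2 (A.coe_mul_mem p a b)

/-- The partial multiplication is single valued, so a product does not depend on the common member
in which it is formed. -/
theorem coe_mul_congr {a b : A.member p} {a' b' : A.member q} (h1 : a.1 = a'.1)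
    (h2 : b.1 = b'.1) : ((a * b : A.member p) : A.carrier) = (a' * b' : A.member q) := by
  have e1 := A.coe_mul_mem p a b
  have e2 := A.coe_mul_mem q a' b'
  rw [h1, h2] at e1
  exact Part.mem_unique e1 e2

variable (A) in
theorem coe_one_eq (p q : J) :
    ((1 : A.member p) : A.carrier) = (1 : A.member q) := by
  obtain ⟨K, hK⟩ := A.inter_subgroup p q
  have h1 : ((1 : A.member p) : A.carrier) ∈ A.member q := (hK 1).1 K.one_mem
  have h2 : (⟨_, h1⟩ * ⟨_, h1⟩ : A.member q) = ⟨_, h1⟩ := by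
    apply Subtype.ext
    rw [← coe_mul_congr (a := (1 : A.member p)) (b := 1) (a' := ⟨_, h1⟩) (b' := ⟨_, h1⟩) rfl rfl,
      mul_one]
  exact congrArg Subtype.val (mul_eq_left.1 h2)

end

theorem image_member_eq {J : Type v} {A : GroupAmalgam.{u} J} {B : GroupAmalgam.{w} J} {p : J}
    {G : Type*} [Group G] (a : G ≃* A.member p) (b : G ≃* B.member p) {e : A.carrier → B.carrier}
    (h : ∀ x, e (a x).1 = (b x).1) : e '' A.member p = B.member p := by
  ext z
  constructor
  · rintro ⟨z, hz, rfl⟩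
    obtain ⟨x, hx⟩ := a.surjective ⟨z, hz⟩
    have := h x
    rw [hx] at this
    rw [this]
    exact (b x).2
  · intro hz
    obtain ⟨x, hx⟩ := b.surjective ⟨z, hz⟩
    refine ⟨(a x).1, (a x).2, ?_⟩
    rw [h, hx]

/-- A description of an amalgam of a rank three diagram by the group `SU(3)`, a group `M` with a pair
of embeddings `r`, `s` of the unit quaternions, and the product of two groups of unit quaternions,
glued along the rank one groups. -/
structure Realization {M : Type*} [Group M] (r s : UnitQuaternion →* M)
    (A : GroupAmalgam.{u} (Sym2 (Fin 3))) where
  f : SU3 ≃* A.member s(0, 1)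
  g : M ≃* A.member s(1, 2)
  h : UnitQuaternion × UnitQuaternion ≃* A.member s(0, 2)
  f_upper : ∀ q, (f (SU3.upper q)).1 = (h (q, 1)).1
  g_right : ∀ q, (g (s q)).1 = (h (1, q)).1
  f_lower : ∀ q, (f (SU3.lower q)).1 = (g (r q)).1
  member_zero : A.member s(0, 0) = Set.range fun q => (f (SU3.upper q)).1
  member_one : A.member s(1, 1) = Set.range fun q => (f (SU3.lower q)).1
  member_two : A.member s(2, 2) = Set.range fun q => (g (s q)).1

namespace Realization

variable {M : Type*} [Group M] {r s : UnitQuaternion →* M} {A : GroupAmalgam.{u} (Sym2 (Fin 3))}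
  (X : Realization r s A)

/-- The heart of the determination of the intersections. An element common to the first root
subgroup of SU(3) and to M commutes with the last rank one member, because the first and last are
factors of a product, and this pins it down inside M. -/
theorem eq_of_f_upper_eq_g (hM : IsRankTwoModel r s) {b : UnitQuaternion} {y : M}
    (h : (X.f (SU3.upper b)).1 = (X.g y).1) : b = 1 ∧ y = 1 := by
  suffices hb : b = 1 by
    refine ⟨hb, ?_⟩
    have h1 := A.coe_one_eq s(0, 1) s(1, 2)
    rw [hb, map_one, map_one, h1, Subtype.coe_inj, ← map_one X.g] at h
    exact (X.g.injective h).symm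
  -- products of compatible elements are compatible
  have mulfg : ∀ {x x' y y'}, (X.f x).1 = (X.g y).1 → (X.f x').1 = (X.g y').1 →
      (X.f (x * x')).1 = (X.g (y * y')).1 := fun h1 h2 => by
    rw [map_mul, map_mul]; exact coe_mul_congr h1 h2
  have finj : ∀ {x x'}, (X.f x).1 = (X.f x').1 → x = x' := fun h =>
    X.f.injective (Subtype.ext h)
  have ginj : ∀ {x x'}, (X.g x).1 = (X.g x').1 → x = x' := fun h =>
    X.g.injective (Subtype.ext h)
  have hinj : ∀ {x x'}, (X.h x).1 = (X.h x').1 → x = x' := fun h =>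
    X.h.injective (Subtype.ext h)
  -- `y` centralizes the image of `s`
  have hys : ∀ q, y * s q = s q * y := by
    intro q
    apply ginj
    have e1 : (X.g y).1 = (X.h (b, 1)).1 := by rw [← h, X.f_upper]
    rw [map_mul, map_mul, coe_mul_congr e1 (X.g_right q), coe_mul_congr (X.g_right q) e1,
      ← map_mul, ← map_mul]
    simp
  -- If y² = 1 then b = ±1. Otherwise y commutes with the middle copy of -1, seen both in M and in
  -- SU(3).
  have hbT : b ∈ torus := by
    rcases hM.centralizer y hys with h2 | h2
    · have h3 := mulfg h h
      rw [h2, map_one, ← A.coe_one_eq s(0, 1), ← map_one X.f] at h3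
      have h4 := finj h3
      rw [← map_mul, ← map_one SU3.upper] at h4
      rcases sq_eq_one (SU3.upper_injective h4) with h5 | h5
      · rw [h5]; exact torus.one_mem
      · rw [h5]; exact ⟨by simp, by simp⟩
    · apply SU3.mem_torus_of_upper_commute
      apply finj
      rw [mulfg h (X.f_lower (-1)), mulfg (X.f_lower (-1)) h, h2]
  have hyt : ∀ t ∈ torus, y * r t = r t * y := by
    intro t ht
    apply ginj
    rw [← mulfg h (X.f_lower t), ← mulfg (X.f_lower t) h, SU3.upper_lower_torus_comm hbT ht]
  have hyj : y * r j = r (b⁻¹ * j) * y := by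
    apply ginj
    rw [← mulfg h (X.f_lower j), ← mulfg (X.f_lower _) h, SU3.upper_mul_lower_j hbT]
  obtain ⟨t, ht, c, hc, hy, hrel⟩ := hM.relation y b hbT hys hyt hyj
  -- Removing the middle factor t from y leaves an element of the last rank one member. It commutes
  -- with the whole first one, which forces b²t = 1.
  have hfh : (X.f (SU3.upper b * SU3.lower t⁻¹)).1 = (X.h (1, c)).1 := by
    rw [mulfg h (X.f_lower t⁻¹), hyt _ (torus.inv_mem ht), hy, ← mul_assoc, ← map_mul,
      inv_mul_cancel, map_one, one_mul, X.g_right]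
  have hbt : b * b * t = 1 := by
    apply SU3.relation_of_commute_upper hbT ht
    apply finj
    rw [map_mul, map_mul X.f (SU3.upper j), coe_mul_congr hfh (X.f_upper j),
      coe_mul_congr (X.f_upper j) hfh, ← map_mul, ← map_mul]
    simp
  have m1 := UnitQuaternion.one_ne_neg_one
  -- In the exceptional cases, the element or its square lies in the first factor of the product and
  -- equals -1 of the second factor, which is absurd.
  rcases hrel hbt with h3 | ⟨h3, h4, h5⟩ | ⟨h3, h4, h5⟩
  · exact h3
  · exfalso
    rw [h4, inv_one, map_one, mul_one, X.f_upper] at hfh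
    have := congrArg Prod.snd (hinj hfh)
    rw [h5] at this
    exact m1 this
  · exfalso
    have h6 := coe_mul_congr hfh hfh
    rw [← map_mul, ← map_mul, mul_assoc, ← mul_assoc (SU3.lower _),
      ← SU3.upper_lower_torus_comm hbT (torus.inv_mem ht), mul_assoc, ← mul_assoc, ← map_mul,
      ← map_mul SU3.lower, ← _root_.mul_inv_rev, h4, inv_one, map_one, mul_one, X.f_upper] at h6
    have := congrArg Prod.snd (hinj h6)
    simp only [Prod.snd_mul, h5] at this
    exact m1 this

/-- In an Euler decomposition of x the outer factors belong to the middle rank one group, hence can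
be moved to the side of M. The remaining upper factor is then trivial. -/
theorem exists_of_f_eq_g (hM : IsRankTwoModel r s) {x : SU3} {y : M}
    (h : (X.f x).1 = (X.g y).1) : ∃ q, x = SU3.lower q ∧ y = r q := by
  obtain ⟨a, b, c, rfl⟩ := SU3.exists_eq_lower_upper_lower x
  have h1 : (X.f (SU3.upper b)).1 = (X.g (r a⁻¹ * y * r c⁻¹)).1 := by
    have := coe_mul_congr (coe_mul_congr (X.f_lower a⁻¹) h) (X.f_lower c⁻¹)
    rw [← map_mul, ← map_mul, ← map_mul, ← map_mul] at this
    rw [← this]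
    simp [mul_assoc]
  obtain ⟨hb, hy⟩ := X.eq_of_f_upper_eq_g hM h1
  refine ⟨a * c, by rw [hb, map_one, mul_one, map_mul], ?_⟩
  rw [map_inv, map_inv, mul_inv_eq_one, inv_mul_eq_iff_eq_mul, ← map_mul] at hy
  exact hy

theorem eq_of_f_eq_h (hM : IsRankTwoModel r s) {x : SU3} {q q' : UnitQuaternion}
    (h : (X.f x).1 = (X.h (q, q')).1) : q' = 1 ∧ x = SU3.upper q := by
  have h1 : (X.f (SU3.upper q⁻¹ * x)).1 = (X.g (s q')).1 := by
    rw [map_mul, coe_mul_congr (X.f_upper q⁻¹) h, ← map_mul, X.g_right]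
    simp
  obtain ⟨a, h2, h3⟩ := X.exists_of_f_eq_g hM h1
  have h4 := hM.eq_one_of_eq _ _ h3
  rw [h4, map_one, ← map_one r] at h3
  rw [← hM.injective_left h3, map_one, map_inv, inv_mul_eq_one] at h2
  exact ⟨h4, h2.symm⟩

theorem eq_of_g_eq_h (hM : IsRankTwoModel r s) {y : M} {q q' : UnitQuaternion}
    (h : (X.g y).1 = (X.h (q, q')).1) : q = 1 ∧ y = s q' := by
  have h1 : (X.f (SU3.upper q)).1 = (X.g (y * s q'⁻¹)).1 := by
    rw [map_mul, coe_mul_congr h (X.g_right q'⁻¹), ← map_mul, X.f_upper]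
    simp
  obtain ⟨h2, h3⟩ := X.eq_of_f_upper_eq_g hM h1
  rw [map_inv, mul_inv_eq_one] at h3
  exact ⟨h2, h3⟩

/-- The map onto the amalgam from the disjoint union of its rank two groups. -/
def toCarrier : SU3 ⊕ M ⊕ (UnitQuaternion × UnitQuaternion) → A.carrier
  | .inl x => (X.f x).1
  | .inr (.inl y) => (X.g y).1
  | .inr (.inr z) => (X.h z).1

theorem member_eq (p : Sym2 (Fin 3)) :
    p = s(0, 0) ∨ p = s(1, 1) ∨ p = s(2, 2) ∨ p = s(0, 1) ∨ p = s(1, 2) ∨ p = s(0, 2) := by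
  induction p with
  | _ a b => fin_cases a <;> fin_cases b <;> simp

theorem exists_of_mem {p : Sym2 (Fin 3)} {a b : A.carrier} (ha : a ∈ A.member p)
    (hb : b ∈ A.member p) : (∃ x y, a = (X.f x).1 ∧ b = (X.f y).1) ∨
      (∃ x y, a = (X.g x).1 ∧ b = (X.g y).1) ∨ ∃ x y, a = (X.h x).1 ∧ b = (X.h y).1 := by
  rcases member_eq p with rfl | rfl | rfl | rfl | rfl | rfl
  · rw [X.member_zero] at ha hb
    obtain ⟨x, rfl⟩ := ha
    obtain ⟨y, rfl⟩ := hb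
    exact Or.inl ⟨_, _, rfl, rfl⟩
  · rw [X.member_one] at ha hb
    obtain ⟨x, rfl⟩ := ha
    obtain ⟨y, rfl⟩ := hb
    exact Or.inl ⟨_, _, rfl, rfl⟩
  · rw [X.member_two] at ha hb
    obtain ⟨x, rfl⟩ := ha
    obtain ⟨y, rfl⟩ := hb
    exact Or.inr (Or.inl ⟨_, _, rfl, rfl⟩)
  · exact Or.inl ⟨X.f.symm ⟨a, ha⟩, X.f.symm ⟨b, hb⟩, by simp, by simp⟩
  · exact Or.inr (Or.inl ⟨X.g.symm ⟨a, ha⟩, X.g.symm ⟨b, hb⟩, by simp, by simp⟩)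
  · exact Or.inr (Or.inr ⟨X.h.symm ⟨a, ha⟩, X.h.symm ⟨b, hb⟩, by simp, by simp⟩)

theorem toCarrier_surjective : Function.Surjective X.toCarrier := by
  intro a
  obtain ⟨p, hp⟩ := A.exists_mem_member a
  rcases X.exists_of_mem hp hp with ⟨x, -, h, -⟩ | ⟨x, -, h, -⟩ | ⟨x, -, h, -⟩
  · exact ⟨.inl x, h.symm⟩
  · exact ⟨.inr (.inl x), h.symm⟩
  · exact ⟨.inr (.inr x), h.symm⟩

variable {B : GroupAmalgam.{w} (Sym2 (Fin 3))} (Y : Realization r s B)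

/-- Coincidences between different rank two groups occur only along the prescribed rank one groups,
so they are the same in every realization. -/
theorem toCarrier_eq_of_eq (hM : IsRankTwoModel r s) {u v} (h : X.toCarrier u = X.toCarrier v) :
    Y.toCarrier u = Y.toCarrier v := by
  have fg : ∀ {x y}, (X.f x).1 = (X.g y).1 → (Y.f x).1 = (Y.g y).1 := fun h => by
    obtain ⟨q, rfl, rfl⟩ := X.exists_of_f_eq_g hM h
    exact Y.f_lower q
  have fh : ∀ {x y}, (X.f x).1 = (X.h y).1 → (Y.f x).1 = (Y.h y).1 := fun {x y} h => by
    obtain ⟨h1, rfl⟩ := X.eq_of_f_eq_h (q := y.1) (q' := y.2) hM h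
    rw [Y.f_upper, ← h1]
  have gh : ∀ {x y}, (X.g x).1 = (X.h y).1 → (Y.g x).1 = (Y.h y).1 := fun {x y} h => by
    obtain ⟨h1, rfl⟩ := X.eq_of_g_eq_h (q := y.1) (q' := y.2) hM h
    rw [Y.g_right, ← h1]
  rcases u with x | x | x <;> rcases v with y | y | y <;>
    simp only [toCarrier] at h ⊢
  · rw [X.f.injective (Subtype.ext h)]
  · exact fg h
  · exact fh h
  · exact (fg h.symm).symm
  · rw [X.g.injective (Subtype.ext h)]
  · exact gh h
  · exact (fh h.symm).symm
  · exact (gh h.symm).symm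
  · rw [X.h.injective (Subtype.ext h)]

theorem exists_equiv (X : Realization r s A) (Y : Realization r s B) (hM : IsRankTwoModel r s) :
    ∃ e : A.carrier ≃ B.carrier, ∀ u, e (X.toCarrier u) = Y.toCarrier u := by
  have h1 : ∀ u, Y.toCarrier (Function.surjInv X.toCarrier_surjective (X.toCarrier u)) =
      Y.toCarrier u := fun u => X.toCarrier_eq_of_eq Y hM (Function.surjInv_eq _ _)
  have h2 : ∀ u, X.toCarrier (Function.surjInv Y.toCarrier_surjective (Y.toCarrier u)) =
      X.toCarrier u := fun u => Y.toCarrier_eq_of_eq X hM (Function.surjInv_eq _ _)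
  refine ⟨⟨fun a => Y.toCarrier (Function.surjInv X.toCarrier_surjective a),
    fun b => X.toCarrier (Function.surjInv Y.toCarrier_surjective b), fun a => ?_, fun b => ?_⟩,
    h1⟩
  · obtain ⟨u, rfl⟩ := X.toCarrier_surjective a
    simp only [h1, h2]
  · obtain ⟨u, rfl⟩ := Y.toCarrier_surjective b
    simp only [h1, h2]

/-- Two amalgams with the same description are isomorphic. -/
theorem nonempty_iso (X : Realization r s A) (Y : Realization r s B)
    (hM : IsRankTwoModel r s) : Nonempty (A.Iso B) := by
  obtain ⟨e, he⟩ := X.exists_equiv Y hM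
  have hf : ∀ x, e (X.f x).1 = (Y.f x).1 := fun x => he (.inl x)
  have hg : ∀ x, e (X.g x).1 = (Y.g x).1 := fun x => he (.inr (.inl x))
  have hh : ∀ x, e (X.h x).1 = (Y.h x).1 := fun x => he (.inr (.inr x))
  have himage : ∀ p, e '' A.member p = B.member p := by
    intro p
    rcases member_eq p with rfl | rfl | rfl | rfl | rfl | rfl
    · rw [X.member_zero, Y.member_zero, ← Set.range_comp]
      exact congrArg Set.range (funext fun q => hf _)
    · rw [X.member_one, Y.member_one, ← Set.range_comp]
      exact congrArg Set.range (funext fun q => hf _)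
    · rw [X.member_two, Y.member_two, ← Set.range_comp]
      exact congrArg Set.range (funext fun q => hg _)
    · exact image_member_eq X.f Y.f hf
    · exact image_member_eq X.g Y.g hg
    · exact image_member_eq X.h Y.h hh
  refine ⟨⟨e, himage, fun a b => ?_⟩⟩
  by_cases hd : ∃ p, a ∈ A.member p ∧ b ∈ A.member p
  · obtain ⟨p, ha, hb⟩ := hd
    rcases X.exists_of_mem ha hb with ⟨x, y, rfl, rfl⟩ | ⟨x, y, rfl, rfl⟩ | ⟨x, y, rfl, rfl⟩
    · rw [mul_eq_some, hf, hf, mul_eq_some, Part.map_some, ← map_mul, hf, map_mul]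
    · rw [mul_eq_some, hg, hg, mul_eq_some, Part.map_some, ← map_mul, hg, map_mul]
    · rw [mul_eq_some, hh, hh, mul_eq_some, Part.map_some, ← map_mul, hh, map_mul]
  · have h1 : ¬ (A.mul a b).Dom := fun h => hd ((A.mul_dom_iff a b).1 h)
    have h2 : ¬ (B.mul (e a) (e b)).Dom := fun h => by
      obtain ⟨p, ha, hb⟩ := (B.mul_dom_iff _ _).1 h
      rw [← himage] at ha hb
      exact hd ⟨p, (e.injective.mem_set_image).1 ha, (e.injective.mem_set_image).1 hb⟩
    rw [Part.eq_none_iff'.2 h1, Part.eq_none_iff'.2 h2, Part.map_none]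

end Realization

end GroupAmalgam

end

/-! ### Central epimorphisms, and automorphisms of SU(2) that extend to SU(3). -/

open UnitQuaternion

noncomputable section

/-- A central extension of a group isomorphic to its source, with perfect source whose center is
finite, is an isomorphism. -/
theorem injective_of_ker_le_center {G : Type*} {L : Type*} [Group G] [Group L] (f : G →* L)
    (hf : Function.Surjective f) (hk : f.ker ≤ Subgroup.center G) (hG : commutator G = ⊤)
    (hfin : Finite (Subgroup.center G)) (e : L ≃* G) : Function.Injective f := by
  -- If f x is central, all commutators of x are central, so conjugation by x changes elements by
  -- central factors. It therefore fixes every commutator, hence all of the perfect group G.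
  have hcenter : ∀ x, f x ∈ Subgroup.center L → x ∈ Subgroup.center G := by
    intro x hx
    have hmem : ∀ g, x * g * x⁻¹ * g⁻¹ ∈ Subgroup.center G := by
      intro g
      apply hk
      rw [MonoidHom.mem_ker, map_mul, map_mul, map_mul, map_inv, map_inv,
        ← Subgroup.mem_center_iff.1 hx (f g)]
      group
    have hcomm : commutator G ≤ Subgroup.centralizer {x} := by
      rw [commutator_def, Subgroup.commutator_le]
      intro g _ h _
      rw [Subgroup.mem_centralizer_singleton_iff, commutatorElement_def]
      have hg := Subgroup.mem_center_iff.1 (hmem g)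
      have hh := Subgroup.mem_center_iff.1 (hmem h)
      set c := x * g * x⁻¹ * g⁻¹ with hc
      set d := x * h * x⁻¹ * h⁻¹ with hd
      have e1 : x * g * x⁻¹ = g * c := by rw [hg, hc]; group
      have e2 : x * h * x⁻¹ = h * d := by rw [hh, hd]; group
      have e3 : x * (g * h * g⁻¹ * h⁻¹) * x⁻¹ = g * h * g⁻¹ * h⁻¹ := by
        calc x * (g * h * g⁻¹ * h⁻¹) * x⁻¹
            = (x * g * x⁻¹) * (x * h * x⁻¹) * (x * g * x⁻¹)⁻¹ * (x * h * x⁻¹)⁻¹ := by group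
          _ = g * (c * h) * (d * c⁻¹) * g⁻¹ * d⁻¹ * h⁻¹ := by rw [e1, e2]; group
          _ = g * h * (c * d) * c⁻¹ * g⁻¹ * d⁻¹ * h⁻¹ := by rw [← hg h]; group
          _ = g * h * (c * d * c⁻¹) * g⁻¹ * d⁻¹ * h⁻¹ := by group
          _ = g * h * (d * g⁻¹) * d⁻¹ * h⁻¹ := by rw [mul_inv_eq_iff_eq_mul.2 (hh c)]; group
          _ = g * h * (g⁻¹ * d) * d⁻¹ * h⁻¹ := by rw [hh g⁻¹]
          _ = g * h * g⁻¹ * h⁻¹ := by group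
      exact (mul_inv_eq_iff_eq_mul.1 e3).symm
    rw [hG] at hcomm
    rw [Subgroup.mem_center_iff]
    intro g
    exact (Subgroup.mem_centralizer_singleton_iff.1 (hcomm (Subgroup.mem_top g)))
  have hmap : ∀ x : Subgroup.center G, f x ∈ Subgroup.center L := by
    intro x
    rw [Subgroup.mem_center_iff]
    intro y
    obtain ⟨y, rfl⟩ := hf y
    rw [← map_mul, Subgroup.mem_center_iff.1 x.2 y, map_mul]
  -- Thus f maps the center onto the center. Composed with the given isomorphism this is a
  -- surjection of a finite set to itself, hence injective, and the kernel of f is contained in the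
  -- center.
  let ψ : Subgroup.center G → Subgroup.center G := fun x =>
    Subgroup.centerCongr e ⟨f x, hmap x⟩
  have hψ : Function.Surjective ψ := by
    intro y
    obtain ⟨⟨z, hz⟩, rfl⟩ := (Subgroup.centerCongr e).surjective y
    obtain ⟨x, rfl⟩ := hf z
    exact ⟨⟨x, hcenter x hz⟩, rfl⟩
  have hinj := Finite.injective_iff_surjective.2 hψ
  rw [injective_iff_map_eq_one]
  intro x hx
  have h1 : ψ ⟨x, hk hx⟩ = ψ 1 := by
    have e1 : (⟨f x, hmap ⟨x, hk hx⟩⟩ : Subgroup.center L) = ⟨f (1 : Subgroup.center G), hmap 1⟩ :=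
      Subtype.ext (by simp [hx])
    exact congrArg (Subgroup.centerCongr e) e1
  exact congrArg Subtype.val (hinj h1)

theorem UnitQuaternion.range_le_commutator {G : Type*} [Group G] (r : UnitQuaternion →* G) :
    r.range ≤ commutator G := by
  rintro _ ⟨q, rfl⟩
  obtain ⟨y, u, rfl⟩ := exists_eq_commutator q
  rw [map_mul, map_mul, map_mul, map_inv, map_inv, ← commutatorElement_def]
  exact Subgroup.commutator_mem_commutator (Subgroup.mem_top _) (Subgroup.mem_top _)

theorem commutator_eq_top_of_range_sup {G : Type*} [Group G] {r s : UnitQuaternion →* G}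
    (h : r.range ⊔ s.range = ⊤) : commutator G = ⊤ :=
  eq_top_iff.2 (h ▸ sup_le (range_le_commutator r) (range_le_commutator s))

theorem SU3.range_upper_sup_range_lower : upper.range ⊔ lower.range = ⊤ := by
  refine eq_top_iff.2 fun x _ => ?_
  obtain ⟨a, b, c, rfl⟩ := exists_eq_lower_upper_lower x
  have h1 : ∀ q, lower q ∈ upper.range ⊔ lower.range := fun q =>
    le_sup_right (a := upper.range) ⟨q, rfl⟩
  have h2 : ∀ q, upper q ∈ upper.range ⊔ lower.range := fun q =>
    le_sup_left (a := upper.range) ⟨q, rfl⟩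
  exact mul_mem (mul_mem (h1 a) (h2 b)) (h1 c)

theorem IsRankTwoModel.finite_center {M : Type*} [Group M] {r s : UnitQuaternion →* M}
    (hM : IsRankTwoModel r s) : Finite (Subgroup.center M) :=
  (hM.finite_centralizer.subset fun _ hy =>
    ⟨fun _ => (Subgroup.mem_center_iff.1 hy _).symm,
      fun _ => (Subgroup.mem_center_iff.1 hy _).symm⟩).to_subtype

theorem UnitQuaternion.eq_or_of_mem_center {q : UnitQuaternion}
    (h : q ∈ Subgroup.center UnitQuaternion) : q = 1 ∨ q = -1 :=
  eq_one_or_neg_one (Subgroup.mem_center_iff.1 h i).symm (Subgroup.mem_center_iff.1 h j).symm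

theorem UnitQuaternion.finite_center_prod :
    Finite (Subgroup.center (UnitQuaternion × UnitQuaternion)) := by
  refine Set.Finite.to_subtype (((Set.toFinite {(1 : UnitQuaternion), -1}).prod
    (Set.toFinite {(1 : UnitQuaternion), -1})).subset fun z hz => ?_)
  refine ⟨eq_or_of_mem_center (Subgroup.mem_center_iff.2 fun g => ?_),
    eq_or_of_mem_center (Subgroup.mem_center_iff.2 fun g => ?_)⟩
  · exact congrArg Prod.fst (Subgroup.mem_center_iff.1 hz (g, 1))
  · exact congrArg Prod.snd (Subgroup.mem_center_iff.1 hz (1, g))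

theorem UnitQuaternion.range_inl_sup_range_inr :
    (MonoidHom.inl UnitQuaternion UnitQuaternion).range ⊔
      (MonoidHom.inr UnitQuaternion UnitQuaternion).range = ⊤ := by
  refine eq_top_iff.2 fun z _ => ?_
  rw [show z = MonoidHom.inl _ _ z.1 * MonoidHom.inr _ _ z.2 by simp]
  exact Subgroup.mul_mem_sup ⟨_, rfl⟩ ⟨_, rfl⟩

/-- An endomorphism of the group of unit quaternions which is compatible with the commuting actions
of two elements, up to the center, maps `i` to `i` or to `-i`. -/
theorem UnitQuaternion.map_i_eq {H : Type*} [Group H] (p : UnitQuaternion →* H)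
    (hp : ∀ q, p q = 1 → q = 1 ∨ q = -1) (α : UnitQuaternion ≃* UnitQuaternion) (a b : H)
    (hab : a * b = b * a) (ha : ∀ q, a * p q = p (sqrtI * q * sqrtI⁻¹) * a)
    (hb : ∀ q, b * p (α q) = p (α (sqrtI * q * sqrtI⁻¹)) * b) : α i = i ∨ α i = -i := by
  have hα : α.toMonoidHom (-1) = -1 := by
    have h1 : α (-1) * α (-1) = 1 := by rw [← map_mul]; simp
    refine (sq_eq_one h1).resolve_left fun h => ?_
    exact one_ne_neg_one (α.injective (h.trans (map_one α).symm)).symm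
  have hb' : ∀ q, b * p q = p (α sqrtI * q * (α sqrtI)⁻¹) * b := by
    intro q
    obtain ⟨q, rfl⟩ := α.surjective q
    rw [hb, map_mul α, map_mul α, map_inv]
  set e := sqrtI
  set e' := α sqrtI
  -- Since a and b commute, e e' and e' e induce the same conjugation on the image of p.
  have h1 : ∀ q, p (e * e' * q * (e * e')⁻¹) = p (e' * e * q * (e' * e)⁻¹) := by
    intro q
    have h2 : a * b * p q = p (e * (e' * q * e'⁻¹) * e⁻¹) * (a * b) := by
      rw [mul_assoc, hb', ← mul_assoc, ha, mul_assoc]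
    have h3 : b * a * p q = p (e' * (e * q * e⁻¹) * e'⁻¹) * (b * a) := by
      rw [mul_assoc, ha, ← mul_assoc, hb', mul_assoc]
    rw [hab, h3] at h2
    have h4 := mul_right_cancel h2
    convert h4.symm using 2 <;> group
  set c := (e' * e)⁻¹ * (e * e') with hc
  have h2 : ∀ q, c * q * c⁻¹ = q ∨ c * q * c⁻¹ = -q := by
    intro q
    have h3 : p (c * q * c⁻¹ * q⁻¹) = 1 := by
      rw [show c * q * c⁻¹ * q⁻¹ = (e' * e)⁻¹ * (e * e' * q * (e * e')⁻¹) * (e' * e) * q⁻¹ by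
        rw [hc]; group, map_mul, map_mul, map_mul, h1, ← map_mul, ← map_mul, ← map_mul]
      rw [show (e' * e)⁻¹ * (e' * e * q * (e' * e)⁻¹) * (e' * e) * q⁻¹ = 1 by group, map_one]
    rcases hp _ h3 with h4 | h4
    · exact Or.inl (mul_inv_eq_one.1 h4)
    · exact Or.inr (by rw [mul_inv_eq_iff_eq_mul.1 h4, neg_one_mul])
  -- Conjugation by c changes q at most by a sign, which disappears on squares. Both i and j are
  -- squares, so c = ±1.
  have h3 : ∀ q, c * (q * q) = q * q * c := by
    intro q
    rw [← mul_inv_eq_iff_eq_mul]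
    have : c * (q * q) * c⁻¹ = (c * q * c⁻¹) * (c * q * c⁻¹) := by group
    rw [this]
    rcases h2 q with h | h
    · rw [h]
    · rw [h, neg_mul_neg]
  have hci : c * i = i * c := by rw [← sqrtI_mul_self]; exact h3 _
  have hcj : c * j = j * c := by
    obtain ⟨g, hg⟩ := exists_conj_of_re_eq i j rfl
    have : j = (g * sqrtI * g⁻¹) * (g * sqrtI * g⁻¹) := by
      rw [← mul_inv_eq_iff_eq_mul.2 hg, ← sqrtI_mul_self]
      group
    rw [this]
    exact h3 _
  refine map_i_eq_of_commute hα ?_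
  rcases eq_one_or_neg_one hci hcj with h4 | h4
  · left
    rw [hc, inv_mul_eq_one] at h4
    exact h4.symm
  · right
    rw [hc, inv_mul_eq_iff_eq_mul, mul_neg, mul_one] at h4
    exact h4

/-- An automorphism of the second simple root subgroup of `SU(3)` that normalizes its torus extends
to an automorphism of `SU(3)` that preserves the first simple root subgroup. -/
theorem SU3.exists_extension {α : UnitQuaternion ≃* UnitQuaternion} (h : α i = i ∨ α i = -i) :
    ∃ (τ : SU3 ≃* SU3) (σ : UnitQuaternion ≃* UnitQuaternion), (∀ q, τ (lower q) = lower (α q)) ∧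
      ∀ q, τ (upper q) = upper (σ q) := by
  -- A torus element s of the lower subgroup acts on the upper one as conjugation by a square root
  -- of s⁻¹.
  have key : ∀ s ∈ torus, ∃ σ : UnitQuaternion ≃* UnitQuaternion, ∀ q,
      MulAut.conj (lower s) (upper q) = upper (σ q) := by
    intro s hs
    obtain ⟨t, ht, hts⟩ := exists_mul_self_eq (torus.inv_mem hs)
    refine ⟨MulAut.conj t, fun q => ?_⟩
    have h1 := lower_mul_upper ht q
    rw [← _root_.mul_inv_rev, hts, inv_inv] at h1
    rw [MulAut.conj_apply, MulAut.conj_apply, h1, mul_inv_cancel_right]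
  rcases h with h | h
  · obtain ⟨s, hs, hα⟩ := eq_conj_of_map_i (α := α.toMonoidHom) h
    obtain ⟨σ, hσ⟩ := key s hs
    refine ⟨MulAut.conj (lower s), σ, fun q => ?_, hσ⟩
    rw [MulAut.conj_apply, ← map_inv, ← map_mul, ← map_mul, ← hα]
    rfl
  -- When α i = -i, composing with conjugation by j⁻¹ reduces to an automorphism fixing i;
  -- conjugation by j is entrywise complex conjugation on SU(3).
  · obtain ⟨s, hs, hα⟩ := eq_conj_of_map_i
      (α := ((MulAut.conj j⁻¹).toMonoidHom.comp α.toMonoidHom)) (by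
        simp only [MonoidHom.comp_apply, MulEquiv.coe_toMonoidHom, h, MulAut.conj_apply]
        rw [ext_iff']
        simp [i, j])
    obtain ⟨σ, hσ⟩ := key s hs
    refine ⟨(MulAut.conj (lower s)).trans conjEquiv, σ.trans (MulAut.conj j), fun q => ?_,
      fun q => ?_⟩
    · rw [MulEquiv.trans_apply, MulAut.conj_apply, ← map_inv, ← map_mul, ← map_mul, ← hα,
        conjEquiv_lower]
      simp [mul_assoc]
    · rw [MulEquiv.trans_apply, hσ, conjEquiv_upper]
      rfl

end

/-! ### Making the parametrizations of a noncollapsing amalgam compatible. -/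

open UnitQuaternion

noncomputable section

namespace GroupAmalgam

/-- The restriction of a completion to a member. -/
def IsCompletion.memberHom {J : Type v} {A : GroupAmalgam.{u} J} {H : Type w} [Group H]
    {π : A.carrier → H} (hπ : A.IsCompletion π) (j : J) : A.member j →* H :=
  MonoidHom.mk' (fun a => π a) (hπ.map_mul j)

/-- Two embeddings of a group in members of an amalgam that have the same image differ by an
automorphism. -/
theorem exists_mulEquiv_of_range_eq {J : Type v} {A : GroupAmalgam.{u} J} {p q : J} {G : Type*}
    [Group G] (a : G →* A.member p) (b : G →* A.member q) (ha : Function.Injective a)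
    (hb : Function.Injective b)
    (h : Set.range (fun x => (a x).1) = Set.range (fun x => (b x).1)) :
    ∃ α : G ≃* G, ∀ x, (a x).1 = (b (α x)).1 := by
  have h1 : ∀ x, ∃ y, (b y).1 = (a x).1 := fun x => by
    have : (a x).1 ∈ Set.range (fun x => (b x).1) := h ▸ ⟨x, rfl⟩
    exact this
  choose α hα using h1
  have hmul : ∀ x y, α (x * y) = α x * α y := by
    intro x y
    apply hb
    apply Subtype.ext
    rw [hα, map_mul, map_mul]
    exact (coe_mul_congr (hα x) (hα y)).symm
  refine ⟨MulEquiv.ofBijective (MonoidHom.mk' α hmul) ⟨fun x y hxy => ?_, fun y => ?_⟩,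
    fun x => (hα x).symm⟩
  · apply ha
    apply Subtype.ext
    rw [← hα, ← hα]
    exact congrArg (fun z => (b z).1) hxy
  · have : (b y).1 ∈ Set.range (fun x => (a x).1) := h ▸ ⟨y, rfl⟩
    obtain ⟨x, hx⟩ := this
    exact ⟨x, hb (Subtype.ext ((hα x).trans hx))⟩

/-- The members of the amalgam of a family of subgroups are these subgroups. -/
def memberEquiv {J : Type v} {G : Type u} [Group G] (H : J → Subgroup G) (j : J) :
    H j ≃* (ofSubgroups H).member j where
  toFun x := ⟨⟨x, j, x.2⟩, x.2⟩
  invFun x := ⟨x.1.1, x.2⟩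
  left_inv _ := rfl
  right_inv _ := rfl
  map_mul' _ _ := rfl

/-- Parametrizations of the rank two members of an amalgam by `SU(3)`, a group `M` and a product,
such that the rank one members have the expected parameters. -/
structure Parametrization {M : Type*} [Group M] (r s : UnitQuaternion →* M)
    (A : GroupAmalgam.{u} (Sym2 (Fin 3))) where
  f : SU3 ≃* A.member s(0, 1)
  g : M ≃* A.member s(1, 2)
  h : UnitQuaternion × UnitQuaternion ≃* A.member s(0, 2)
  range_f_upper : Set.range (fun q => (f (SU3.upper q)).1) = A.member s(0, 0)
  range_f_lower : Set.range (fun q => (f (SU3.lower q)).1) = A.member s(1, 1)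
  range_g_left : Set.range (fun q => (g (r q)).1) = A.member s(1, 1)
  range_g_right : Set.range (fun q => (g (s q)).1) = A.member s(2, 2)
  range_h_left : Set.range (fun q => (h (q, 1)).1) = A.member s(0, 0)
  range_h_right : Set.range (fun q => (h (1, q)).1) = A.member s(2, 2)

namespace Parametrization

variable {M : Type*} [Group M] {r s : UnitQuaternion →* M} {A : GroupAmalgam.{u} (Sym2 (Fin 3))}
  (X : Parametrization r s A)

theorem exists_reparametrization (hM : IsRankTwoModel r s) :
    ∃ α : UnitQuaternion ≃* UnitQuaternion, ∀ q, (X.g (r q)).1 = (X.f (SU3.lower (α q))).1 :=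
  exists_mulEquiv_of_range_eq (X.g.toMonoidHom.comp r) (X.f.toMonoidHom.comp SU3.lower)
    (X.g.injective.comp hM.injective_left) (X.f.injective.comp SU3.lower_injective)
    (X.range_g_left.trans X.range_f_lower.symm)

/-- The actions of the two outer tori on the middle member live in different rank two members. A
completion puts them into one group, where they commute. -/
theorem map_i_eq (hM : IsRankTwoModel r s) (hA : IsStronglyNoncollapsing A)
    {α : UnitQuaternion ≃* UnitQuaternion}
    (hα : ∀ q, (X.g (r q)).1 = (X.f (SU3.lower (α q))).1) : α i = i ∨ α i = -i := by
  obtain ⟨H, _, π, hπ, hker⟩ := hA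
  obtain ⟨v, hv⟩ := hM.exists_acts
  set v₁ := sqrtI⁻¹ * sqrtI⁻¹
  have hv₁ : ∀ q, SU3.upper v₁ * SU3.lower q =
      SU3.lower (sqrtI * q * sqrtI⁻¹) * SU3.upper v₁ := SU3.upper_mul_lower sqrtI_mem_torus
  let f' : SU3 →* H := (hπ.memberHom s(0, 1)).comp X.f.toMonoidHom
  let g' : M →* H := (hπ.memberHom s(1, 2)).comp X.g.toMonoidHom
  let h' : UnitQuaternion × UnitQuaternion →* H := (hπ.memberHom s(0, 2)).comp X.h.toMonoidHom
  have hgf : ∀ q, g' (r q) = f' (SU3.lower (α q)) := fun q => congrArg π (hα q)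
  refine UnitQuaternion.map_i_eq (f'.comp SU3.lower) ?_ α (f' (SU3.upper v₁)) (g' (s v))
    ?_ ?_ ?_
  -- The kernel of the completion on the middle member is central, hence consists of elements ±1.
  · intro q hq
    have hmem : ∀ q, (X.f (SU3.lower q)).1 ∈ A.member s(1, 1) := fun q =>
      X.range_f_lower ▸ ⟨q, rfl⟩
    have h1 := hker 1 ⟨_, hmem q⟩ hq
    apply UnitQuaternion.eq_or_of_mem_center
    rw [Subgroup.mem_center_iff] at h1 ⊢
    intro y
    have h2 := congrArg Subtype.val (h1 ⟨_, hmem y⟩)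
    have h3 : ∀ x y, (((⟨_, hmem x⟩ : A.member s(1, 1)) * ⟨_, hmem y⟩ : A.member s(1, 1)) :
        A.carrier) = (X.f (SU3.lower (x * y))).1 := fun x y => by
      rw [map_mul, map_mul]
      exact coe_mul_congr rfl rfl
    rw [h3, h3] at h2
    exact SU3.lower_injective (X.f.injective (Subtype.ext h2))
  -- Elements of the two outer rank one members lie in different factors of the (0,2) member, so
  -- their images commute.
  · have h1 : (X.f (SU3.upper v₁)).1 ∈ Set.range (fun q => (X.h (q, 1)).1) := by
      rw [X.range_h_left, ← X.range_f_upper]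
      exact ⟨_, rfl⟩
    have h2 : (X.g (s v)).1 ∈ Set.range (fun q => (X.h (1, q)).1) := by
      rw [X.range_h_right, ← X.range_g_right]
      exact ⟨_, rfl⟩
    obtain ⟨a, ha⟩ := h1
    obtain ⟨b, hb⟩ := h2
    have h3 : f' (SU3.upper v₁) = h' (a, 1) := congrArg π ha.symm
    have h4 : g' (s v) = h' (1, b) := congrArg π hb.symm
    rw [h3, h4, ← map_mul, ← map_mul]
    simp
  · intro q
    simp only [MonoidHom.comp_apply]
    rw [← map_mul, hv₁, map_mul]
  · intro q
    simp only [MonoidHom.comp_apply]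
    rw [← hgf, ← hgf, ← map_mul, hv, map_mul]

theorem range_comp_mulEquiv {α β : Type*} [Group α] (k : α → β) (σ : α ≃* α) :
    Set.range (fun q => k (σ q)) = Set.range k :=
  σ.surjective.range_comp k

/-- In a strongly noncollapsing amalgam the parametrizations of the members can be chosen
compatibly. -/
theorem nonempty_realization (X : Parametrization r s A) (hM : IsRankTwoModel r s) (hA : IsStronglyNoncollapsing A) :
    Nonempty (Realization r s A) := by
  obtain ⟨α, hα⟩ := X.exists_reparametrization hM
  obtain ⟨τ, σ, hτ, hσ⟩ := SU3.exists_extension (X.map_i_eq hM hA hα)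
  have hupper : Set.range (fun q => (X.f (τ (SU3.upper q))).1) = A.member s(0, 0) := by
    rw [← X.range_f_upper]
    simp only [hσ]
    exact range_comp_mulEquiv (fun q => (X.f (SU3.upper q)).1) σ
  have hlower : Set.range (fun q => (X.f (τ (SU3.lower q))).1) = A.member s(1, 1) := by
    rw [← X.range_f_lower]
    simp only [hτ]
    exact range_comp_mulEquiv (fun q => (X.f (SU3.lower q)).1) α
  -- With α absorbed into SU(3) by τ, the mismatches on the outer members are arbitrary
  -- automorphisms, and the product group absorbs one in each factor.
  obtain ⟨β, hβ⟩ := exists_mulEquiv_of_range_eq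
    ((τ.trans X.f).toMonoidHom.comp SU3.upper) (X.h.toMonoidHom.comp (MonoidHom.inl _ _))
    ((τ.trans X.f).injective.comp SU3.upper_injective)
    (X.h.injective.comp fun _ _ h => congrArg Prod.fst h)
    (hupper.trans X.range_h_left.symm)
  obtain ⟨γ, hγ⟩ := exists_mulEquiv_of_range_eq
    (X.g.toMonoidHom.comp s) (X.h.toMonoidHom.comp (MonoidHom.inr _ _))
    (X.g.injective.comp hM.injective_right)
    (X.h.injective.comp fun _ _ h => congrArg Prod.snd h)
    (X.range_g_right.trans X.range_h_right.symm)
  exact ⟨{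
    f := τ.trans X.f
    g := X.g
    h := (β.prodCongr γ).trans X.h
    f_upper := fun q => by
      refine (hβ q).trans ?_
      change _ = (X.h (β q, γ 1)).1
      rw [map_one γ]
      rfl
    g_right := fun q => by
      refine (hγ q).trans ?_
      change _ = (X.h (β 1, γ q)).1
      rw [map_one β]
      rfl
    f_lower := fun q => by
      rw [hα, MulEquiv.trans_apply, hτ]
    member_zero := hupper.symm
    member_one := hlower.symm
    member_two := X.range_g_right.symm }⟩

end Parametrization

end GroupAmalgam

/-- A description of three subgroups of a group, to be thought of as its simple root subgroups for a
diagram of rank three, by embeddings of `SU(3)` and of a group with a pair of embeddings of the unit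
quaternions. -/
structure RootEmbedding {K M : Type*} [Group K] [Group M] (R : Fin 3 → Subgroup K)
    (r s : UnitQuaternion →* M) where
  φ : SU3 →* K
  χ : M →* K
  φ_injective : Function.Injective φ
  χ_injective : Function.Injective χ
  range_zero : (φ.comp SU3.upper).range = R 0
  range_one : (φ.comp SU3.lower).range = R 1
  range_two : (χ.comp s).range = R 2
  φ_lower : ∀ q, φ (SU3.lower q) = χ (r q)
  commute : ∀ q q', Commute (φ (SU3.upper q)) (χ (s q'))
  ne : φ (SU3.upper (-1)) ≠ χ (s (-1))

namespace RootEmbedding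

variable {K : Type u} {M : Type*} [Group K] [Group M] {R : Fin 3 → Subgroup K}
  {r s : UnitQuaternion →* M} (E : RootEmbedding R r s)

/-- The embedding of the product of the two commuting root subgroups. -/
def η : UnitQuaternion × UnitQuaternion →* K :=
  (E.φ.comp SU3.upper).noncommCoprod (E.χ.comp s) E.commute

theorem η_left (q : UnitQuaternion) : E.η (q, 1) = E.φ (SU3.upper q) := by
  simp [η]

theorem η_right (q : UnitQuaternion) : E.η (1, q) = E.χ (s q) := by
  simp [η]

/-- The components of a kernel element are central in their factors, hence ±1. Injectivity on each
factor leaves only (-1, -1), which `ne` rules out. -/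
theorem η_injective (hM : IsRankTwoModel r s) : Function.Injective E.η := by
  have hφ : Function.Injective (E.φ.comp SU3.upper) := E.φ_injective.comp SU3.upper_injective
  have hχ : Function.Injective (E.χ.comp s) := E.χ_injective.comp hM.injective_right
  rw [injective_iff_map_eq_one]
  rintro ⟨q, q'⟩ h
  have h1 : E.φ.comp SU3.upper q * E.χ.comp s q' = 1 := h
  have e1 : E.φ.comp SU3.upper q = (E.χ.comp s q')⁻¹ := eq_inv_of_mul_eq_one_left h1
  have e2 : E.χ.comp s q' = (E.φ.comp SU3.upper q)⁻¹ := eq_inv_of_mul_eq_one_right h1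
  have c1 : q = 1 ∨ q = -1 := by
    apply eq_or_of_mem_center
    rw [Subgroup.mem_center_iff]
    intro g
    apply hφ
    rw [map_mul, map_mul, e1]
    exact (E.commute g q').inv_right
  have c2 : q' = 1 ∨ q' = -1 := by
    apply eq_or_of_mem_center
    rw [Subgroup.mem_center_iff]
    intro g
    apply hχ
    rw [map_mul, map_mul, e2]
    exact (E.commute q g).inv_left.symm
  rcases c1 with rfl | rfl
  · rw [map_one, inv_one, ← map_one (E.χ.comp s)] at e2
    rw [hχ e2, Prod.mk_one_one]
  · rcases c2 with rfl | rfl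
    · rw [map_one, inv_one, ← map_one (E.φ.comp SU3.upper)] at e1
      exact absurd (hφ e1).symm one_ne_neg_one
    · rw [← map_inv, show (-1 : UnitQuaternion)⁻¹ = -1 by simp] at e1
      exact absurd e1 E.ne

theorem pairSubgroup_eq_zero_one : E.φ.range = pairSubgroup R s(0, 1) := by
  change _ = R 0 ⊔ R 1
  rw [← E.range_zero, ← E.range_one, MonoidHom.range_comp, MonoidHom.range_comp,
    ← Subgroup.map_sup, SU3.range_upper_sup_range_lower, MonoidHom.range_eq_map]

theorem pairSubgroup_eq_one_two (h : r.range ⊔ s.range = ⊤) :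
    E.χ.range = pairSubgroup R s(1, 2) := by
  change _ = R 1 ⊔ R 2
  have h1 : E.φ.comp SU3.lower = E.χ.comp r := MonoidHom.ext E.φ_lower
  rw [← E.range_two, ← E.range_one, h1, MonoidHom.range_comp, MonoidHom.range_comp,
    ← Subgroup.map_sup, h, MonoidHom.range_eq_map]

theorem pairSubgroup_eq_zero_two : E.η.range = pairSubgroup R s(0, 2) := by
  change _ = R 0 ⊔ R 2
  rw [← E.range_zero, ← E.range_two]
  exact MonoidHom.noncommCoprod_range _ _ _

/-- The first rank two group. -/
def equivZeroOne : SU3 ≃* pairSubgroup R s(0, 1) :=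
  (MonoidHom.ofInjective E.φ_injective).trans (MulEquiv.subgroupCongr E.pairSubgroup_eq_zero_one)

/-- The second rank two group. -/
def equivOneTwo (h : r.range ⊔ s.range = ⊤) : M ≃* pairSubgroup R s(1, 2) :=
  (MonoidHom.ofInjective E.χ_injective).trans
    (MulEquiv.subgroupCongr (E.pairSubgroup_eq_one_two h))

/-- The reducible rank two group. -/
def equivZeroTwo (hM : IsRankTwoModel r s) :
    UnitQuaternion × UnitQuaternion ≃* pairSubgroup R s(0, 2) :=
  (MonoidHom.ofInjective (E.η_injective hM)).trans
    (MulEquiv.subgroupCongr E.pairSubgroup_eq_zero_two)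

theorem coe_equivOneTwo (h : r.range ⊔ s.range = ⊤) (x : M) : (E.equivOneTwo h x : K) = E.χ x :=
  rfl

theorem coe_equivZeroTwo (hM : IsRankTwoModel r s) (x : UnitQuaternion × UnitQuaternion) :
    (E.equivZeroTwo hM x : K) = E.η x := rfl

/-- The compatible parametrization of the standard amalgam. -/
def realization (hM : IsRankTwoModel r s) (h : r.range ⊔ s.range = ⊤) :
    GroupAmalgam.Realization r s (standardAmalgam R) where
  f := E.equivZeroOne.trans (GroupAmalgam.memberEquiv (pairSubgroup R) s(0, 1))
  g := (E.equivOneTwo h).trans (GroupAmalgam.memberEquiv (pairSubgroup R) s(1, 2))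
  h := (E.equivZeroTwo hM).trans (GroupAmalgam.memberEquiv (pairSubgroup R) s(0, 2))
  f_upper q := Subtype.ext (E.η_left q).symm
  g_right q := Subtype.ext (E.η_right q).symm
  f_lower q := Subtype.ext (E.φ_lower q)
  member_zero := by
    ext x
    change x.1 ∈ R 0 ⊔ R 0 ↔ _
    rw [sup_idem, ← E.range_zero]
    exact ⟨fun ⟨q, hq⟩ => ⟨q, Subtype.ext hq⟩, fun ⟨q, hq⟩ => ⟨q, congrArg Subtype.val hq⟩⟩
  member_one := by
    ext x
    change x.1 ∈ R 1 ⊔ R 1 ↔ _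
    rw [sup_idem, ← E.range_one]
    exact ⟨fun ⟨q, hq⟩ => ⟨q, Subtype.ext hq⟩, fun ⟨q, hq⟩ => ⟨q, congrArg Subtype.val hq⟩⟩
  member_two := by
    ext x
    change x.1 ∈ R 2 ⊔ R 2 ↔ _
    rw [sup_idem, ← E.range_two]
    exact ⟨fun ⟨q, hq⟩ => ⟨q, Subtype.ext hq⟩, fun ⟨q, hq⟩ => ⟨q, congrArg Subtype.val hq⟩⟩

theorem range_eq {G : Type*} [Group G] {A : GroupAmalgam.{w} (Sym2 (Fin 3))}
    {p p' : Sym2 (Fin 3)} (e : G ≃* pairSubgroup R p) (F : G ≃* A.member p)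
    (k : pairSubgroup R p →* A.member p) (hF : ∀ x, F x = k (e x)) {R₀ : Subgroup K}
    (hk : (fun x => (k x : A.carrier)) '' {x | (x : K) ∈ R₀} = A.member p')
    (t : UnitQuaternion → G) (ht : ∀ x : K, x ∈ R₀ ↔ ∃ q, (e (t q) : K) = x) :
    Set.range (fun q => (F (t q)).1) = A.member p' := by
  rw [← hk]
  ext z
  constructor
  · rintro ⟨q, rfl⟩
    exact ⟨e (t q), (ht _).2 ⟨q, rfl⟩, by simp only [hF]⟩
  · rintro ⟨x, hx, rfl⟩
    obtain ⟨q, hq⟩ := (ht _).1 hx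
    exact ⟨q, by simp only [hF]; rw [Subtype.ext hq]⟩

/-- Unambiguity turns the given central epimorphism itself into an isomorphism, so its effect on
rank one subgroups is retained. -/
theorem exists_equiv {G : Type*} [Group G] {A : GroupAmalgam.{w} (Sym2 (Fin 3))}
    {p : Sym2 (Fin 3)} (e : G ≃* pairSubgroup R p) (k : pairSubgroup R p →* A.member p)
    (hk : Function.Surjective k) (hker : k.ker ≤ Subgroup.center (pairSubgroup R p))
    (hG : commutator G = ⊤) (hfin : Finite (Subgroup.center G))
    (i : Nonempty (A.member p ≃* pairSubgroup R p)) :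
    ∃ F : G ≃* A.member p, ∀ x, F x = k (e x) := by
  obtain ⟨i⟩ := i
  have hinj : Function.Injective (k.comp e.toMonoidHom) := by
    refine injective_of_ker_le_center _ (hk.comp e.surjective) ?_ hG hfin (i.trans e.symm)
    intro x hx
    have h1 := hker (show e x ∈ k.ker from hx)
    rw [Subgroup.mem_center_iff] at h1 ⊢
    intro y
    apply e.injective
    rw [map_mul, map_mul, h1]
  exact ⟨MulEquiv.ofBijective _ ⟨hinj, hk.comp e.surjective⟩, fun _ => rfl⟩

theorem nonempty_parametrization (E : RootEmbedding R r s) (hM : IsRankTwoModel r s) (h : r.range ⊔ s.range = ⊤)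
    {A : GroupAmalgam.{w} (Sym2 (Fin 3))} (hA : IsPhanAmalgam R A) (hA' : IsUnambiguous R A) :
    Nonempty (GroupAmalgam.Parametrization r s A) := by
  have mem_zero : ∀ x : K, x ∈ R 0 ↔ ∃ q, E.φ (SU3.upper q) = x := fun x => by
    rw [← E.range_zero]; exact Iff.rfl
  have mem_one : ∀ x : K, x ∈ R 1 ↔ ∃ q, E.φ (SU3.lower q) = x := fun x => by
    rw [← E.range_one]; exact Iff.rfl
  have mem_two : ∀ x : K, x ∈ R 2 ↔ ∃ q, E.χ (s q) = x := fun x => by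
    rw [← E.range_two]; exact Iff.rfl
  obtain ⟨f, hf, hf', hf0, hf1⟩ := hA 0 1
  obtain ⟨g, hg, hg', hg1, hg2⟩ := hA 1 2
  obtain ⟨k, hk, hk', hk0, hk2⟩ := hA 0 2
  obtain ⟨F, hF⟩ := exists_equiv E.equivZeroOne f hf hf'
    (commutator_eq_top_of_range_sup SU3.range_upper_sup_range_lower)
    SU3.isRankTwoModel.finite_center (hA' 0 1)
  obtain ⟨G, hG⟩ := exists_equiv (E.equivOneTwo h) g hg hg'
    (commutator_eq_top_of_range_sup h) hM.finite_center (hA' 1 2)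
  obtain ⟨H, hH⟩ := exists_equiv (E.equivZeroTwo hM) k hk hk'
    (commutator_eq_top_of_range_sup range_inl_sup_range_inr) finite_center_prod (hA' 0 2)
  exact ⟨{
    f := F
    g := G
    h := H
    range_f_upper := range_eq E.equivZeroOne F f hF hf0 _ mem_zero
    range_f_lower := range_eq E.equivZeroOne F f hF hf1 _ mem_one
    range_g_left := range_eq (E.equivOneTwo h) G g hG hg1 _ fun x => by
      rw [mem_one]
      exact exists_congr fun q => by rw [E.φ_lower, coe_equivOneTwo]
    range_g_right := range_eq (E.equivOneTwo h) G g hG hg2 _ mem_two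
    range_h_left := range_eq (E.equivZeroTwo hM) H k hH hk0 _ fun x => by
      rw [mem_zero]
      exact exists_congr fun q => by rw [coe_equivZeroTwo, E.η_left]
    range_h_right := range_eq (E.equivZeroTwo hM) H k hH hk2 _ fun x => by
      rw [mem_two]
      exact exists_congr fun q => by rw [coe_equivZeroTwo, E.η_right] }⟩

/-- A strongly noncollapsing unambiguous Phan amalgam for a system of simple root subgroups as above
is isomorphic to the standard one. -/
theorem nonempty_iso (E : RootEmbedding R r s) (hM : IsRankTwoModel r s) (h : r.range ⊔ s.range = ⊤)
    {A : GroupAmalgam.{w} (Sym2 (Fin 3))} (hA : IsPhanAmalgam R A) (hA' : IsUnambiguous R A)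
    (hA'' : IsStronglyNoncollapsing A) : Nonempty (A.Iso (standardAmalgam R)) := by
  obtain ⟨X⟩ := E.nonempty_parametrization hM h hA hA'
  obtain ⟨X⟩ := X.nonempty_realization hM hA''
  exact X.nonempty_iso (E.realization hM h) hM

end RootEmbedding

end

/-! ### Type A₃: root subgroups of SU(4). -/

open Matrix ComplexConjugate UnitQuaternion

noncomputable section

/-- The group `SU(4)`. -/
abbrev SU4 : Type := Matrix.specialUnitaryGroup (Fin 4) ℂ

namespace SU4

/-- The embedding of `SU(3)` in `SU(4)` as the stabilizer of a basis vector. -/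
def block (e : Fin 3 ⊕ Fin 1 ≃ Fin 4) : SU3 →* SU4 where
  toFun x := ⟨Matrix.reindex e e (Matrix.fromBlocks x.1 0 0 1), by
    rw [Matrix.mem_specialUnitaryGroup_iff, Matrix.mem_unitaryGroup_iff, Matrix.det_reindex_self,
      Matrix.det_fromBlocks_zero₂₁, ((SU3.mem_iff x.1).1 x.2).2, Matrix.star_eq_conjTranspose,
      Matrix.conjTranspose_reindex, Matrix.fromBlocks_conjTranspose, Matrix.reindex_apply,
      Matrix.reindex_apply, Matrix.submatrix_mul_equiv, Matrix.fromBlocks_multiply]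
    have h : x.1 * x.1ᴴ = 1 :=
      Matrix.mem_unitaryGroup_iff.1 (Matrix.mem_specialUnitaryGroup_iff.1 x.2).1
    simp [h]⟩
  map_one' := Subtype.ext (by simp)
  map_mul' x y := Subtype.ext (by simp [Matrix.submatrix_mul_equiv, Matrix.fromBlocks_multiply])

theorem block_val (e : Fin 3 ⊕ Fin 1 ≃ Fin 4) (x : SU3) (a b : Fin 3 ⊕ Fin 1) :
    (block e x).1 (e a) (e b) = Matrix.fromBlocks x.1 0 0 1 a b := by
  change Matrix.reindex e e (Matrix.fromBlocks x.1 0 0 1) (e a) (e b) = _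
  simp

theorem block_injective (e : Fin 3 ⊕ Fin 1 ≃ Fin 4) : Function.Injective (block e) :=
  fun x y h => SU3.ext_entries fun a b => by
    have := block_val e x (Sum.inl a) (Sum.inl b)
    rw [h, block_val] at this
    exact this.symm

theorem block_mulVec_inr (e : Fin 3 ⊕ Fin 1 ≃ Fin 4) (x : SU3) :
    (block e x).1 *ᵥ Pi.single (e (Sum.inr 0)) 1 = Pi.single (e (Sum.inr 0)) 1 := by
  refine mulVec_single_of_col fun l => ?_
  obtain ⟨l, rfl⟩ := e.surjective l
  rw [block_val]
  rcases l with l | l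
  · simp
  · simp [Matrix.one_apply, Fin.fin_one_eq_zero l]

theorem block_mulVec_inl (e : Fin 3 ⊕ Fin 1 ≃ Fin 4) (x : SU3) (k : Fin 3) :
    (block e x).1 *ᵥ Pi.single (e (Sum.inl k)) 1 = Pi.single (e (Sum.inl k)) 1 ↔
      x.1 *ᵥ Pi.single k 1 = Pi.single k 1 := by
  constructor
  · intro h
    refine mulVec_single_of_col fun l => ?_
    have h1 := col_of_mulVec_single h (e (Sum.inl l))
    rw [block_val] at h1
    simpa [Matrix.one_apply] using h1
  · intro h
    refine mulVec_single_of_col fun l => ?_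
    obtain ⟨l, rfl⟩ := e.surjective l
    rw [block_val]
    rcases l with l | l
    · rw [Matrix.fromBlocks_apply₁₁, col_of_mulVec_single h]
      simp [Matrix.one_apply]
    · simp

/-- A unitary matrix fixing a basis vector has the standard row as well as the standard column
there, hence is a block matrix. -/
theorem exists_block_eq (e : Fin 3 ⊕ Fin 1 ≃ Fin 4) {g : SU4}
    (h : g.1 *ᵥ Pi.single (e (Sum.inr 0)) 1 = Pi.single (e (Sum.inr 0)) 1) :
    ∃ x, block e x = g := by
  have hg : g.1 = Matrix.reindex e e (Matrix.fromBlocks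
      (g.1.submatrix (e ∘ Sum.inl) (e ∘ Sum.inl)) 0 0 1) := by
    ext a b
    obtain ⟨a, rfl⟩ := e.surjective a
    obtain ⟨b, rfl⟩ := e.surjective b
    rcases a with a | a <;> rcases b with b | b
    · simp
    · rw [Fin.fin_one_eq_zero b, col_of_mulVec_single h]
      simp
    · rw [Fin.fin_one_eq_zero a, row_of_mulVec_single h]
      simp
    · rw [Fin.fin_one_eq_zero a, Fin.fin_one_eq_zero b, col_of_mulVec_single h]
      simp
  set m := g.1.submatrix (e ∘ Sum.inl) (e ∘ Sum.inl)
  obtain ⟨h1, h2⟩ := Matrix.mem_specialUnitaryGroup_iff.1 g.2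
  rw [hg, Matrix.det_reindex_self, Matrix.det_fromBlocks_zero₂₁, Matrix.det_one, mul_one] at h2
  rw [Matrix.mem_unitaryGroup_iff, hg, Matrix.star_eq_conjTranspose,
      Matrix.conjTranspose_reindex, Matrix.fromBlocks_conjTranspose, Matrix.reindex_apply,
      Matrix.reindex_apply, Matrix.submatrix_mul_equiv, Matrix.fromBlocks_multiply] at h1
  have h3 : m * mᴴ = 1 := by
    ext a b
    have := congrFun (congrFun h1 (e (Sum.inl a))) (e (Sum.inl b))
    simpa [Matrix.one_apply] using this
  exact ⟨⟨m, Matrix.mem_specialUnitaryGroup_iff.2 ⟨Matrix.mem_unitaryGroup_iff.2 h3, h2⟩⟩,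
    Subtype.ext hg.symm⟩

/-- The first three coordinates. -/
def fstEquiv : Fin 3 ⊕ Fin 1 ≃ Fin 4 := finSumFinEquiv

/-- The last three coordinates. -/
def sndEquiv : Fin 3 ⊕ Fin 1 ≃ Fin 4 := (Equiv.sumComm _ _).trans (finSumFinEquiv (m := 1) (n := 3))

@[simp] theorem fstEquiv_inl_zero : fstEquiv (Sum.inl 0) = 0 := rfl
@[simp] theorem fstEquiv_inl_one : fstEquiv (Sum.inl 1) = 1 := rfl
@[simp] theorem fstEquiv_inl_two : fstEquiv (Sum.inl 2) = 2 := rfl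
@[simp] theorem sndEquiv_inl_zero : sndEquiv (Sum.inl 0) = 1 := rfl
@[simp] theorem sndEquiv_inl_one : sndEquiv (Sum.inl 1) = 2 := rfl
@[simp] theorem sndEquiv_inl_two : sndEquiv (Sum.inl 2) = 3 := rfl
@[simp] theorem fstEquiv_inr : fstEquiv (Sum.inr 0) = 3 := rfl
@[simp] theorem sndEquiv_inr : sndEquiv (Sum.inr 0) = 0 := rfl

theorem map_suRootSubgroup (e : Fin 3 ⊕ Fin 1 ≃ Fin 4) (i : Fin 2) (l : Fin 3)
    (h0 : e (Sum.inr 0) ≠ l.castSucc) (h1 : e (Sum.inr 0) ≠ l.succ)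
    (h2 : ∀ k, (k ≠ i.castSucc ∧ k ≠ i.succ) ↔
      (e (Sum.inl k) ≠ l.castSucc ∧ e (Sum.inl k) ≠ l.succ)) :
    (suRootSubgroup 2 i).map (block e) = suRootSubgroup 3 l := by
  ext g
  constructor
  · rintro ⟨x, hx, rfl⟩ k hk hk'
    obtain ⟨k, rfl⟩ := e.surjective k
    rcases k with k | k
    · rw [block_mulVec_inl]
      obtain ⟨h3, h4⟩ := (h2 k).2 ⟨hk, hk'⟩
      exact hx k h3 h4
    · rw [Fin.fin_one_eq_zero k]
      exact block_mulVec_inr e x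
  · intro hg
    obtain ⟨x, rfl⟩ := exists_block_eq e (hg _ h0 h1)
    refine ⟨x, fun k hk hk' => ?_, rfl⟩
    obtain ⟨h3, h4⟩ := (h2 k).1 ⟨hk, hk'⟩
    exact (block_mulVec_inl e x k).1 (hg _ h3 h4)

theorem block_fst_upper (q : UnitQuaternion) : (block fstEquiv (SU3.upper q)).1 =
    !![q.fstC, q.sndC, 0, 0; -conj q.sndC, conj q.fstC, 0, 0; 0, 0, 1, 0; 0, 0, 0, 1] := by
  ext a b
  obtain ⟨a, rfl⟩ := fstEquiv.surjective a
  obtain ⟨b, rfl⟩ := fstEquiv.surjective b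
  rw [block_val]
  rcases a with a | a <;> rcases b with b | b <;> fin_cases a <;> fin_cases b <;>
    simp [SU3.upper_val, SU3.upperMatrix]

theorem block_fst_lower (q : UnitQuaternion) : (block fstEquiv (SU3.lower q)).1 =
    !![1, 0, 0, 0; 0, q.fstC, q.sndC, 0; 0, -conj q.sndC, conj q.fstC, 0; 0, 0, 0, 1] := by
  ext a b
  obtain ⟨a, rfl⟩ := fstEquiv.surjective a
  obtain ⟨b, rfl⟩ := fstEquiv.surjective b
  rw [block_val]
  rcases a with a | a <;> rcases b with b | b <;> fin_cases a <;> fin_cases b <;>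
    simp [SU3.lower_val, SU3.lowerMatrix]

theorem block_snd_upper (q : UnitQuaternion) : (block sndEquiv (SU3.upper q)).1 =
    !![1, 0, 0, 0; 0, q.fstC, q.sndC, 0; 0, -conj q.sndC, conj q.fstC, 0; 0, 0, 0, 1] := by
  ext a b
  obtain ⟨a, rfl⟩ := sndEquiv.surjective a
  obtain ⟨b, rfl⟩ := sndEquiv.surjective b
  rw [block_val]
  rcases a with a | a <;> rcases b with b | b <;> fin_cases a <;> fin_cases b <;>
    simp [SU3.upper_val, SU3.upperMatrix]

theorem block_snd_lower (q : UnitQuaternion) : (block sndEquiv (SU3.lower q)).1 =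
    !![1, 0, 0, 0; 0, 1, 0, 0; 0, 0, q.fstC, q.sndC; 0, 0, -conj q.sndC, conj q.fstC] := by
  ext a b
  obtain ⟨a, rfl⟩ := sndEquiv.surjective a
  obtain ⟨b, rfl⟩ := sndEquiv.surjective b
  rw [block_val]
  rcases a with a | a <;> rcases b with b | b <;> fin_cases a <;> fin_cases b <;>
    simp [SU3.lower_val, SU3.lowerMatrix]

/-- The simple root subgroups of `SU(4)`. -/
def rootEmbedding : RootEmbedding (suRootSubgroup 3) SU3.upper SU3.lower where
  φ := block fstEquiv
  χ := block sndEquiv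
  φ_injective := block_injective _
  χ_injective := block_injective _
  range_zero := by
    rw [MonoidHom.range_comp, SU3.range_upper]
    exact map_suRootSubgroup _ _ _ (by decide) (by decide) (by decide)
  range_one := by
    rw [MonoidHom.range_comp, SU3.range_lower]
    exact map_suRootSubgroup _ _ _ (by decide) (by decide) (by decide)
  range_two := by
    rw [MonoidHom.range_comp, SU3.range_lower]
    exact map_suRootSubgroup _ _ _ (by decide) (by decide) (by decide)
  φ_lower q := Subtype.ext ((block_fst_lower q).trans (block_snd_upper q).symm)
  commute q q' := by
    apply Subtype.ext
    rw [Submonoid.coe_mul, Submonoid.coe_mul, block_fst_upper, block_snd_lower]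
    ext a b
    fin_cases a <;> fin_cases b <;> simp [Matrix.mul_apply, Fin.sum_univ_four]
  ne h := by
    have h1 := congrFun (congrFun (congrArg Subtype.val h) 0) 0
    rw [block_fst_upper, block_snd_lower] at h1
    norm_num at h1

end SU4

end

/-! ### Type C₃: root subgroups of U_3(ℍ). -/

open Matrix ComplexConjugate UnitQuaternion

noncomputable section

/-- The group `U_3(ℍ)`. -/
abbrev U3H : Type := QuaternionicUnitaryGroup 3

namespace U3H

/-- The block diagonal matrix with blocks `1` and `m`. -/
def blockMatrix (m : Matrix (Fin 2) (Fin 2) (Quaternion ℝ)) :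
    Matrix (Fin 3) (Fin 3) (Quaternion ℝ) :=
  !![1, 0, 0; 0, m 0 0, m 0 1; 0, m 1 0, m 1 1]

theorem blockMatrix_mul (m n : Matrix (Fin 2) (Fin 2) (Quaternion ℝ)) :
    blockMatrix (m * n) = blockMatrix m * blockMatrix n := by
  ext1 a b
  rw [Matrix.mul_apply, Fin.sum_univ_three]
  fin_cases a <;> fin_cases b <;> simp [blockMatrix, Matrix.mul_apply]

theorem blockMatrix_one : blockMatrix 1 = 1 := by
  ext1 a b
  fin_cases a <;> fin_cases b <;> simp [blockMatrix]

theorem star_blockMatrix (m : Matrix (Fin 2) (Fin 2) (Quaternion ℝ)) :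
    star (blockMatrix m) = blockMatrix (star m) := by
  ext1 a b
  fin_cases a <;> fin_cases b <;> simp [blockMatrix, Matrix.star_apply]

/-- The embedding of `U_2(ℍ)` in `U_3(ℍ)` as the stabilizer of the first basis vector. -/
def block : U2H →* U3H where
  toFun x := ⟨blockMatrix x.1, by
    rw [Unitary.mem_iff, star_blockMatrix, ← blockMatrix_mul, ← blockMatrix_mul,
      (Unitary.mem_iff.1 x.2).1, (Unitary.mem_iff.1 x.2).2, blockMatrix_one, and_self]⟩
  map_one' := Subtype.ext blockMatrix_one
  map_mul' x y := Subtype.ext (blockMatrix_mul x.1 y.1)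

theorem block_val (x : U2H) :
    (block x).1 = !![1, 0, 0; 0, x.1 0 0, x.1 0 1; 0, x.1 1 0, x.1 1 1] := rfl

theorem block_injective : Function.Injective block := fun x y h => U2H.ext_entries fun a b => by
  have h1 := congrArg Subtype.val h
  rw [block_val, block_val] at h1
  have h2 := congrFun (congrFun h1 a.succ) b.succ
  fin_cases a <;> fin_cases b <;> simpa using h2

theorem suToQuaternionic_injective : Function.Injective (suToQuaternionic 3) := by
  intro x y h
  refine SU3.ext_entries fun a b => ?_
  have h1 := congrFun (congrFun (congrArg Subtype.val h) a) b
  exact Complex.ext (congrArg QuaternionAlgebra.re h1) (congrArg QuaternionAlgebra.imI h1)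

theorem suToQuaternionic_entry (x : SU3) (a b : Fin 3) :
    (suToQuaternionic 3 x).1 a b = quat (x.1 a b).re (x.1 a b).im 0 0 := rfl

theorem suToQuaternionic_upper (q : UnitQuaternion) : (suToQuaternionic 3 (SU3.upper q)).1 =
    !![quat q.re q.imI 0 0, quat q.imJ q.imK 0 0, 0; quat (-q.imJ) q.imK 0 0,
      quat q.re (-q.imI) 0 0, 0; 0, 0, 1] := by
  ext1 a b
  rw [suToQuaternionic_entry]
  fin_cases a <;> fin_cases b <;> apply U2H.quat_ext <;>
    simp [SU3.upper_val, SU3.upperMatrix, fstC, sndC]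

theorem suToQuaternionic_lower (q : UnitQuaternion) :
    suToQuaternionic 3 (SU3.lower q) = block (U2H.short q) := by
  apply Subtype.ext
  ext1 a b
  rw [suToQuaternionic_entry, block_val, U2H.short_val]
  fin_cases a <;> fin_cases b <;> apply U2H.quat_ext <;>
    simp [SU3.lower_val, SU3.lowerMatrix, U2H.shortMatrix, fstC, sndC]

theorem block_long (q : UnitQuaternion) :
    (block (U2H.long q)).1 = !![1, 0, 0; 0, 1, 0; 0, 0, q.1] := rfl

theorem range_block_long : (block.comp U2H.long).range = quaternionicRootSubgroup 2 := by
  ext g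
  constructor
  · rintro ⟨q, rfl⟩ k hk
    funext l
    rw [Matrix.mulVec_single_one, Matrix.col_apply, MonoidHom.comp_apply, block_long]
    fin_cases k <;> fin_cases l <;> simp at hk ⊢
  · intro hg
    have hcol : ∀ k, k ≠ 2 → ∀ l, g.1 l k = (1 : Matrix (Fin 3) (Fin 3) (Quaternion ℝ)) l k := by
      intro k hk l
      have := congrFun (hg k hk) l
      rw [Matrix.mulVec_single_one] at this
      simpa [Matrix.one_apply, Pi.single_apply] using this
    have hstar : star g.1 * g.1 = 1 := (Unitary.mem_iff.1 g.2).1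
    have hstar' : g.1 * star g.1 = 1 := (Unitary.mem_iff.1 g.2).2
    -- The last column is orthogonal to the first two, which are standard basis vectors.
    have hrow : ∀ k, k ≠ 2 → g.1 k 2 = 0 := by
      intro k hk
      have h1 := congrFun (congrFun hstar k) 2
      rw [Matrix.mul_apply] at h1
      simp only [Matrix.star_apply, hcol k hk] at h1
      simpa [Matrix.one_apply, hk, apply_ite (star : Quaternion ℝ → Quaternion ℝ)] using h1
    have h2 := congrFun (congrFun hstar 2) 2
    have h3 := congrFun (congrFun hstar' 2) 2
    rw [Matrix.mul_apply, Fin.sum_univ_three] at h2 h3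
    simp only [Matrix.star_apply, hrow 0 (by decide), hrow 1 (by decide),
      hcol 0 (by decide), hcol 1 (by decide)] at h2 h3
    simp only [Matrix.one_apply, Fin.reduceEq, if_false, if_true, star_zero, mul_zero,
      zero_add] at h2 h3
    refine ⟨⟨g.1 2 2, Unitary.mem_iff.2 ⟨h2, h3⟩⟩, ?_⟩
    apply Subtype.ext
    ext1 a b
    rw [MonoidHom.comp_apply, block_long]
    fin_cases a <;> fin_cases b <;>
      simp [hrow 0 (by decide), hrow 1 (by decide), hcol 0 (by decide), hcol 1 (by decide)]

/-- The simple root subgroups of `U_3(ℍ)`. -/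
def rootEmbedding : RootEmbedding quaternionicRootSubgroup (genLeft U2H.short U2H.long)
    (genRight U2H.short U2H.long) where
  φ := suToQuaternionic 3
  χ := block.comp (genSubgroup U2H.short U2H.long).subtype
  φ_injective := suToQuaternionic_injective
  χ_injective := block_injective.comp Subtype.val_injective
  range_zero := by
    rw [MonoidHom.range_comp, SU3.range_upper]
    rfl
  range_one := by
    rw [MonoidHom.range_comp, SU3.range_lower]
    rfl
  range_two := range_block_long
  φ_lower := suToQuaternionic_lower
  commute q q' := by
    apply Subtype.ext
    change (suToQuaternionic 3 (SU3.upper q)).1 * (block (U2H.long q')).1 =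
      (block (U2H.long q')).1 * (suToQuaternionic 3 (SU3.upper q)).1
    rw [block_long, suToQuaternionic_upper]
    ext1 a b
    rw [Matrix.mul_apply, Fin.sum_univ_three, Matrix.mul_apply, Fin.sum_univ_three]
    fin_cases a <;> fin_cases b <;> simp
  ne h := by
    have h1 : (suToQuaternionic 3 (SU3.upper (-1))).1 = (block (U2H.long (-1))).1 :=
      congrArg Subtype.val h
    rw [block_long, suToQuaternionic_upper] at h1
    have h2 := congrArg QuaternionAlgebra.re (congrFun (congrFun h1 0) 0)
    norm_num at h2

end U3H

end

/-! ### Representations of matrix rings from matrix units. -/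

open Matrix ComplexConjugate UnitQuaternion

noncomputable section

section matrixUnits
variable {D R n : Type*} [Ring D] [Ring R] [Fintype n] [DecidableEq n]

/-- A multiplicative additive map becomes a unital multiplicative map when it is completed by the
complement of the idempotent that is the image of the identity. -/
def NonUnitalRingHom.completion {S : Type*} [Ring S] (f : S →ₙ+* R) : S →* R where
  toFun x := f x + (1 - f 1)
  map_one' := by rw [add_sub_cancel]
  map_mul' x y := by
    have h1 : f x * f 1 = f x := by rw [← map_mul, mul_one]
    have h2 : f 1 * f y = f y := by rw [← map_mul, one_mul]
    have h3 : f 1 * f 1 = f 1 := by rw [← map_mul, one_mul]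
    rw [map_mul]
    simp only [mul_add, add_mul, mul_sub, sub_mul, mul_one, one_mul, h1, h2, h3]
    abel

theorem NonUnitalRingHom.completion_apply {S : Type*} [Ring S] (f : S →ₙ+* R) (x : S) :
    f.completion x = f x + (1 - f 1) := rfl

theorem NonUnitalRingHom.completion_injective {S : Type*} [Ring S] {f : S →ₙ+* R}
    (hf : Function.Injective f) : Function.Injective f.completion :=
  fun _ _ h => hf (add_right_cancel h)

theorem NonUnitalRingHom.injective_of_map_one_ne_zero {S : Type*} [DivisionRing S] {f : S →ₙ+* R}
    (h : f 1 ≠ 0) : Function.Injective f := by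
  rw [injective_iff_map_eq_zero]
  intro x hx
  by_contra hx0
  apply h
  rw [← mul_inv_cancel₀ hx0, map_mul, hx, zero_mul]

/-- The representation of a matrix ring obtained by transporting a representation of the coefficients
along a system of matrix units. -/
def ofMatrixUnits (h : D →ₙ+* R) (x y : n → R)
    (hxy : ∀ a b, h 1 * (y a * x b) * h 1 = if a = b then h 1 else 0) : Matrix n n D →ₙ+* R where
  toFun m := ∑ a, ∑ b, x a * h (m a b) * y b
  map_zero' := by simp
  map_add' m m' := by simp [mul_add, add_mul, Finset.sum_add_distrib]
  map_mul' m m' := by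
    have key : ∀ u v a b, h u * y a * (x b * h v) = if a = b then h (u * v) else 0 := by
      intro u v a b
      have h1 : h u = h u * h 1 := by rw [← map_mul, mul_one]
      have h2 : h v = h 1 * h v := by rw [← map_mul, one_mul]
      calc h u * y a * (x b * h v) = h u * (h 1 * (y a * x b) * h 1) * h v := by
            nth_rw 1 [h1, h2]; simp only [mul_assoc]
        _ = if a = b then h (u * v) else 0 := by
            rw [hxy]
            split_ifs
            · rw [← h1, ← map_mul]
            · simp
    simp only [Matrix.mul_apply, map_sum, Finset.mul_sum, Finset.sum_mul]
    have key' : ∀ a k l b, x a * h (m a k) * y k * (x l * h (m' l b) * y b) =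
        if k = l then x a * h (m a k * m' l b) * y b else 0 := by
      intro a k l b
      rw [show x a * h (m a k) * y k * (x l * h (m' l b) * y b) =
        x a * (h (m a k) * y k * (x l * h (m' l b))) * y b by simp only [mul_assoc], key]
      split_ifs <;> simp
    simp only [key']
    rw [Finset.sum_congr rfl fun a _ => Finset.sum_comm, Finset.sum_comm]
    exact Finset.sum_congr rfl fun k _ => Finset.sum_comm.trans (by simp)

theorem ofMatrixUnits_apply (h : D →ₙ+* R) (x y : n → R)
    (hxy : ∀ a b, h 1 * (y a * x b) * h 1 = if a = b then h 1 else 0) (m : Matrix n n D) :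
    ofMatrixUnits h x y hxy m = ∑ a, ∑ b, x a * h (m a b) * y b := rfl

/-- The entries of a matrix are recovered by multiplying its image with matrix units on both sides.
-/
theorem ofMatrixUnits_injective {h : D →ₙ+* R} {x y : n → R}
    (hxy : ∀ a b, h 1 * (y a * x b) * h 1 = if a = b then h 1 else 0)
    (hh : Function.Injective h) : Function.Injective (ofMatrixUnits h x y hxy) := by
  have h1 : ∀ u, h u * h 1 = h u := fun u => by rw [← map_mul, mul_one]
  have h2 : ∀ u, h 1 * h u = h u := fun u => by rw [← map_mul, one_mul]
  have key : ∀ m a b, h 1 * y a * ofMatrixUnits h x y hxy m * (x b * h 1) = h (m a b) := by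
    intro m a b
    have key' : ∀ c d, h 1 * y a * (x c * h (m c d) * y d) * (x b * h 1) =
        if a = c then (if d = b then h (m c d) else 0) else 0 := by
      intro c d
      calc _ = (h 1 * (y a * x c) * h 1) * h (m c d) * (h 1 * (y d * x b) * h 1) := by
            rw [show h 1 * y a * (x c * h (m c d) * y d) * (x b * h 1) =
              h 1 * (y a * x c) * h (m c d) * ((y d * x b) * h 1) by simp only [mul_assoc]]
            have h1' : ∀ u z, h u * (h 1 * z) = h u * z := fun u z => by rw [← mul_assoc, h1]
            have h2' : ∀ u z, h 1 * (h u * z) = h u * z := fun u z => by rw [← mul_assoc, h2]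
            simp only [mul_assoc, h2, h1']
        _ = _ := by
            rw [hxy, hxy]
            split_ifs <;> simp [h1, h2]
    simp only [ofMatrixUnits_apply, Finset.mul_sum, Finset.sum_mul, key']
    simp
  intro m m' hm
  ext a b
  apply hh
  rw [← key, ← key, hm]

end matrixUnits

section coefficients
variable {R : Type*} [Ring R] [Algebra ℝ R]

/-- The representation of the complex numbers with given images of `1` and `i`. -/
def complexHom (p J : R) (hp : p * p = p) (hpJ : p * J = J) (hJp : J * p = J)
    (hJ : J * J = -p) : ℂ →ₙ+* R where
  toFun z := z.re • p + z.im • J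
  map_zero' := by simp
  map_add' z w := by
    simp only [Complex.add_re, Complex.add_im]
    module
  map_mul' z w := by
    simp only [mul_add, add_mul, smul_mul_smul_comm, hp, hpJ, hJp, hJ, Complex.mul_re,
      Complex.mul_im]
    module

/-- The representation of the quaternions with given images of the basis. -/
def quaternionHom (p u v w : R) (hp : p * p = p) (hu : p * u = u) (hu' : u * p = u)
    (hv : p * v = v) (hv' : v * p = v) (huu : u * u = -p) (hvv : v * v = -p) (huv : u * v = w)
    (hvu : v * u = -w) : Quaternion ℝ →ₙ+* R where
  toFun q := q.re • p + q.imI • u + q.imJ • v + q.imK • w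
  map_zero' := by simp
  map_add' q q' := by
    simp only [Quaternion.re_add, Quaternion.imI_add, Quaternion.imJ_add, Quaternion.imK_add]
    module
  map_mul' q q' := by
    have e1 : p * w = w := by rw [← huv, ← mul_assoc, hu]
    have e2 : w * p = w := by rw [← huv, mul_assoc, hv']
    have e3 : u * w = -v := by rw [← huv, ← mul_assoc, huu, neg_mul, hv]
    have e4 : w * v = -u := by rw [← huv, mul_assoc, hvv, mul_neg, hu']
    have e5 : v * w = u := by
      rw [show w = -(v * u) by rw [hvu, neg_neg], mul_neg, ← mul_assoc, hvv, neg_mul, hu, neg_neg]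
    have e6 : w * u = v := by
      rw [show w = -(v * u) by rw [hvu, neg_neg], neg_mul, mul_assoc, huu, mul_neg, hv', neg_neg]
    have e7 : w * w = -p := by rw [← huv, mul_assoc, huv, e5, huu]
    simp only [mul_add, add_mul, smul_mul_smul_comm, hp, hu, hu', hv, hv', huu, hvv, huv, hvu,
      e1, e2, e3, e4, e5, e6, e7, Quaternion.re_mul, Quaternion.imI_mul, Quaternion.imJ_mul,
      Quaternion.imK_mul]
    module

end coefficients

end

/-! ### SU(3) and U_2(ℍ) inside a Clifford algebra. -/

open Matrix ComplexConjugate UnitQuaternion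

noncomputable section

/-- A family of anticommuting elements with square `1`. -/
structure IsCliffordFamily {ι R : Type*} [Ring R] (e : ι → R) : Prop where
  sq : ∀ a, e a * e a = 1
  anticomm : ∀ {a b}, a ≠ b → e a * e b = -(e b * e a)

namespace IsCliffordFamily

section
variable {ι R : Type*} [Ring R] {e : ι → R} (he : IsCliffordFamily e)
include he

theorem sq_assoc (a : ι) (x : R) : e a * (e a * x) = x := by
  rw [← mul_assoc, he.sq, one_mul]

theorem anticomm_assoc {a b : ι} (h : a ≠ b) (x : R) :
    e a * (e b * x) = -(e b * (e a * x)) := by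
  rw [← mul_assoc, he.anticomm h, neg_mul, mul_assoc]

/-- The order condition orients anticommutation as a terminating rewrite rule, so that `simp` sorts
products of generators. -/
theorem swap [LT ι] {a b : ι} (_ : b < a) (h : a ≠ b) : e a * e b = -(e b * e a) := he.anticomm h

theorem swap_assoc [LT ι] {a b : ι} (_ : b < a) (h : a ≠ b) (x : R) :
    e a * (e b * x) = -(e b * (e a * x)) := he.anticomm_assoc h x

end

variable {R : Type*} [Ring R] [Algebra ℝ R] {e : Fin 7 → R} (he : IsCliffordFamily e)

/-- The idempotent for the representation of `SU(3)`. -/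
def idem₃ (e : Fin 7 → R) : R :=
  (1 / 4 : ℝ) • (1 + e 0 * (e 1 * (e 2 * e 3)) + e 2 * (e 3 * (e 4 * e 5)) -
    e 0 * (e 1 * (e 4 * e 5)))

/-- The imaginary unit for the representation of `SU(3)`. -/
def imag₃ (e : Fin 7 → R) : R :=
  (1 / 4 : ℝ) • (e 0 * (e 1 * (e 2 * (e 3 * (e 4 * e 5)))) + e 4 * e 5 + e 0 * e 1 - e 2 * e 3)

/-- The left matrix units for the representation of `SU(3)`. -/
def left₃ (e : Fin 7 → R) : Fin 3 → R := ![e 0 * e 2, 1, e 4 * e 2]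

/-- The right matrix units for the representation of `SU(3)`. -/
def right₃ (e : Fin 7 → R) : Fin 3 → R := ![e 2 * e 0, 1, e 2 * e 4]

include he

/-- With the commuting involutions P = e₀e₁e₂e₃ and Q = e₂e₃e₄e₅ one has PQ = -e₀e₁e₄e₅, so the
element is (1 + P)(1 + Q)/4, the projection to the joint eigenvalue (+,+). -/
theorem idem₃_mul_idem₃ : idem₃ e * idem₃ e = idem₃ e := by
  simp only [idem₃, mul_add, add_mul, mul_sub, sub_mul, smul_mul_smul_comm, mul_one, one_mul,
    mul_assoc]
  simp [he.sq, he.sq_assoc, he.swap, he.swap_assoc]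
  module

theorem idem₃_mul_imag₃ : idem₃ e * imag₃ e = imag₃ e := by
  simp only [idem₃, imag₃, mul_add, add_mul, mul_sub, sub_mul, smul_mul_smul_comm, one_mul,
    mul_assoc]
  simp [he.sq, he.sq_assoc, he.swap, he.swap_assoc]
  module

theorem imag₃_mul_idem₃ : imag₃ e * idem₃ e = imag₃ e := by
  simp only [idem₃, imag₃, mul_add, add_mul, mul_sub, sub_mul, smul_mul_smul_comm, mul_one,
    mul_assoc]
  simp [he.sq, he.sq_assoc, he.swap, he.swap_assoc]
  module

/-- The imaginary unit is e₄e₅ times the idempotent, and e₄e₅ commutes with the idempotent and has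
square -1. -/
theorem imag₃_mul_imag₃ : imag₃ e * imag₃ e = -idem₃ e := by
  simp only [idem₃, imag₃, mul_add, add_mul, mul_sub, sub_mul, smul_mul_smul_comm,
    mul_assoc]
  simp [he.sq, he.sq_assoc, he.swap, he.swap_assoc]
  module

/-- Conjugation by e₀ flips the sign of P, conjugation by e₄ that of Q. The four conjugates are the
joint spectral projections and add up to 1. -/
theorem idem₃_ne_zero [Nontrivial R] : idem₃ e ≠ 0 := by
  intro h
  have h1 : idem₃ e + e 0 * idem₃ e * e 0 + e 4 * idem₃ e * e 4 +
      e 4 * e 0 * idem₃ e * (e 0 * e 4) = 1 := by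
    simp only [idem₃, mul_add, add_mul, mul_sub, sub_mul, smul_mul_assoc, mul_smul_comm, mul_one,
      mul_assoc]
    simp [he.sq, he.sq_assoc, he.swap, he.swap_assoc]
    module
  rw [h] at h1
  simp at h1

/-- The representation of the complex numbers for the representation of `SU(3)`. -/
def coeff₃ : ℂ →ₙ+* R :=
  complexHom (idem₃ e) (imag₃ e) he.idem₃_mul_idem₃ he.idem₃_mul_imag₃ he.imag₃_mul_idem₃
    he.imag₃_mul_imag₃

theorem coeff₃_apply (z : ℂ) : he.coeff₃ z = z.re • idem₃ e + z.im • imag₃ e := rfl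

theorem coeff₃_one : he.coeff₃ 1 = idem₃ e := by simp [coeff₃_apply]

/-- The element e₀e₂ flips only Q and e₄e₂ flips only P, so the three indices correspond to the
eigenvalues (+,-), (+,+), (-,+), whose projections are orthogonal. On (-,-) the completed
representation is trivial. -/
theorem matrixUnits₃ (a b : Fin 3) : he.coeff₃ 1 * (right₃ e a * left₃ e b) * he.coeff₃ 1 =
    if a = b then he.coeff₃ 1 else 0 := by
  rw [coeff₃_one]
  fin_cases a <;> fin_cases b <;>
    simp [left₃, right₃, he.sq, he.sq_assoc, mul_assoc, he.idem₃_mul_idem₃] <;>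
    simp only [idem₃, mul_add, add_mul, mul_sub, sub_mul, smul_mul_assoc,
      mul_smul_comm, mul_one, one_mul, mul_assoc] <;>
    simp [he.sq, he.sq_assoc, he.swap, he.swap_assoc] <;>
    module

/-- The representation of matrices of size three. -/
def rep₃ : Matrix (Fin 3) (Fin 3) ℂ →ₙ+* R :=
  ofMatrixUnits he.coeff₃ (left₃ e) (right₃ e) he.matrixUnits₃

theorem rep₃_injective [Nontrivial R] : Function.Injective he.rep₃ :=
  ofMatrixUnits_injective _ (NonUnitalRingHom.injective_of_map_one_ne_zero (by
    rw [coeff₃_one]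
    exact he.idem₃_ne_zero))

theorem rep₃_apply (m : Matrix (Fin 3) (Fin 3) ℂ) : he.rep₃.completion m =
    e 0 * e 2 * he.coeff₃ (m 0 0) * (e 2 * e 0) + e 0 * e 2 * he.coeff₃ (m 0 1) +
    e 0 * e 2 * he.coeff₃ (m 0 2) * (e 2 * e 4) +
    (he.coeff₃ (m 1 0) * (e 2 * e 0) + he.coeff₃ (m 1 1) + he.coeff₃ (m 1 2) * (e 2 * e 4)) +
    (e 4 * e 2 * he.coeff₃ (m 2 0) * (e 2 * e 0) + e 4 * e 2 * he.coeff₃ (m 2 1) +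
      e 4 * e 2 * he.coeff₃ (m 2 2) * (e 2 * e 4)) +
    (1 - (e 0 * e 2 * he.coeff₃ 1 * (e 2 * e 0) + he.coeff₃ 1 +
      e 4 * e 2 * he.coeff₃ 1 * (e 2 * e 4))) := by
  rw [NonUnitalRingHom.completion_apply, rep₃, ofMatrixUnits_apply, ofMatrixUnits_apply]
  simp [Fin.sum_univ_three, left₃, right₃]

theorem rep₃_upper (q : UnitQuaternion) : he.rep₃.completion (SU3.upper q).1 =
    (1 / 2 : ℝ) • (1 - e 0 * (e 1 * (e 2 * e 3))) +
    (q.re / 2) • (1 + e 0 * (e 1 * (e 2 * e 3))) + (q.imI / 2) • (e 2 * e 3 - e 0 * e 1) +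
    (q.imJ / 2) • (e 0 * e 2 + e 1 * e 3) + (q.imK / 2) • (e 1 * e 2 - e 0 * e 3) := by
  rw [rep₃_apply, SU3.upper_val]
  simp [SU3.upperMatrix, coeff₃_apply, fstC, sndC]
  simp only [idem₃, imag₃, mul_add, add_mul, mul_sub, sub_mul, smul_add, smul_sub, smul_mul_assoc,
    mul_smul_comm, mul_one, one_mul, mul_assoc, neg_mul]
  simp [he.sq, he.sq_assoc, he.swap, he.swap_assoc]
  module

theorem rep₃_lower (q : UnitQuaternion) : he.rep₃.completion (SU3.lower q).1 =
    (1 / 2 : ℝ) • (1 - e 2 * (e 3 * (e 4 * e 5))) +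
    (q.re / 2) • (1 + e 2 * (e 3 * (e 4 * e 5))) + (q.imI / 2) • (e 4 * e 5 - e 2 * e 3) +
    (q.imJ / 2) • (e 2 * e 4 + e 3 * e 5) + (q.imK / 2) • (e 3 * e 4 - e 2 * e 5) := by
  rw [rep₃_apply, SU3.lower_val]
  simp [SU3.lowerMatrix, coeff₃_apply, fstC, sndC]
  simp only [idem₃, imag₃, mul_add, add_mul, mul_sub, sub_mul, smul_add, smul_sub, smul_mul_assoc,
    mul_smul_comm, mul_one, one_mul, mul_assoc, mul_neg, neg_mul]
  simp [he.sq, he.sq_assoc, he.swap, he.swap_assoc]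
  module

omit he in
/-- The idempotent for the representation of `U_2(ℍ)`. -/
def idem₂ (e : Fin 7 → R) : R := (1 / 2 : ℝ) • (1 + e 2 * (e 3 * (e 4 * e 5)))

omit he in
/-- The image of `i` for the representation of `U_2(ℍ)`. -/
def imagI₂ (e : Fin 7 → R) : R := (1 / 2 : ℝ) • (e 4 * e 5 - e 2 * e 3)

omit he in
/-- The image of `j` for the representation of `U_2(ℍ)`. -/
def imagJ₂ (e : Fin 7 → R) : R := (1 / 2 : ℝ) • (e 2 * e 4 + e 3 * e 5)

omit he in
/-- The image of `k` for the representation of `U_2(ℍ)`. -/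
def imagK₂ (e : Fin 7 → R) : R := (1 / 2 : ℝ) • (e 3 * e 4 - e 2 * e 5)

omit he in
/-- The left matrix units for the representation of `U_2(ℍ)`. -/
def left₂ (e : Fin 7 → R) : Fin 2 → R := ![e 5 * e 6, 1]

omit he in
/-- The right matrix units for the representation of `U_2(ℍ)`. -/
def right₂ (e : Fin 7 → R) : Fin 2 → R := ![e 6 * e 5, 1]

theorem relations₂ : idem₂ e * idem₂ e = idem₂ e ∧ idem₂ e * imagI₂ e = imagI₂ e ∧
    imagI₂ e * idem₂ e = imagI₂ e ∧ idem₂ e * imagJ₂ e = imagJ₂ e ∧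
    imagJ₂ e * idem₂ e = imagJ₂ e ∧ imagI₂ e * imagI₂ e = -idem₂ e ∧
    imagJ₂ e * imagJ₂ e = -idem₂ e ∧ imagI₂ e * imagJ₂ e = imagK₂ e ∧
    imagJ₂ e * imagI₂ e = -imagK₂ e := by
  refine ⟨?_, ?_, ?_, ?_, ?_, ?_, ?_, ?_, ?_⟩ <;>
    simp only [idem₂, imagI₂, imagJ₂, imagK₂, mul_add, add_mul, mul_sub, sub_mul,
      smul_mul_smul_comm, mul_one, one_mul, mul_assoc] <;>
    simp [he.sq, he.sq_assoc, he.swap, he.swap_assoc] <;>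
    module

/-- The idempotent is (1 + Q)/2, and conjugation by e₂ turns it into the complementary one. -/
theorem idem₂_ne_zero [Nontrivial R] : idem₂ e ≠ 0 := by
  intro h
  have h1 : idem₂ e + e 2 * idem₂ e * e 2 = 1 := by
    simp only [idem₂, mul_add, add_mul, smul_mul_assoc, mul_smul_comm, mul_one, mul_assoc]
    simp [he.sq, he.sq_assoc, he.swap, he.swap_assoc]
    module
  rw [h] at h1
  simp at h1

/-- The representation of the quaternions for the representation of `U_2(ℍ)`. -/
def coeff₂ : Quaternion ℝ →ₙ+* R :=
  quaternionHom (idem₂ e) (imagI₂ e) (imagJ₂ e) (imagK₂ e) he.relations₂.1 he.relations₂.2.1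
    he.relations₂.2.2.1 he.relations₂.2.2.2.1 he.relations₂.2.2.2.2.1 he.relations₂.2.2.2.2.2.1
    he.relations₂.2.2.2.2.2.2.1 he.relations₂.2.2.2.2.2.2.2.1 he.relations₂.2.2.2.2.2.2.2.2

theorem coeff₂_apply (q : Quaternion ℝ) : he.coeff₂ q = q.re • idem₂ e + q.imI • imagI₂ e +
    q.imJ • imagJ₂ e + q.imK • imagK₂ e := rfl

theorem coeff₂_one : he.coeff₂ 1 = idem₂ e := by simp [coeff₂_apply]

theorem matrixUnits₂ (a b : Fin 2) : he.coeff₂ 1 * (right₂ e a * left₂ e b) * he.coeff₂ 1 =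
    if a = b then he.coeff₂ 1 else 0 := by
  rw [coeff₂_one]
  fin_cases a <;> fin_cases b <;>
    simp [left₂, right₂, he.sq, he.sq_assoc, mul_assoc, he.relations₂.1] <;>
    simp only [idem₂, mul_add, add_mul, smul_mul_assoc,
      mul_smul_comm, mul_one, one_mul, mul_assoc] <;>
    simp [he.sq, he.sq_assoc, he.swap, he.swap_assoc]

/-- The representation of quaternionic matrices of size two. -/
def rep₂ : Matrix (Fin 2) (Fin 2) (Quaternion ℝ) →ₙ+* R :=
  ofMatrixUnits he.coeff₂ (left₂ e) (right₂ e) he.matrixUnits₂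

theorem rep₂_injective [Nontrivial R] : Function.Injective he.rep₂ :=
  ofMatrixUnits_injective _ (NonUnitalRingHom.injective_of_map_one_ne_zero (by
    rw [coeff₂_one]
    exact he.idem₂_ne_zero))

theorem rep₂_apply (m : Matrix (Fin 2) (Fin 2) (Quaternion ℝ)) : he.rep₂.completion m =
    e 5 * e 6 * he.coeff₂ (m 0 0) * (e 6 * e 5) + e 5 * e 6 * he.coeff₂ (m 0 1) +
    (he.coeff₂ (m 1 0) * (e 6 * e 5) + he.coeff₂ (m 1 1)) +
    (1 - (e 5 * e 6 * he.coeff₂ 1 * (e 6 * e 5) + he.coeff₂ 1)) := by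
  rw [NonUnitalRingHom.completion_apply, rep₂, ofMatrixUnits_apply, ofMatrixUnits_apply]
  simp [left₂, right₂]

theorem rep₂_long (q : UnitQuaternion) : he.rep₂.completion (U2H.long q).1 =
    (1 / 2 : ℝ) • (1 - e 2 * (e 3 * (e 4 * e 5))) +
    (q.re / 2) • (1 + e 2 * (e 3 * (e 4 * e 5))) + (q.imI / 2) • (e 4 * e 5 - e 2 * e 3) +
    (q.imJ / 2) • (e 2 * e 4 + e 3 * e 5) + (q.imK / 2) • (e 3 * e 4 - e 2 * e 5) := by
  rw [rep₂_apply, U2H.long_val, U2H.longMatrix_eq]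
  simp [coeff₂_apply]
  simp only [idem₂, imagI₂, imagJ₂, imagK₂, mul_add, add_mul, smul_add, smul_sub,
    smul_mul_assoc, mul_smul_comm, mul_one, mul_assoc]
  simp [he.sq, he.sq_assoc, he.swap, he.swap_assoc]
  module

theorem rep₂_short (q : UnitQuaternion) : he.rep₂.completion (U2H.short q).1 =
    q.re • 1 - q.imI • (e 4 * e 5) + q.imJ • (e 5 * e 6) - q.imK • (e 4 * e 6) := by
  rw [rep₂_apply, U2H.short_val]
  simp [coeff₂_apply, U2H.shortMatrix]
  simp only [idem₂, imagI₂, mul_add, add_mul, mul_sub, sub_mul, smul_add, smul_sub,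
    smul_mul_assoc, mul_smul_comm, mul_one, one_mul, mul_assoc, neg_mul]
  simp [he.sq, he.sq_assoc, he.swap, he.swap_assoc]
  module

/-- One factor involves even products of e₀, …, e₃, the other even products of e₄, e₅, e₆. -/
theorem commute_rep (q q' : UnitQuaternion) : Commute (he.rep₃.completion (SU3.upper q).1)
    (he.rep₂.completion (U2H.short q').1) := by
  rw [rep₃_upper, rep₂_short, Commute, SemiconjBy]
  simp only [mul_add, add_mul, mul_sub, sub_mul, smul_add, smul_sub,
    smul_mul_assoc, mul_smul_comm, mul_one, one_mul, mul_assoc]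
  simp [he.swap, he.swap_assoc]
  module

/-- The two elements are -e₀e₁e₂e₃ and -1. If they agreed, conjugation by e₀, which negates
e₀e₁e₂e₃, would give 1 = -1. -/
theorem rep_ne [Nontrivial R] : he.rep₃.completion (SU3.upper (-1)).1 ≠
    he.rep₂.completion (U2H.short (-1)).1 := by
  intro h
  rw [rep₃_upper, rep₂_short] at h
  have h1 : e 0 * (e 1 * (e 2 * e 3)) = 1 := by
    simp at h
    linear_combination (norm := module) (-1 : ℝ) • h
  have h2 : e 0 * (e 0 * (e 1 * (e 2 * e 3))) * e 0 = -(e 0 * (e 1 * (e 2 * e 3))) := by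
    simp [he.sq_assoc, he.swap, he.swap_assoc, mul_assoc]
  rw [h1, mul_one, he.sq] at h2
  have h3 : (2 : ℝ) • (1 : R) = 0 := by
    linear_combination (norm := module) (1 : ℝ) • h2
  exact one_ne_zero ((smul_eq_zero_iff_right (two_ne_zero (α := ℝ))).1 h3)

end IsCliffordFamily

end

/-! ### Type B₃: root subgroups of Spin(7). -/

open Matrix ComplexConjugate UnitQuaternion

noncomputable section

namespace Spin7

/-- The standard basis of `ℝ^7` in the Clifford algebra. -/
def gen (a : Fin 7) : CliffordAlgebra sumSquares7 :=
  CliffordAlgebra.ι sumSquares7 (Pi.single a 1)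

theorem sumSquares7_apply (v : Fin 7 → ℝ) : sumSquares7 v = ∑ i, v i * v i := by
  simp [sumSquares7, QuadraticMap.weightedSumSquares_apply]

theorem isCliffordFamily_gen : IsCliffordFamily gen where
  sq a := by
    rw [gen, CliffordAlgebra.ι_sq_scalar, sumSquares7_apply]
    simp [Pi.single_apply]
  anticomm {a b} h := by
    apply CliffordAlgebra.ι_mul_ι_comm_of_isOrtho
    rw [QuadraticMap.isOrtho_def]
    simp only [sumSquares7_apply, ← Finset.sum_add_distrib]
    refine Finset.sum_congr rfl fun i _ => ?_
    by_cases h1 : i = a <;> by_cases h2 : i = b <;> simp_all [Pi.single_apply]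

instance : Nontrivial (CliffordAlgebra sumSquares7) :=
  letI : Invertible (2 : ℝ) := invertibleOfNonzero two_ne_zero
  inferInstance

theorem ι_mul_ι_mem_spinGroup {v w : Fin 7 → ℝ} (hv : sumSquares7 v = 1)
    (hw : sumSquares7 w = 1) :
    CliffordAlgebra.ι sumSquares7 v * CliffordAlgebra.ι sumSquares7 w ∈ spinGroup sumSquares7 := by
  have hsq : ∀ {v}, sumSquares7 v = 1 → CliffordAlgebra.ι sumSquares7 v *
      CliffordAlgebra.ι sumSquares7 v = 1 := fun h => by
    rw [CliffordAlgebra.ι_sq_scalar, h, map_one]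
  have hlip : ∀ {v}, sumSquares7 v = 1 → CliffordAlgebra.ι sumSquares7 v ∈
      (lipschitzGroup sumSquares7).toSubmonoid.map
        (Units.coeHom <| CliffordAlgebra sumSquares7) := fun {v} h =>
    ⟨⟨_, _, hsq h, hsq h⟩, Subgroup.subset_closure ⟨v, rfl⟩, rfl⟩
  have h1 : ∀ {v w}, sumSquares7 v = 1 → sumSquares7 w = 1 →
      CliffordAlgebra.ι sumSquares7 w * CliffordAlgebra.ι sumSquares7 v *
        (CliffordAlgebra.ι sumSquares7 v * CliffordAlgebra.ι sumSquares7 w) = 1 := by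
    intro v w hv hw
    rw [mul_assoc, ← mul_assoc (CliffordAlgebra.ι sumSquares7 v), hsq hv, one_mul, hsq hw]
  rw [spinGroup.mem_iff, pinGroup.mem_iff, Unitary.mem_iff, star_mul, CliffordAlgebra.star_ι,
    CliffordAlgebra.star_ι, neg_mul_neg]
  exact ⟨⟨mul_mem (hlip hv) (hlip hw), h1 hv hw, h1 hw hv⟩,
    CliffordAlgebra.ι_mul_ι_mem_evenOdd_zero _ v w⟩

theorem spinRotor_eq (a b : Fin 7) (t : ℝ) :
    spinRotor a b t = Real.cos t • 1 + Real.sin t • (gen a * gen b) := by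
  rw [spinRotor, Algebra.algebraMap_eq_smul_one]
  rfl

theorem spinRotor_mem {a b : Fin 7} (h : a ≠ b) (t : ℝ) :
    spinRotor a b t ∈ spinGroup sumSquares7 := by
  -- A rotor is the product of the unit vectors e_a and cos t e_a + sin t e_b.
  have h1 : spinRotor a b t = CliffordAlgebra.ι sumSquares7 (Pi.single a 1) *
      CliffordAlgebra.ι sumSquares7 (Real.cos t • Pi.single a 1 + Real.sin t • Pi.single b 1) := by
    rw [spinRotor_eq, map_add, map_smul, map_smul]
    change _ = gen a * (_ • gen a + _ • gen b)
    rw [mul_add, mul_smul_comm, mul_smul_comm, isCliffordFamily_gen.sq]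
  rw [h1]
  apply ι_mul_ι_mem_spinGroup
  · rw [sumSquares7_apply]
    simp [Pi.single_apply]
  · refine (sumSquares7_apply _).trans (Eq.trans ?_ (Real.cos_sq_add_sin_sq t))
    have h2 : ∀ i, (Real.cos t • Pi.single a 1 + Real.sin t • Pi.single b 1 : Fin 7 → ℝ) i *
        (Real.cos t • Pi.single a 1 + Real.sin t • Pi.single b 1 : Fin 7 → ℝ) i =
        (if i = a then Real.cos t ^ 2 else 0) + (if i = b then Real.sin t ^ 2 else 0) := by
      intro i
      by_cases h3 : i = a <;> by_cases h4 : i = b <;> simp_all [sq]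
    refine (Finset.sum_congr rfl fun i _ => h2 i).trans ?_
    simp [Finset.sum_add_distrib]

/-- The elements that are mapped into the spin group form a subgroup. -/
def spinComap {G : Type*} [Group G] (f : G →* CliffordAlgebra sumSquares7) : Subgroup G where
  carrier := {x | f x ∈ spinGroup sumSquares7}
  mul_mem' {x y} hx hy := by
    rw [Set.mem_ofPred_eq, map_mul]
    exact mul_mem hx hy
  one_mem' := by
    rw [Set.mem_ofPred_eq, map_one]
    exact one_mem _
  inv_mem' {x} hx := by
    have h : star (f x) = f x⁻¹ := left_inv_eq_right_inv (spinGroup.star_mul_self_of_mem hx)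
      (by rw [← map_mul, mul_inv_cancel, map_one])
    rw [Set.mem_ofPred_eq, ← h]
    exact spinGroup.star_mem hx

theorem mem_spinComap {G : Type*} [Group G] {f : G →* CliffordAlgebra sumSquares7} {x : G} :
    x ∈ spinComap f ↔ f x ∈ spinGroup sumSquares7 := Iff.rfl

/-- The circle through `j`. -/
def circleJ (t : ℝ) : UnitQuaternion := mk (Real.cos t) 0 (Real.sin t) 0 (by
  linear_combination Real.cos_sq_add_sin_sq t)

/-- The circle through `k`. -/
def circleK (t : ℝ) : UnitQuaternion := mk (Real.cos t) 0 0 (Real.sin t) (by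
  linear_combination Real.cos_sq_add_sin_sq t)

theorem eq_top_of_circles {G : Subgroup UnitQuaternion} {c d : ℝ} (hc : c ≠ 0) (hd : d ≠ 0)
    (hj : ∀ t, circleJ (c * t) ∈ G) (hk : ∀ t, circleK (d * t) ∈ G) : G = ⊤ :=
  closure_circles G
    (fun t => by
      have h := hj (t / c)
      rwa [mul_div_cancel₀ t hc] at h)
    (fun t => by
      have h := hk (t / d)
      rwa [mul_div_cancel₀ t hd] at h)

/-- The circles through j and k generate the unit quaternions, so their images generate the range.
The constants allow for the rates at which the one-parameter groups are traversed. -/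
theorem range_eq_closure (f : UnitQuaternion →* Spin7) {g g' : ℝ → CliffordAlgebra sumSquares7}
    {c d : ℝ} (hc : c ≠ 0) (hd : d ≠ 0) (hj : ∀ t, (f (circleJ (c * t))).1 = g t)
    (hk : ∀ t, (f (circleK (d * t))).1 = g' t) :
    f.range = Subgroup.closure {x : Spin7 | ∃ t : ℝ, (x : CliffordAlgebra sumSquares7) = g t ∨
      (x : CliffordAlgebra sumSquares7) = g' t} := by
  apply le_antisymm
  · have h := eq_top_of_circles (G := (Subgroup.closure {x : Spin7 | ∃ t : ℝ,
      (x : CliffordAlgebra sumSquares7) = g t ∨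
      (x : CliffordAlgebra sumSquares7) = g' t}).comap f) hc hd
      (fun t => Subgroup.subset_closure ⟨t, Or.inl (hj t)⟩)
      (fun t => Subgroup.subset_closure ⟨t, Or.inr (hk t)⟩)
    rintro _ ⟨q, rfl⟩
    have : q ∈ (⊤ : Subgroup UnitQuaternion) := Subgroup.mem_top q
    rw [← h] at this
    exact this
  · rw [Subgroup.closure_le]
    rintro x ⟨t, h | h⟩
    · exact ⟨_, Subtype.ext ((hj t).trans h.symm)⟩
    · exact ⟨_, Subtype.ext ((hk t).trans h.symm)⟩

/-- Arranged so that for x = cos t, y = sin t the coefficients become those of a quaternion on the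
circle through j at angle 2t. -/
theorem rotor_mul_rotor {R : Type*} [Ring R] [Algebra ℝ R] {e : Fin 7 → R}
    (he : IsCliffordFamily e) {a b c d : Fin 7} (hbc : c ≠ b) (x y : ℝ) :
    (x • 1 + y • (e a * e c)) * (x • 1 + y • (e b * e d)) =
      ((x ^ 2 + y ^ 2) / 2) • (1 - e a * (e b * (e c * e d))) +
      ((x ^ 2 - y ^ 2) / 2) • (1 + e a * (e b * (e c * e d))) +
      (x * y) • (e a * e c + e b * e d) := by
  simp only [mul_add, add_mul, smul_mul_smul_comm, mul_one, one_mul, mul_assoc]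
  rw [he.anticomm_assoc hbc, mul_neg]
  module

theorem rotor_mul_rotor_neg {R : Type*} [Ring R] [Algebra ℝ R] {e : Fin 7 → R}
    (he : IsCliffordFamily e) {a b c d : Fin 7} (hbd : d ≠ b) (hcd : d ≠ c) (x y : ℝ) :
    (x • 1 + y • (e a * e d)) * (x • 1 + (-y) • (e b * e c)) =
      ((x ^ 2 + y ^ 2) / 2) • (1 - e a * (e b * (e c * e d))) +
      ((x ^ 2 - y ^ 2) / 2) • (1 + e a * (e b * (e c * e d))) +
      (-(x * y)) • (e b * e c - e a * e d) := by
  simp only [mul_add, add_mul, smul_mul_smul_comm, mul_one, one_mul, mul_assoc]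
  rw [he.anticomm_assoc hbd, he.anticomm hcd]
  simp only [mul_neg, neg_neg]
  module

/-- The representation of `SU(3)` in the Clifford algebra. -/
def repSU3 : SU3 →* CliffordAlgebra sumSquares7 :=
  isCliffordFamily_gen.rep₃.completion.comp (Matrix.specialUnitaryGroup (Fin 3) ℂ).subtype

/-- The representation of `U_2(ℍ)` in the Clifford algebra. -/
def repU2H : U2H →* CliffordAlgebra sumSquares7 :=
  isCliffordFamily_gen.rep₂.completion.comp
    (unitary (Matrix (Fin 2) (Fin 2) (Quaternion ℝ))).subtype

theorem half_eq (t : ℝ) : (1 / 2 : ℝ) = (Real.cos t ^ 2 + Real.sin t ^ 2) / 2 := by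
  rw [Real.cos_sq_add_sin_sq]

theorem repSU3_upper_circleJ (t : ℝ) :
    repSU3 (SU3.upper (circleJ (2 * t))) = spinRotor 0 2 t * spinRotor 1 3 t := by
  rw [spinRotor_eq, spinRotor_eq, rotor_mul_rotor isCliffordFamily_gen (by decide)]
  refine (isCliffordFamily_gen.rep₃_upper _).trans ?_
  rw [half_eq t]
  simp [circleJ, Real.cos_two_mul', Real.sin_two_mul]
  module

theorem repSU3_upper_circleK (t : ℝ) :
    repSU3 (SU3.upper (circleK (-2 * t))) = spinRotor 0 3 t * spinRotor 1 2 (-t) := by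
  rw [spinRotor_eq, spinRotor_eq, Real.sin_neg, Real.cos_neg,
    rotor_mul_rotor_neg isCliffordFamily_gen (by decide) (by decide)]
  refine (isCliffordFamily_gen.rep₃_upper _).trans ?_
  rw [half_eq t]
  simp [circleK, Real.cos_two_mul', Real.sin_two_mul]
  module

theorem repSU3_lower_circleJ (t : ℝ) :
    repSU3 (SU3.lower (circleJ (2 * t))) = spinRotor 2 4 t * spinRotor 3 5 t := by
  rw [spinRotor_eq, spinRotor_eq, rotor_mul_rotor isCliffordFamily_gen (by decide)]
  refine (isCliffordFamily_gen.rep₃_lower _).trans ?_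
  rw [half_eq t]
  simp [circleJ, Real.cos_two_mul', Real.sin_two_mul]
  module

theorem repSU3_lower_circleK (t : ℝ) :
    repSU3 (SU3.lower (circleK (-2 * t))) = spinRotor 2 5 t * spinRotor 3 4 (-t) := by
  rw [spinRotor_eq, spinRotor_eq, Real.sin_neg, Real.cos_neg,
    rotor_mul_rotor_neg isCliffordFamily_gen (by decide) (by decide)]
  refine (isCliffordFamily_gen.rep₃_lower _).trans ?_
  rw [half_eq t]
  simp [circleK, Real.cos_two_mul', Real.sin_two_mul]
  module

theorem repU2H_long (q : UnitQuaternion) : repU2H (U2H.long q) = repSU3 (SU3.lower q) :=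
  (isCliffordFamily_gen.rep₂_long q).trans (isCliffordFamily_gen.rep₃_lower q).symm

theorem repU2H_short_circleJ (t : ℝ) :
    repU2H (U2H.short (circleJ (1 * t))) = spinRotor 5 6 t := by
  rw [spinRotor_eq]
  refine (isCliffordFamily_gen.rep₂_short _).trans ?_
  simp [circleJ]

theorem repU2H_short_circleK (t : ℝ) :
    repU2H (U2H.short (circleK (-1 * t))) = spinRotor 4 6 t := by
  rw [spinRotor_eq]
  refine (isCliffordFamily_gen.rep₂_short _).trans ?_
  simp [circleK]

theorem repSU3_upper_mem (q : UnitQuaternion) :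
    repSU3 (SU3.upper q) ∈ spinGroup sumSquares7 := by
  have h := eq_top_of_circles (G := spinComap (repSU3.comp SU3.upper)) two_ne_zero
    (neg_ne_zero.2 two_ne_zero)
    (fun t => by
      rw [mem_spinComap, MonoidHom.comp_apply, repSU3_upper_circleJ]
      exact mul_mem (spinRotor_mem (by decide) t) (spinRotor_mem (by decide) t))
    (fun t => by
      rw [mem_spinComap, MonoidHom.comp_apply, repSU3_upper_circleK]
      exact mul_mem (spinRotor_mem (by decide) t) (spinRotor_mem (by decide) _))
  exact mem_spinComap.1 (h ▸ Subgroup.mem_top q : q ∈ spinComap (repSU3.comp SU3.upper))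

theorem repSU3_lower_mem (q : UnitQuaternion) :
    repSU3 (SU3.lower q) ∈ spinGroup sumSquares7 := by
  have h := eq_top_of_circles (G := spinComap (repSU3.comp SU3.lower)) two_ne_zero
    (neg_ne_zero.2 two_ne_zero)
    (fun t => by
      rw [mem_spinComap, MonoidHom.comp_apply, repSU3_lower_circleJ]
      exact mul_mem (spinRotor_mem (by decide) t) (spinRotor_mem (by decide) t))
    (fun t => by
      rw [mem_spinComap, MonoidHom.comp_apply, repSU3_lower_circleK]
      exact mul_mem (spinRotor_mem (by decide) t) (spinRotor_mem (by decide) _))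
  exact mem_spinComap.1 (h ▸ Subgroup.mem_top q : q ∈ spinComap (repSU3.comp SU3.lower))

theorem repU2H_short_mem (q : UnitQuaternion) :
    repU2H (U2H.short q) ∈ spinGroup sumSquares7 := by
  have h := eq_top_of_circles (G := spinComap (repU2H.comp U2H.short)) one_ne_zero
    (neg_ne_zero.2 one_ne_zero)
    (fun t => by
      rw [mem_spinComap, MonoidHom.comp_apply, repU2H_short_circleJ]
      exact spinRotor_mem (by decide) t)
    (fun t => by
      rw [mem_spinComap, MonoidHom.comp_apply, repU2H_short_circleK]
      exact spinRotor_mem (by decide) t)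
  exact mem_spinComap.1 (h ▸ Subgroup.mem_top q : q ∈ spinComap (repU2H.comp U2H.short))

theorem repSU3_mem (x : SU3) : repSU3 x ∈ spinGroup sumSquares7 := by
  have h : SU3.upper.range ⊔ SU3.lower.range ≤ spinComap repSU3 := sup_le
    (by rintro _ ⟨q, rfl⟩; exact repSU3_upper_mem q)
    (by rintro _ ⟨q, rfl⟩; exact repSU3_lower_mem q)
  rw [SU3.range_upper_sup_range_lower] at h
  exact h (Subgroup.mem_top x)

/-- Only the generated subgroup is claimed to map into the spin group, so the check reduces to the
root subgroups. -/
theorem repU2H_mem (x : genSubgroup U2H.long U2H.short) : repU2H x ∈ spinGroup sumSquares7 := by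
  have h : genSubgroup U2H.long U2H.short ≤ spinComap repU2H := sup_le
    (by
      rintro _ ⟨q, rfl⟩
      rw [mem_spinComap, repU2H_long]
      exact repSU3_lower_mem q)
    (by rintro _ ⟨q, rfl⟩; exact repU2H_short_mem q)
  exact h x.2

/-- The simple root subgroups of `Spin(7)`. -/
def rootEmbedding : RootEmbedding spinRootSubgroup (genLeft U2H.long U2H.short)
    (genRight U2H.long U2H.short) where
  φ := repSU3.codRestrict (spinGroup sumSquares7) repSU3_mem
  χ := (repU2H.comp (genSubgroup U2H.long U2H.short).subtype).codRestrict (spinGroup sumSquares7)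
    repU2H_mem
  φ_injective x y h := Subtype.ext (NonUnitalRingHom.completion_injective
    isCliffordFamily_gen.rep₃_injective (congrArg Subtype.val h))
  χ_injective x y h := Subtype.ext (Subtype.ext (NonUnitalRingHom.completion_injective
    isCliffordFamily_gen.rep₂_injective (congrArg Subtype.val h)))
  range_zero := range_eq_closure _ two_ne_zero (neg_ne_zero.2 two_ne_zero) repSU3_upper_circleJ
    repSU3_upper_circleK
  range_one := range_eq_closure _ two_ne_zero (neg_ne_zero.2 two_ne_zero) repSU3_lower_circleJ
    repSU3_lower_circleK
  range_two := by
    refine (range_eq_closure _ one_ne_zero (neg_ne_zero.2 one_ne_zero) repU2H_short_circleJ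
      repU2H_short_circleK).trans ?_
    -- The circle through j gives e₅e₆ and the circle through k gives e₄e₆, the reverse of the order
    -- in the definition.
    simp only [or_comm]
    rfl
  φ_lower q := Subtype.ext (repU2H_long q).symm
  commute q q' := Subtype.ext (isCliffordFamily_gen.commute_rep q q')
  ne h := isCliffordFamily_gen.rep_ne (congrArg Subtype.val h)

end Spin7

end

theorem mainTheorem3 (Δ : DiagramRankThree) (A : GroupAmalgam.{u} (Sym2 (Fin 3)))
    (hA : IsPhanAmalgam Δ.rootSubgroup A)
    (hunambiguous : IsUnambiguous Δ.rootSubgroup A)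
    (hnoncollapsing : IsStronglyNoncollapsing A) :
    Nonempty (A.Iso (standardAmalgam Δ.rootSubgroup)) := by
  cases Δ with
  | A₃ =>
    exact SU4.rootEmbedding.nonempty_iso SU3.isRankTwoModel
      SU3.range_upper_sup_range_lower hA hunambiguous hnoncollapsing
  | B₃ =>
    exact Spin7.rootEmbedding.nonempty_iso U2H.isRankTwoModel_long_short.gen
      (range_genLeft_sup_range_genRight _ _) hA hunambiguous hnoncollapsing
  | C₃ =>
    exact U3H.rootEmbedding.nonempty_iso U2H.isRankTwoModel_short_long.gen
      (range_genLeft_sup_range_genRight _ _) hA hunambiguous hnoncollapsing
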